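/- **Setting.** A Hamiltonian is a multilinear polynomial $\psi(x)=\sum_{S\subseteq[n]}\widehat\psi(S)\prod_{i\in S}x_i$ on $\{-1,1\}^n$, and $\mu_\psi(x)\propto e^{\psi(x)}$. Write $i\sim j$ if $\partial_i\psi$ depends on $x_j$; this defines the minimal dependency graph $G$. $\mu_\psi$ is a $(k,d,\alpha,\lambda)$-MRF if $\deg\psi\le k$; every $\partial_i\psi$ depends on at most $d$ variables; whenever $i\sim j$ there is a maximal monomial $K\ni i,j$ of $\psi$ (i.e. $\widehat\psi(K)\ne0$ and $\widehat\psi(K')=0$ for all $K'\supsetneq K$) with $|\widehat\psi(K)|\ge\alpha$; and $\sum_{K\ni i}|\widehat\psi(K)|\le\lambda$ for every $i$. In the continuous-time Glauber dynamics $(X^t)_{t\ge0}$ the sites have independent rate-$1$ Poisson update times, independent of the initial configuration, which has an arbitrary law; when site $i$ is updated it becomes $1$ with conditional probability $\sigma(2\partial_i\psi(X_{-i}))$, $\sigma(z)=1/(1+e^{-z})$, and $-1$ otherwise. **Algorithm 1** $(k,d,\alpha,\lambda,\delta)$ for $n$ sites. Put $$q=\tfrac12\Big(\tfrac{e^{-2\lambda}}{2d}\Big)^{\max(k-2,0)},\quad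 L=\tfrac{\alpha^2qe^{-6\lambda}}{64d},\quad \kappa=\tfrac{5\alpha^2q}{64}e^{-6\lambda},\quad q'=\tfrac{L^5}{6^5},$$ $$M=\Big\lceil\tfrac{2000\log(2n^2/\delta)}{\kappa^2}\Big\rceil,\quad r=\Big\lceil\tfrac{\log(2\max\{1,2(k-2)\})}{L}\Big\rceil,\quad T=L\,(Mr+2M/q').$$ For a pair $i<j$ of observed sites and $\ell\ge0$ let $C^{(\ell)}$ be the event that, in the three consecutive thirds of $[(\ell+r-1)L,(\ell+r)L]$: in the first and in the last third $i$ updates at least twice and $j$ does not; in the middle third $j$ updates and $i$ does not. Let $\tau_1=\min\{\ell\ge r:C^{(\ell)}\}$ and $\tau_{s+1}=\min\{\ell\ge\tau_s+r:C^{(\ell)}\}$. Let $Z^{(\ell)}=Y_1Y_2-2Y_1Y_1'+Y_1'Y_2'$, where $Y_1,Y_2$ (resp. $Y_1',Y_2'$) indicate whether the first two updates of $i$ in the first (resp. last) third have the value $1$. If for some pair fewer than $M$ stopping times satisfy $(\tau_s+r)L\le T$, the algorithm fails; otherwise it returns the graph of those pairs for which $\frac1M\sum_{s=1}^MZ^{(\tau_s)}\ge\kappa$.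 The observed update times and values of each site are given as a list ordered by time, and the running time counts elementary operations of a real random access machine. **Statement.** 1. Let $k\ge 0$ and $d\ge1$ be integers and $0<\alpha\le\lambda$. There is a constant $C=C(k,d,\alpha,\lambda)>0$ such that for all $n\ge2$ and $0<\delta\le1$ one has $T\le C\log(n/\delta)$, and for every $(k,d,\alpha,\lambda)$-MRF $\mu_\psi$ on $\{-1,1\}^n$, every set $S\subseteq[n]$ of observed sites and every law of the initial configuration: given the Glauber trajectory on $[0,T]$ restricted to the updates of the sites in $S$, with probability at least $1-\delta$ Algorithm 1 returns exactly the induced dependency graph $G[S]$, and does so in at most $C\,n^2\log(n/\delta)$ steps. 2. Independent samples do not suffice. Let $n\geq 1$, $v\in[n]$, $S=[n]\setminus\{v\}$, $\psi_1(x)=\prod_{i=1}^nx_i$ and $\psi_2(x)=1$. Then $(X_i)_{i\in S}$ is uniform on $\{-1,1\}^{S}$ both under $\mu_{\psi_1}$ and under $\mu_{\psi_2}$. If $n\ge3$, then both are $(n,n-1,1,1)$-MRFs, their induced dependency graphs $G_1[S]$ and $G_2[S]$ differ, and for every $m$ and every (possibly randomized) estimator of $G[S]$ from $m$ independent samples of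 $(X_i)_{i\in S}$, the probability of returning $G_1[S]$ under $\mu_{\psi_1}$ and the probability of returning $G_2[S]$ under $\mu_{\psi_2}$ add up to at most $1$. -/

import Mathlib

open MeasureTheory

noncomputable section

namespace GlauberMRF

/-! ## Multilinear Hamiltonians and Markov random fields -/

/-- Spin configurations, i.e. points of `{-1, 1}^n`. -/
abbrev Config (n : ℕ) : Type := Fin n → ℤˣ

/-- A function `{-1, 1}^n → ℝ`, given by the coefficients of its unique multilinear expansion
`∑_S (ψ S) ∏_{i ∈ S} x_i`. -/
abbrev Hamiltonian (n : ℕ) : Type := Finset (Fin n) → ℝ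

variable {n : ℕ}

/-- The value of a multilinear polynomial at a configuration. -/
def Hamiltonian.eval (f : Hamiltonian n) (x : Config n) : ℝ :=
  ∑ S : Finset (Fin n), f S * ∏ i ∈ S, ((x i : ℤ) : ℝ)

/-- The `i`-th partial derivative; it does not involve the variable `x_i`. -/
def Hamiltonian.deriv (i : Fin n) (f : Hamiltonian n) : Hamiltonian n :=
  fun S => if i ∈ S then 0 else f (insert i S)

/-- The set of variables that appear in the multilinear expansion. -/
def Hamiltonian.supp (f : Hamiltonian n) : Finset (Fin n) :=
  (Finset.univ.filter fun S : Finset (Fin n) => f S ≠ 0).biUnion id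

/-- `S` is a maximal monomial of `f`. -/
def Hamiltonian.IsMaximalMonomial (f : Hamiltonian n) (S : Finset (Fin n)) : Prop :=
  f S ≠ 0 ∧ ∀ T : Finset (Fin n), S ⊂ T → f T = 0

/-- The minimal dependency graph: `i ∼ j` iff `∂_i ψ` depends on `x_j`. -/
def dependencyGraph (ψ : Hamiltonian n) : SimpleGraph (Fin n) where
  Adj i j := j ∈ (ψ.deriv i).supp
  symm := ⟨by
    intro i j h
    obtain ⟨S, hS, hj⟩ := Finset.mem_biUnion.mp h
    replace hS : (if i ∈ S then 0 else ψ (insert i S)) ≠ 0 := (Finset.mem_filter.mp hS).2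
    replace hj : j ∈ S := hj
    have hi : i ∉ S := fun hi => hS (if_pos hi)
    have hij : j ≠ i := fun e => hi (e ▸ hj)
    refine Finset.mem_biUnion.mpr ⟨insert i (S.erase j),
      Finset.mem_filter.mpr ⟨Finset.mem_univ _, ?_⟩, Finset.mem_insert_self _ _⟩
    change (if j ∈ insert i (S.erase j) then 0 else ψ (insert j (insert i (S.erase j)))) ≠ 0
    rw [if_neg (by simp [hij]), Finset.insert_comm, Finset.insert_erase hj]
    rwa [if_neg hi] at hS⟩
  loopless := ⟨by
    intro i h
    obtain ⟨S, hS, hi⟩ := Finset.mem_biUnion.mp h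
    exact (Finset.mem_filter.mp hS).2 (if_pos hi)⟩

/-- The Hamiltonian `ψ` defines a `(k, d, α, lam)`-Markov random field. -/
structure IsMRF (k d : ℕ) (α lam : ℝ) (ψ : Hamiltonian n) : Prop where
  /-- low polynomial degree -/
  degree_le : ∀ S : Finset (Fin n), ψ S ≠ 0 → S.card ≤ k
  /-- bounded vertex degree: every `∂_i ψ` is a `d`-junta -/
  junta : ∀ i : Fin n, (ψ.deriv i).supp.card ≤ d
  /-- nontrivial edge coefficients -/
  edge_coeff : ∀ i j : Fin n, (dependencyGraph ψ).Adj i j →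
    ∃ S : Finset (Fin n), ψ.IsMaximalMonomial S ∧ i ∈ S ∧ j ∈ S ∧ α ≤ |ψ S|
  /-- bounded width: the Fourier `1`-norm of every `∂_i ψ` is at most `lam` -/
  width_le : ∀ i : Fin n, ∑ S : Finset (Fin n), |ψ.deriv i S| ≤ lam

/-- The induced dependency graph `G[S]`. -/
def inducedGraph (ψ : Hamiltonian n) (S : Finset (Fin n)) : SimpleGraph S :=
  (dependencyGraph ψ).comap Subtype.val

/-- The Markov random field `μ_ψ(x) ∝ exp (ψ x)`. -/
def mrf (ψ : Hamiltonian n) : PMF (Config n) :=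
  PMF.normalize (fun x => ENNReal.ofReal (Real.exp (ψ.eval x)))
    (fun h => (ENNReal.ofReal_pos.mpr (Real.exp_pos _)).ne'
      (ENNReal.tsum_eq_zero.mp h fun _ => 1))
    (by
      rw [tsum_fintype]
      exact ENNReal.sum_ne_top.mpr fun _ _ => ENNReal.ofReal_ne_top)

/-- The law of `(X_i)_{i ∈ S}` for `X ∼ μ_ψ`. -/
def marginal (ψ : Hamiltonian n) (S : Finset (Fin n)) : PMF (S → ℤˣ) :=
  (mrf ψ).map fun x i => x i

/-! ## Continuous-time Glauber dynamics

The dynamics is built from its driving randomness: an initial configuration, and for every site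
`i` independent `Exp(1)` waiting times between the successive updates of `i` (so the update times
of the sites are independent Poisson processes of rate `1`) and independent uniform marks that
decide the outcomes of these updates. The `m`-th update of site `i`, `m = 0, 1, …`, is indexed by
the pair `(i, m)`. -/

/-- Initial configuration, waiting times, marks. -/
abbrev Noise (n : ℕ) : Type :=
  Config n × ((Fin n × ℕ → ℝ) × (Fin n × ℕ → unitInterval))

/-- The exponential distribution of rate `1`. -/
def stdExp : Measure ℝ := ProbabilityTheory.expMeasure 1

instance : IsProbabilityMeasure stdExp :=
  ProbabilityTheory.isProbabilityMeasure_expMeasure one_pos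

/-- The law of the driving randomness, for an initial configuration with law `ν`. -/
def noiseLaw (ν : Measure (Config n)) : Measure (Noise n) :=
  ν.prod ((Measure.infinitePi fun _ : Fin n × ℕ => stdExp).prod
    (Measure.infinitePi fun _ : Fin n × ℕ => (volume : Measure unitInterval)))

/-- The time of the `m`-th update of site `i`. -/
def updateTime (ω : Noise n) (e : Fin n × ℕ) : ℝ :=
  ∑ m ∈ Finset.range (e.2 + 1), ω.2.1 (e.1, m)

open Classical in
/-- The (almost surely finitely many) updates up to time `t`. -/
def updatesUpTo (ω : Noise n) (t : ℝ) : Finset (Fin n × ℕ) :=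
  if h : {e | updateTime ω e ≤ t}.Finite then h.toFinset else ∅

/-- The updates up to time `t` in chronological order (ties have probability zero). -/
def updateList (ω : Noise n) (t : ℝ) : List (Fin n × ℕ) :=
  (updatesUpTo ω t).toList.mergeSort fun e e' => decide (updateTime ω e ≤ updateTime ω e')

/-- One Glauber update: site `e.1` becomes `1` with probability `σ(2 ∂_i ψ(x_{-i}))`, `i = e.1`,
and `-1` otherwise. -/
def glauberStep (ψ : Hamiltonian n) (ω : Noise n) (x : Config n) (e : Fin n × ℕ) : Config n :=
  Function.update x e.1
    (if (ω.2.2 e : ℝ) ≤ Real.sigmoid (2 * (ψ.deriv e.1).eval x) then 1 else -1)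

/-- The configuration `X^t`. -/
def glauber (ψ : Hamiltonian n) (ω : Noise n) (t : ℝ) : Config n :=
  (updateList ω t).foldl (glauberStep ψ ω) ω.1

/-- The number of updates of site `i` up to time `T`. -/
def numUpdates (ω : Noise n) (T : ℝ) (i : Fin n) : ℕ :=
  Set.ncard {m : ℕ | updateTime ω (i, m) ≤ T}

/-- What is seen of one site: the ordered list of its update times, each with the value the site
takes there (whether or not this value is new). -/
abbrev SiteRecord : Type := List (ℝ × ℤˣ)

/-- The record of site `i` up to time `T`. -/
def siteRecord (ψ : Hamiltonian n) (ω : Noise n) (T : ℝ) (i : Fin n) : SiteRecord :=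
  (List.range (numUpdates ω T i)).map fun m =>
    (updateTime ω (i, m), glauber ψ ω (updateTime ω (i, m)) i)

/-- The trajectory up to time `T`, restricted to the updates of the sites in `S`. -/
def observation (ψ : Hamiltonian n) (S : Finset (Fin n)) (T : ℝ) (ω : Noise n) :
    List (S × SiteRecord) :=
  ((Finset.univ : Finset S).sort (· ≤ ·)).map fun i => (i, siteRecord ψ ω T i)

/-! ## Step counting

Programs are written in the monad `Timed`, which carries the number of elementary operations
executed so far. The elementary operations are those of a real random access machine: arithmetic,
comparison, assignment and branching on integers and reals, (in the initialization only) `exp`,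
`log` and rounding of a real, and reading, testing for emptiness and extending a list at its
head. -/

/-- A result together with the number of elementary operations spent on it. -/
structure Timed (β : Type) where
  /-- the result -/
  val : β
  /-- the number of elementary operations -/
  cost : ℕ

instance : Monad Timed where
  pure b := ⟨b, 0⟩
  bind x f := ⟨(f x.val).val, x.cost + (f x.val).cost⟩

/-- Charge `c` elementary operations. -/
def tick (c : ℕ) : Timed Unit := ⟨(), c⟩

/-! ## The algorithm -/

/-- The lower bound `q` on the probability that the mixed derivative is large. -/
def qBurn (k d : ℕ) (lam : ℝ) : ℝ := 1 / 2 * (Real.exp (-2 * lam) / (2 * d)) ^ (k - 2)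

/-- The block length `L`. -/
def blockLength (k d : ℕ) (α lam : ℝ) : ℝ :=
  α ^ 2 * qBurn k d lam * Real.exp (-6 * lam) / (64 * d)

/-- The threshold `κ`. -/
def threshold (k d : ℕ) (α lam : ℝ) : ℝ :=
  5 * α ^ 2 * qBurn k d lam / 64 * Real.exp (-6 * lam)

/-- The lower bound `L⁵ / 6⁵` on the probability of a good window. -/
def qGood (k d : ℕ) (α lam : ℝ) : ℝ := blockLength k d α lam ^ 5 / 6 ^ 5

/-- The number `M` of stopping times that are used. -/
def numStops (n k d : ℕ) (α lam δ : ℝ) : ℕ :=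
  ⌈2000 * Real.log (2 * (n : ℝ) ^ 2 / δ) / threshold k d α lam ^ 2⌉₊

/-- The number `r` of blocks in a window. -/
def windowBlocks (k d : ℕ) (α lam : ℝ) : ℕ :=
  ⌈Real.log (2 * max 1 (2 * ((k : ℝ) - 2))) / blockLength k d α lam⌉₊

/-- The length `T = L (M r + 2 M / q)` of the trajectory. -/
def horizon (n k d : ℕ) (α lam δ : ℝ) : ℝ :=
  blockLength k d α lam * (numStops n k d α lam δ * windowBlocks k d α lam +
    2 * numStops n k d α lam δ / qGood k d α lam)

/-- The quantities that the main loops use. -/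
structure Params where
  /-- block length `L` -/
  L : ℝ
  /-- threshold `κ` -/
  κ : ℝ
  /-- number `M` of stopping times -/
  M : ℕ
  /-- number `r` of blocks per window -/
  r : ℕ
  /-- number of full blocks in `[0, T]` -/
  blocks : ℕ

/-- The initialization. -/
def params (n k d : ℕ) (α lam δ : ℝ) : Params where
  L := blockLength k d α lam
  κ := threshold k d α lam
  M := numStops n k d α lam δ
  r := windowBlocks k d α lam
  blocks := ⌊horizon n k d α lam δ / blockLength k d α lam⌋₊

/-- Split an ordered record into the part before time `c` and the rest. -/
def splitBefore (c : ℝ) : SiteRecord → Timed (SiteRecord × SiteRecord)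
  | [] => do
    tick 2
    return ([], [])
  | e :: es => do
    tick 4
    if e.1 < c then
      let p ← splitBefore c es
      return (e :: p.1, p.2)
    else
      return ([], e :: es)

/-- The indicator of the value `1`. -/
def ind (s : ℤˣ) : ℝ := if s = 1 then 1 else 0

/-- `a₁ a₂ a₃` and `b₁ b₂ b₃` are the records of sites `i` and `j` in the three thirds of the
last block of a window. If the event `C` holds (`i` updates at least twice in the first and
in the last third but not in the middle one, where `j` updates, and `j` does not update in the
outer two), return the statistic `Z = Y₁ Y₂ - 2 Y₁ Y₁' + Y₁' Y₂'`, otherwise `none`. -/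
def statistic : (a₁ a₂ a₃ b₁ b₂ b₃ : SiteRecord) → Option ℝ
  | y₁ :: y₂ :: _, [], y₁' :: y₂' :: _, [], _ :: _, [] =>
    some (ind y₁.2 * ind y₂.2 - 2 * ind y₁.2 * ind y₁'.2 + ind y₁'.2 * ind y₂'.2)
  | _, _, _, _, _, _ => none

/-- The linear scan through the blocks `[b L, (b+1) L]`, for one pair `i, j`, with the parts
`A`, `B` of their records from time `b L` on. The window `I^(ℓ) = [ℓ L, (ℓ + r) L]` that ends
with block `b` has `ℓ = b + 1 - r`. If `ℓ ≥ next` and `C^(ℓ)` holds then `ℓ` is the next stopping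
time: its statistic is added to `sum`, and from then on `next = ℓ + r = b + 1`. The argument `s`
is the number of stopping times found so far. The result is `∑_{ℓ ≤ M} Z^(τ_ℓ)`, or `none` if
fewer than `M` stopping times have their windows inside the trajectory. The first argument is the
number of blocks that are left. -/
def scan (p : Params) : (blocksLeft b next s : ℕ) → (sum : ℝ) → (A B : SiteRecord) →
    Timed (Option ℝ)
  | 0, _, _, s, sum, _, _ => do
    tick 2
    return if p.M ≤ s then some sum else none
  | left + 1, b, next, s, sum, A, B => do
    tick 50
    if p.M ≤ s then
      return some sum
    else
      let A₁ ← splitBefore ((b + 1 / 3) * p.L) A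
      let A₂ ← splitBefore ((b + 2 / 3) * p.L) A₁.2
      let A₃ ← splitBefore ((b + 1) * p.L) A₂.2
      let B₁ ← splitBefore ((b + 1 / 3) * p.L) B
      let B₂ ← splitBefore ((b + 2 / 3) * p.L) B₁.2
      let B₃ ← splitBefore ((b + 1) * p.L) B₂.2
      if next + p.r ≤ b + 1 then
        match statistic A₁.1 A₂.1 A₃.1 B₁.1 B₂.1 B₃.1 with
        | some z => scan p left (b + 1) (b + 1) (s + 1) (sum + z) A₃.2 B₃.2
        | none => scan p left (b + 1) next s sum A₃.2 B₃.2
      else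
        scan p left (b + 1) next s sum A₃.2 B₃.2

/-- The decision for one pair: `none` if there are fewer than `M` stopping times, otherwise
whether `(1/M) ∑_{ℓ ≤ M} Z^(τ_ℓ) ≥ κ`. The first stopping time is at least `r`. -/
def testPair (p : Params) (A B : SiteRecord) : Timed (Option Bool) := do
  let total ← scan p p.blocks 0 p.r 0 0 A B
  tick 4
  return total.map fun z => decide (p.κ ≤ z / p.M)

/-- The inner loop: compare the site `i` with the remaining sites. -/
def testRow {V : Type} (p : Params) (i : V) (A : SiteRecord) :
    List (V × SiteRecord) → List (V × V) → Timed (Option (List (V × V)))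
  | [], E => do
    tick 2
    return some E
  | (j, B) :: rest, E => do
    tick 5
    match ← testPair p A B with
    | none => return none
    | some true => testRow p i A rest ((i, j) :: E)
    | some false => testRow p i A rest E

/-- The outer loop. -/
def testAll {V : Type} (p : Params) :
    List (V × SiteRecord) → List (V × V) → Timed (Option (List (V × V)))
  | [], E => do
    tick 2
    return some E
  | (i, A) :: rest, E => do
    tick 4
    match ← testRow p i A rest E with
    | none => return none
    | some E' => testAll p rest E'

/-- The algorithm `FindMarkovBlanket(k, d, α, λ, δ)`, run on the records of the sites in `V`. It
returns the list of edges found, or `none` (failure). The initialization evaluates a fixed number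
of closed expressions, one of which is a power with exponent `k - 2`. -/
def findMarkovBlanket {V : Type} (n k d : ℕ) (α lam δ : ℝ) (obs : List (V × SiteRecord)) :
    Timed (Option (List (V × V))) := do
  tick (100 + k)
  testAll (params n k d α lam δ) obs []

/-- The graph with a given list of edges. -/
def edgeGraph {V : Type} (E : List (V × V)) : SimpleGraph V :=
  SimpleGraph.fromRel fun i j => (i, j) ∈ E

/-- The run of the algorithm on the trajectory of length `T`, observed on `S` only. -/
def run (k d : ℕ) (α lam δ : ℝ) (ψ : Hamiltonian n) (S : Finset (Fin n)) (ω : Noise n) :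
    Timed (Option (List (S × S))) :=
  findMarkovBlanket n k d α lam δ (observation ψ S (horizon n k d α lam δ) ω)

/-! ## Learning from independent samples -/

/-- The parity Hamiltonian `ψ₁(x) = ∏ x_i`. -/
def parity (n : ℕ) : Hamiltonian n := fun S => if S = Finset.univ then 1 else 0

/-- The sites other than `v`. -/
def others (v : Fin n) : Finset (Fin n) := Finset.univ.erase v

/-- The constant Hamiltonian `ψ₂(x) = 1`. -/
def constOne (n : ℕ) : Hamiltonian n := fun S => if S = ∅ then 1 else 0

/-- The probability that the (possibly randomized) estimator `A` returns `G[S]`, when it is given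
`m` independent samples of `(X_i)_{i ∈ S}`, `X ∼ μ_ψ`. -/
def iidSuccess (ψ : Hamiltonian n) (S : Finset (Fin n)) (m : ℕ)
    (A : (Fin m → S → ℤˣ) → PMF (SimpleGraph S)) : ENNReal :=
  ∑ x : Fin m → S → ℤˣ, (∏ t, marginal ψ S (x t)) * A x (inducedGraph ψ S)

end GlauberMRF

end

open GlauberMRF

/-! Fix a pair `i`, `j`, put `ε = d L`, and let `p(x) = σ(2 ∂_i ψ(x))` be the update probability of
`i`. Call a block with the event `C` calm if no neighbour of `i` other than `j` is updated in it. On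
a calm block `p` has one value during the first third and one value `p'` during the last, so the
four spins in `Z` behave like independent coins with parameters `p, p, p', p'`, and `Z` has mean `E
(p - p')²` (`avg3_calm`). If `i` and `j` are not adjacent, then `p' = p` and the mean is zero. If
they are adjacent, the updates of `j` in the middle third leave its spin flipped with probability at
least `e^{-2λ}/2`, and a flip moves `p` by at least `e^{-2λ} |∂_i ∂_j ψ|`. Since clocks of different
sites are independent, a block with `C` fails to be calm with conditional probability at most `1 -
e^{-dL} ≤ ε`, and `-2 ≤ Z ≤ 1` always. So, given `C`, the mean of `Z` is at most `ε` for
non-adjacent pairs (`avg3_stat_le_of_not_adj`) and at least `(1 - ε) (e^{-6λ}/2) (∂_i ∂_j ψ)² - 2 ε`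
for adjacent ones (`le_avg3_stat`), with the derivative taken at the start of the block.

That derivative may vanish at an unlucky configuration; the `r - 1` earlier blocks of the window
serve as burn-in. Let `K` be a maximal monomial through `i` and `j`. Differentiating along its
variables one by one leads from `∂_i ∂_j ψ` to the nonzero constant `ψ K`. If `a` is updated and the
other variables of `f` are not, both values of `x_a` are likely, so the second moment of `f` is
bounded below by a multiple of `(∂_a f)²` (`burnIn_step`). Suitably weighted squares of the
successive derivatives therefore pass the size of the last one down to the first
(`admissible_burnPot`, `Above.relax`), and after the burn-in the mean of `(∂_i ∂_j ψ)²` is at least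
`α² q`. With the chosen parameters this makes the mean of `Z` about `30 ε`, against `κ = 5 ε`.

The blocks of a window may already have been inspected and rejected, so the burn-in happens under
conditioning. But `C` concerns only the update times of `i` and `j`, and the derivatives used
contain neither variable. The growth therefore holds jointly with any pattern of updates of `i` and
`j`, and this is what `Admissible` demands.

The statistics at the stopping times are dependent; their sum is controlled by backward induction on
the blocks with exponential weights: `scanProb_none_le` for too few stopping times,
`scanProb_upper_le` for non-adjacent pairs, and `exists_potential` for adjacent pairs, where the
induction carries a burn-in potential along. A union bound over pairs finishes the argument.

The inductions need the Markov property. By memorylessness of the exponential law, noise that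
follows one sample before time `h` and an independent one afterwards has the original law
(`measurePreserving_splice`); this gives `driveLaw_restart`. Within one time step the marks are
integrated out first (`integral_runTrace`), and what remains are counts of independent Poisson
clocks (`clockLaw_level_inter`).

For independent samples, summing the density of the parity model over `x_v` gives the same value `e
+ e^{-1}`, up to normalization, at every observed configuration. The two models are thus
indistinguishable. -/

noncomputable section

namespace GlauberMRF

variable {n : ℕ}

/-! ## Enumerations of the updates and restart of the driving noise -/

/-- The waiting times of all sites. -/
abbrev Clocks (n : ℕ) : Type := Fin n × ℕ → ℝ

/-- The marks of all updates. -/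
abbrev Marks (n : ℕ) : Type := Fin n × ℕ → unitInterval

/-- The driving noise without the initial configuration. -/
abbrev Drive (n : ℕ) : Type := Clocks n × Marks n

/-- The time of an update, as a function of the waiting times. -/
def arr (w : Clocks n) (e : Fin n × ℕ) : ℝ := ∑ m ∈ Finset.range (e.2 + 1), w (e.1, m)

/-- The almost sure properties of the waiting times that are used. -/
structure Regular (w : Clocks n) : Prop where
  nonneg : ∀ e, 0 ≤ arr w e
  inj : Function.Injective (arr w)
  mono : ∀ i, StrictMono fun m => arr w (i, m)
  finite : ∀ t, {e | arr w e ≤ t}.Finite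

/-- `wd` lists the updates with times in `s` in chronological order. -/
def IsEnum (w : Clocks n) (s : Set ℝ) (wd : List (Fin n × ℕ)) : Prop :=
  wd.Pairwise (fun e e' => arr w e < arr w e') ∧ ∀ e, e ∈ wd ↔ arr w e ∈ s

lemma pairwise_arr_nodup {w : Clocks n} {wd : List (Fin n × ℕ)}
    (h : wd.Pairwise fun e e' => arr w e < arr w e') : wd.Nodup :=
  List.Pairwise.imp (S := fun a b => a ≠ b) (fun hab e => absurd (e ▸ hab) (lt_irrefl _)) h

lemma IsEnum.unique {w : Clocks n} {s : Set ℝ} {l l' : List (Fin n × ℕ)}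
    (h : IsEnum w s l) (h' : IsEnum w s l') : l = l' :=
  List.Perm.eq_of_pairwise (fun _ _ _ _ h1 h2 => absurd (h1.trans h2) (lt_irrefl _)) h.1 h'.1
    ((List.perm_ext_iff_of_nodup (pairwise_arr_nodup h.1) (pairwise_arr_nodup h'.1)).2
      fun e => (h.2 e).trans (h'.2 e).symm)

lemma Regular.isEnum_sort {w : Clocks n} (hw : Regular w) (F : Finset (Fin n × ℕ)) (s : Set ℝ)
    (hF : ∀ e, e ∈ F ↔ arr w e ∈ s) :
    IsEnum w s (F.toList.mergeSort fun e e' => decide (arr w e ≤ arr w e')) := by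
  refine ⟨?_, fun e => by simp [hF]⟩
  have h1 := List.pairwise_mergeSort (le := fun e e' => decide (arr w e ≤ arr w e'))
    (fun a b c hab hbc => by simp at *; exact hab.trans hbc)
    (fun a b => by simpa using le_total _ _) F.toList
  have h2 : (F.toList.mergeSort fun e e' => decide (arr w e ≤ arr w e')).Nodup :=
    (List.mergeSort_perm _ _).nodup_iff.2 F.nodup_toList
  refine (h1.and h2).imp ?_
  rintro a b ⟨hab, hne⟩
  exact lt_of_le_of_ne (by simpa using hab) fun e => hne (hw.inj e)

lemma Regular.isEnum_updateList {ω : Noise n} (hw : Regular ω.2.1) (t : ℝ) :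
    IsEnum ω.2.1 (Set.Iic t) (updateList ω t) := by
  refine hw.isEnum_sort _ _ fun e => ?_
  have : {e | updateTime ω e ≤ t}.Finite := hw.finite t
  rw [updatesUpTo, dif_pos this]
  simp [updateTime, arr]

lemma Regular.exists_isEnum {w : Clocks n} (hw : Regular w) (h : ℝ) :
    ∃ wd, IsEnum w (Set.Iio h) wd := by
  have hf : {e | arr w e < h}.Finite := (hw.finite h).subset fun e (he : arr w e < h) => he.le
  exact ⟨_, hw.isEnum_sort hf.toFinset _ fun e => by simp⟩

open Classical in
/-- The chronological list of the updates before time `h`. -/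
def word (h : ℝ) (w : Clocks n) : List (Fin n × ℕ) :=
  if hw : ∃ wd, IsEnum w (Set.Iio h) wd then hw.choose else []

lemma Regular.isEnum_word {w : Clocks n} (hw : Regular w) (h : ℝ) :
    IsEnum w (Set.Iio h) (word h w) := by
  have := hw.exists_isEnum h
  rw [word, dif_pos this]
  exact this.choose_spec

lemma word_eq_of_isEnum {w : Clocks n} {h : ℝ} {l : List (Fin n × ℕ)}
    (hl : IsEnum w (Set.Iio h) l) : word h w = l := by
  have hw : ∃ wd, IsEnum w (Set.Iio h) wd := ⟨l, hl⟩
  rw [word, dif_pos hw]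
  exact hw.choose_spec.unique hl

/-- The default `[]` in `word` makes this true for every clock, regular or not, so that `avg_eq` can
integrate out the marks at each fixed `w` without discarding a null set. -/
lemma word_nodup (w : Clocks n) (h : ℝ) : (word h w).Nodup := by
  by_cases hw : ∃ wd, IsEnum w (Set.Iio h) wd
  · rw [word, dif_pos hw]
    exact pairwise_arr_nodup hw.choose_spec.1
  · rw [word, dif_neg hw]
    exact List.nodup_nil

/-- The number of updates of site `i` in a list of updates. -/
def countSite (i : Fin n) (wd : List (Fin n × ℕ)) : ℕ := wd.countP fun e => e.1 = i

/-- The number of updates of site `i` before time `h`. -/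
def numBefore (h : ℝ) (w : Clocks n) (i : Fin n) : ℕ := countSite i (word h w)

/-- The waiting times after time `h`. -/
def shiftClocks (h : ℝ) (w : Clocks n) : Clocks n := fun e =>
  arr w (e.1, numBefore h w e.1 + e.2) -
    -- The first waiting time after the restart is a residual one: it is counted from `h`, not from
    -- the previous update.
    if e.2 = 0 then h else arr w (e.1, numBefore h w e.1 + (e.2 - 1))

/-- The driving noise after time `h`. -/
def shift (h : ℝ) (ω : Drive n) : Drive n :=
  (shiftClocks h ω.1, fun e => ω.2 (e.1, numBefore h ω.1 e.1 + e.2))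

lemma arr_succ (w : Clocks n) (i : Fin n) (m : ℕ) :
    arr w (i, m + 1) = arr w (i, m) + w (i, m + 1) := by
  simp [arr, Finset.sum_range_succ _ (m + 1)]

lemma arr_zero (w : Clocks n) (i : Fin n) : arr w (i, 0) = w (i, 0) := by simp [arr]

lemma arr_shiftClocks (h : ℝ) (w : Clocks n) (e : Fin n × ℕ) :
    arr (shiftClocks h w) e = arr w (e.1, numBefore h w e.1 + e.2) - h := by
  obtain ⟨i, m⟩ := e
  induction m with
  | zero => simp [arr_zero, shiftClocks]
  | succ m ih =>
    rw [arr_succ, ih]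
    simp [shiftClocks]

/-- The times of one site increase with the index, so its updates before `h` form an initial segment
of the indices, finite by regularity. A restart therefore only adds an offset to the indices of each
site. -/
lemma Regular.filter_eq {w : Clocks n} (hw : Regular w) {h : ℝ} {wd : List (Fin n × ℕ)}
    (hwd : IsEnum w (Set.Iio h) wd) (i : Fin n) :
    wd.filter (fun e => e.1 = i) = (List.range (countSite i wd)).map fun m => (i, m) := by
  have hfin : {m | arr w (i, m) < h}.Finite :=
    ((hw.finite h).subset (fun e (he : arr w e < h) => he.le) : {e | arr w e < h}.Finite).preimage
      (f := fun m => (i, m)) (fun a _ b _ hab => by simpa using hab)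
  obtain ⟨N, hN⟩ : ∃ N, ∀ m, arr w (i, m) < h ↔ m < N := by
    classical
    obtain ⟨N, hN⟩ : ∃ N, ¬ arr w (i, N) < h := by
      by_contra hc
      push Not at hc
      exact Set.infinite_univ (hfin.subset fun m _ => hc m)
    have hex : ∃ N, ¬ arr w (i, N) < h := ⟨N, hN⟩
    refine ⟨Nat.find hex, fun m => ⟨fun hm => ?_, fun hm => not_not.1 (Nat.find_min hex hm)⟩⟩
    by_contra hc
    exact Nat.find_spec hex (lt_of_le_of_lt ((hw.mono i).monotone (not_lt.1 hc)) hm)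
  have key : wd.filter (fun e => e.1 = i) = (List.range N).map fun m => (i, m) := by
    refine List.Perm.eq_of_pairwise (le := fun e e' => arr w e < arr w e')
      (fun _ _ _ _ h1 h2 => absurd (h1.trans h2) (lt_irrefl _)) (hwd.1.filter _) ?_ ?_
    · rw [List.pairwise_map]
      exact (List.pairwise_lt_range).imp fun hab => hw.mono i hab
    · refine (List.perm_ext_iff_of_nodup ((pairwise_arr_nodup hwd.1).filter _)
        (List.Nodup.map (fun a b hab => by simpa using hab) List.nodup_range)).2 ?_
      rintro ⟨a, m⟩
      simp only [List.mem_filter, hwd.2, Set.mem_Iio, decide_eq_true_eq, List.mem_map,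
        List.mem_range, Prod.mk.injEq]
      constructor
      · rintro ⟨h1, rfl⟩
        exact ⟨m, (hN m).1 h1, rfl, rfl⟩
      · rintro ⟨m', h1, rfl, rfl⟩
        exact ⟨(hN _).2 h1, rfl⟩
  have hc : countSite i wd = N := by
    rw [countSite, List.countP_eq_length_filter, key]
    simp
  rw [hc, key]

lemma Regular.lt_numBefore_iff {w : Clocks n} (hw : Regular w) (h : ℝ) (i : Fin n) (m : ℕ) :
    m < numBefore h w i ↔ arr w (i, m) < h := by
  have h1 := hw.filter_eq (hw.isEnum_word h) i
  have h2 : (i, m) ∈ (word h w).filter (fun e => e.1 = i) ↔ arr w (i, m) < h := by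
    rw [List.mem_filter, (hw.isEnum_word h).2]
    simp
  rw [← h2, h1]
  simp [numBefore]

lemma Regular.shiftClocks {w : Clocks n} (hw : Regular w) (h : ℝ) :
    Regular (shiftClocks h w) where
  nonneg e := by
    rw [arr_shiftClocks]
    have := (hw.lt_numBefore_iff h e.1 (numBefore h w e.1 + e.2)).not.1 (by omega)
    linarith [not_lt.1 this]
  inj := by
    rintro ⟨a, m⟩ ⟨b, m'⟩ hab
    simp only [arr_shiftClocks, sub_left_inj] at hab
    have := hw.inj hab
    simp only [Prod.mk.injEq] at this
    obtain ⟨rfl, h2⟩ := this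
    simpa using h2
  mono i a b hab := by
    simp only [arr_shiftClocks]
    have := hw.mono i (show numBefore h w i + a < numBefore h w i + b by omega)
    simpa using this
  finite t := by
    have hf : Function.Injective fun e : Fin n × ℕ => (e.1, numBefore h w e.1 + e.2) := by
      rintro ⟨a, m⟩ ⟨b, m'⟩ hab
      simp only [Prod.mk.injEq] at hab
      obtain ⟨rfl, h2⟩ := hab
      simpa using h2
    refine ((hw.finite (t + h)).preimage hf.injOn).subset fun e he => ?_
    simp only [Set.mem_ofPred_eq, arr_shiftClocks] at he
    simp only [Set.mem_preimage, Set.mem_ofPred_eq]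
    linarith

/-- The indices of the updates after time `h`. -/
def reindex (h : ℝ) (w : Clocks n) (e : Fin n × ℕ) : Fin n × ℕ :=
  (e.1, numBefore h w e.1 + e.2)

/-- The deterministic half of the Markov property: the history up to `t` is the history before `h`
followed by the history of the shifted clocks with indices put back. -/
lemma Regular.isEnum_append {w : Clocks n} (hw : Regular w) {h t : ℝ} (ht : h ≤ t)
    {wd : List (Fin n × ℕ)} (hwd : IsEnum (GlauberMRF.shiftClocks h w) (Set.Iic (t - h)) wd) :
    IsEnum w (Set.Iic t) (word h w ++ wd.map (reindex h w)) := by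
  have h0 := hw.isEnum_word h
  refine ⟨List.pairwise_append.2 ⟨h0.1, ?_, ?_⟩, ?_⟩
  · rw [List.pairwise_map]
    refine hwd.1.imp fun {a b} hab => ?_
    rw [arr_shiftClocks, arr_shiftClocks] at hab
    simpa [reindex] using hab
  · intro a ha b hb
    obtain ⟨c, -, rfl⟩ := List.mem_map.1 hb
    have h1 : arr w a < h := (h0.2 a).1 ha
    have h2 := (hw.shiftClocks h).nonneg c
    rw [arr_shiftClocks] at h2
    rw [reindex]
    linarith
  · rintro ⟨i, m⟩
    rw [List.mem_append, h0.2]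
    constructor
    · rintro (h1 | h1)
      · exact (le_of_lt h1).trans ht
      · obtain ⟨c, hc, hce⟩ := List.mem_map.1 h1
        have := (hwd.2 c).1 hc
        rw [arr_shiftClocks, Set.mem_Iic] at this
        rw [← hce, reindex, Set.mem_Iic]
        linarith
    · intro h1
      by_cases hlt : arr w (i, m) < h
      · exact Or.inl hlt
      · right
        have hm : numBefore h w i ≤ m :=
          not_lt.1 fun hc => hlt ((hw.lt_numBefore_iff h i m).1 hc)
        have hr : reindex h w (i, m - numBefore h w i) = (i, m) := by
          simp [reindex, hm]
        refine List.mem_map.2 ⟨(i, m - numBefore h w i), (hwd.2 _).2 ?_, hr⟩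
        rw [arr_shiftClocks]
        change arr w (reindex h w (i, m - numBefore h w i)) - h ≤ t - h
        rw [hr]
        have : arr w (i, m) ≤ t := h1
        linarith

/-! ## The dynamics along a list of updates -/

/-- One Glauber update, driven by the marks. -/
def step (ψ : Hamiltonian n) (u : Marks n) (x : Config n) (e : Fin n × ℕ) : Config n :=
  Function.update x e.1
    (if (u e : ℝ) ≤ Real.sigmoid (2 * (ψ.deriv e.1).eval x) then 1 else -1)

/-- The final configuration and the list of all new spins. -/
def runTrace (ψ : Hamiltonian n) (u : Marks n) :
    Config n → List (Fin n × ℕ) → Config n × List (Fin n × ℤˣ)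
  | x, [] => (x, [])
  | x, e :: wd =>
    ((runTrace ψ u (step ψ u x e) wd).1,
      (e.1, step ψ u x e e.1) :: (runTrace ψ u (step ψ u x e) wd).2)

lemma runTrace_fst (ψ : Hamiltonian n) (u : Marks n) (x : Config n) (wd : List (Fin n × ℕ)) :
    (runTrace ψ u x wd).1 = wd.foldl (step ψ u) x := by
  induction wd generalizing x with
  | nil => rfl
  | cons e wd ih => simp [runTrace, ih]

/-- What happens before time `h`. -/
def outcome (ψ : Hamiltonian n) (h : ℝ) (x : Config n) (ω : Drive n) :
    Config n × List (Fin n × ℤˣ) :=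
  runTrace ψ ω.2 x (word h ω.1)

/-- The successive new spins of site `i`. -/
def valsOf (i : Fin n) (tr : List (Fin n × ℤˣ)) : List ℤˣ :=
  (tr.filter fun e => e.1 = i).map Prod.snd

lemma Regular.glauber_eq (ψ : Hamiltonian n) {ω : Noise n} (hw : Regular ω.2.1) {t : ℝ}
    {wd : List (Fin n × ℕ)} (hwd : IsEnum ω.2.1 (Set.Iic t) wd) :
    glauber ψ ω t = wd.foldl (step ψ ω.2.2) ω.1 := by
  rw [glauber, (hw.isEnum_updateList t).unique hwd]
  rfl

lemma Regular.glauber_shift (ψ : Hamiltonian n) (x : Config n) {ω : Drive n}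
    (hw : Regular ω.1) {h t : ℝ} (ht : h ≤ t) :
    glauber ψ (x, ω) t = glauber ψ ((outcome ψ h x ω).1, shift h ω) (t - h) := by
  have h1 := Regular.isEnum_updateList (ω := ((outcome ψ h x ω).1, shift h ω))
    (hw.shiftClocks h) (t - h)
  rw [Regular.glauber_eq ψ (ω := ((outcome ψ h x ω).1, shift h ω)) (hw.shiftClocks h) h1,
    Regular.glauber_eq ψ (ω := (x, ω)) hw (hw.isEnum_append ht h1), List.foldl_append,
    List.foldl_map, outcome, runTrace_fst]
  rfl

lemma Regular.trace_eq (ψ : Hamiltonian n) (x : Config n) {ω : Drive n} (hw : Regular ω.1)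
    (h : ℝ) : (outcome ψ h x ω).2 =
      (word h ω.1).map fun e => (e.1, glauber ψ (x, ω) (arr ω.1 e) e.1) := by
  -- Induction on the suffix, with the executed prefix kept free: `glauber` at the time of an update
  -- is a fold over all earlier updates.
  have key : ∀ post pre : List (Fin n × ℕ), pre ++ post = word h ω.1 →
      (runTrace ψ ω.2 (pre.foldl (step ψ ω.2) x) post).2 =
        post.map fun e => (e.1, glauber ψ (x, ω) (arr ω.1 e) e.1) := by
    intro post
    induction post with
    | nil => intros; rfl
    | cons e post ih =>
      intro pre hpre
      have hen := hw.isEnum_word h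
      rw [← hpre] at hen
      have hpw := List.pairwise_append.1 hen.1
      have hpw2 := List.pairwise_cons.1 hpw.2.1
      -- Times increase strictly along the word, so the updates up to the time of `e` are exactly
      -- those of `pre` and `e` itself. The recorded value is the one just after the update.
      have hE : IsEnum ω.1 (Set.Iic (arr ω.1 e)) (pre ++ [e]) := by
        refine ⟨List.pairwise_append.2 ⟨hpw.1, by simp, fun a ha b hb => ?_⟩, fun a => ?_⟩
        · exact hpw.2.2 a ha b (by simp at hb; simp [hb])
        · constructor
          · intro ha
            rcases List.mem_append.1 ha with ha | ha
            · exact (hpw.2.2 a ha e (by simp)).le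
            · simp at ha
              simp [ha]
          · intro ha
            have he : arr ω.1 e < h := (hen.2 e).1 (by simp)
            have := (hen.2 a).2 (lt_of_le_of_lt ha he)
            rcases List.mem_append.1 this with h1 | h1
            · simp [h1]
            · rcases List.mem_cons.1 h1 with rfl | h1
              · simp
              · exact absurd (hpw2.1 a h1) (not_lt.2 ha)
      have hg := Regular.glauber_eq ψ (ω := (x, ω)) hw hE
      rw [List.foldl_append] at hg
      have h2 := ih (pre ++ [e]) (by simpa using hpre)
      rw [List.foldl_append] at h2
      simp only [List.foldl_cons, List.foldl_nil] at h2 hg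
      rw [runTrace, List.map_cons, h2, hg]
  exact key (word h ω.1) [] rfl

lemma Regular.valsOf_eq (ψ : Hamiltonian n) (x : Config n) {ω : Drive n} (hw : Regular ω.1)
    (h : ℝ) (i : Fin n) : valsOf i (outcome ψ h x ω).2 =
      (List.range (numBefore h ω.1 i)).map fun m => glauber ψ (x, ω) (arr ω.1 (i, m)) i := by
  rw [valsOf, hw.trace_eq ψ x h, List.filter_map, List.map_map]
  have : ((fun e : Fin n × ℤˣ => decide (e.1 = i)) ∘ fun e : Fin n × ℕ =>
      (e.1, glauber ψ (x, ω) (arr ω.1 e) e.1)) = fun e => decide (e.1 = i) := rfl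
  rw [this, hw.filter_eq (hw.isEnum_word h) i, List.map_map]
  rfl

lemma Regular.numUpdates_shift (x x' : Config n) {ω : Drive n} (hw : Regular ω.1) {h T : ℝ}
    (hT : h ≤ T) (i : Fin n) :
    numUpdates (x, ω) T i = numBefore h ω.1 i + numUpdates (x', shift h ω) (T - h) i := by
  have hfin : ∀ (w : Clocks n), Regular w → ∀ t, {m | arr w (i, m) ≤ t}.Finite := fun w hw t =>
    (hw.finite t).preimage (f := fun m => (i, m)) (fun a _ b _ hab => by simpa using hab)
  have hset : {m | arr ω.1 (i, m) ≤ T} = Set.Iio (numBefore h ω.1 i) ∪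
      (fun m => numBefore h ω.1 i + m) '' {m | arr (GlauberMRF.shiftClocks h ω.1) (i, m) ≤ T - h} := by
    ext m
    simp only [Set.mem_ofPred_eq, Set.mem_union, Set.mem_Iio, Set.mem_image, arr_shiftClocks,
      hw.lt_numBefore_iff]
    constructor
    · intro hm
      by_cases hc : arr ω.1 (i, m) < h
      · exact Or.inl hc
      · have : numBefore h ω.1 i ≤ m :=
          not_lt.1 fun hc' => hc ((hw.lt_numBefore_iff h i m).1 hc')
        refine Or.inr ⟨m - numBefore h ω.1 i, ?_, by omega⟩
        rw [Nat.add_sub_cancel' this]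
        linarith
    · rintro (hm | ⟨m', hm, rfl⟩)
      · linarith
      · linarith
  change Set.ncard {m | arr ω.1 (i, m) ≤ T} = numBefore h ω.1 i +
    Set.ncard {m | arr (GlauberMRF.shiftClocks h ω.1) (i, m) ≤ T - h}
  rw [hset, Set.ncard_union_eq ?_ (Set.finite_Iio _) ((hfin _ (hw.shiftClocks h) _).image _),
    Set.ncard_image_of_injective _ (add_right_injective _)]
  · simp [Set.ncard_eq_toFinset_card']
  · rw [Set.disjoint_left]
    rintro m hm ⟨m', -, rfl⟩
    simp at hm

/-- The cut is the one that `splitBefore` makes: entries with times strictly below `h`, then the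
record of the restarted dynamics with its clock advanced by `h`. -/
lemma Regular.siteRecord_split (ψ : Hamiltonian n) (x : Config n) {ω : Drive n}
    (hw : Regular ω.1) {h T : ℝ} (hT : h ≤ T) (i : Fin n) :
    ∃ A : SiteRecord, A.map Prod.snd = valsOf i (outcome ψ h x ω).2 ∧ (∀ p ∈ A, p.1 < h) ∧
      siteRecord ψ (x, ω) T i = A ++
        (siteRecord ψ ((outcome ψ h x ω).1, shift h ω) (T - h) i).map fun p => (h + p.1, p.2) := by
  refine ⟨(List.range (numBefore h ω.1 i)).map fun m =>
    (arr ω.1 (i, m), glauber ψ (x, ω) (arr ω.1 (i, m)) i), ?_, ?_, ?_⟩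
  · rw [hw.valsOf_eq, List.map_map]
    rfl
  · intro p hp
    obtain ⟨m, hm, rfl⟩ := List.mem_map.1 hp
    exact (hw.lt_numBefore_iff h i m).1 (List.mem_range.1 hm)
  · rw [siteRecord, hw.numUpdates_shift x (outcome ψ h x ω).1 hT, List.range_add, List.map_append,
      List.map_map, siteRecord, List.map_map]
    congr 1
    refine List.map_congr_left fun m _ => ?_
    have h1 : updateTime (x, ω) (i, numBefore h ω.1 i + m) =
        h + updateTime ((outcome ψ h x ω).1, shift h ω) (i, m) := by
      change arr ω.1 _ = h + arr (GlauberMRF.shiftClocks h ω.1) _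
      rw [arr_shiftClocks]
      ring
    have h2 : 0 ≤ updateTime ((outcome ψ h x ω).1, shift h ω) (i, m) :=
      (hw.shiftClocks h).nonneg _
    simp only [Function.comp]
    rw [h1, hw.glauber_shift ψ x (h := h) (by linarith)]
    simp

lemma Regular.siteRecord_nonneg (ψ : Hamiltonian n) (x : Config n) {ω : Drive n}
    (hw : Regular ω.1) (T : ℝ) (i : Fin n) : ∀ p ∈ siteRecord ψ (x, ω) T i, 0 ≤ p.1 := by
  intro p hp
  obtain ⟨m, -, rfl⟩ := List.mem_map.1 hp
  exact hw.nonneg _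

/-! ## The scan as a recursion along the dynamics -/

@[simp] lemma Timed.bind_val {β γ : Type} (x : Timed β) (f : β → Timed γ) :
    (x >>= f).val = (f x.val).val := rfl

@[simp] lemma Timed.bind_cost {β γ : Type} (x : Timed β) (f : β → Timed γ) :
    (x >>= f).cost = x.cost + (f x.val).cost := rfl

@[simp] lemma Timed.pure_val {β : Type} (b : β) : (pure b : Timed β).val = b := rfl

@[simp] lemma Timed.pure_cost {β : Type} (b : β) : (pure b : Timed β).cost = 0 := rfl

@[simp] lemma tick_cost (c : ℕ) : (tick c).cost = c := rfl

lemma splitBefore_append (c : ℝ) (A B : SiteRecord) (hA : ∀ p ∈ A, p.1 < c)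
    (hB : ∀ p ∈ B, c ≤ p.1) : (splitBefore c (A ++ B)).val = (A, B) := by
  induction A with
  | nil =>
    cases B with
    | nil => rfl
    | cons e es =>
      have : ¬ e.1 < c := not_lt.2 (hB e (by simp))
      simp [splitBefore, this]
  | cons a A ih =>
    have h1 : a.1 < c := hA a (by simp)
    have := ih fun p hp => hA p (by simp [hp])
    simp [splitBefore, h1, this]

/-- An amortized bound: entries that are split off pay for themselves. Repeated splitting of one
record thus costs a constant per call plus a constant per entry. -/
lemma splitBefore_cost (c : ℝ) (A : SiteRecord) :
    (splitBefore c A).cost + 4 * (splitBefore c A).val.2.length ≤ 4 * A.length + 4 := by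
  induction A with
  | nil => simp [splitBefore]
  | cons a A ih =>
    by_cases h : a.1 < c
    · simp [splitBefore, h]
      omega
    · simp [splitBefore, h]
      omega

/-- The statistic of a window in terms of the values only. -/
def statVals : (v₁ v₂ v₃ w₁ w₂ w₃ : List ℤˣ) → Option ℝ
  | y₁ :: y₂ :: _, [], y₁' :: y₂' :: _, [], _ :: _, [] =>
    some (ind y₁ * ind y₂ - 2 * ind y₁ * ind y₁' + ind y₁' * ind y₂')
  | _, _, _, _, _, _ => none

lemma statistic_eq (a₁ a₂ a₃ b₁ b₂ b₃ : SiteRecord) : statistic a₁ a₂ a₃ b₁ b₂ b₃ =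
    statVals (a₁.map Prod.snd) (a₂.map Prod.snd) (a₃.map Prod.snd) (b₁.map Prod.snd)
      (b₂.map Prod.snd) (b₃.map Prod.snd) := by
  rcases a₁ with _ | ⟨x, _ | ⟨y, a₁⟩⟩ <;> rcases a₂ with _ | ⟨z, a₂⟩ <;>
    rcases a₃ with _ | ⟨x', _ | ⟨y', a₃⟩⟩ <;> rcases b₁ with _ | ⟨_, b₁⟩ <;>
    rcases b₂ with _ | ⟨_, b₂⟩ <;> rcases b₃ with _ | ⟨_, b₃⟩ <;> rfl

/-- The statistic of the last block of a window, in terms of the spins in its thirds. -/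
def blockStat (i j : Fin n) (t₁ t₂ t₃ : List (Fin n × ℤˣ)) : Option ℝ :=
  statVals (valsOf i t₁) (valsOf i t₂) (valsOf i t₃) (valsOf j t₁) (valsOf j t₂) (valsOf j t₃)

/-- The loop variables of the scan. -/
structure ScanState where
  /-- the current block -/
  b : ℕ
  /-- the first block of the next window -/
  next : ℕ
  /-- the number of stopping times found -/
  s : ℕ
  /-- the sum of their statistics -/
  sum : ℝ

/-- The loop variables after one more block. -/
def ScanState.advance (r : ℕ) (σ : ScanState) : Option ℝ → ScanState
  | some z => if σ.next + r ≤ σ.b + 1 then ⟨σ.b + 1, σ.b + 1, σ.s + 1, σ.sum + z⟩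
      else ⟨σ.b + 1, σ.next, σ.s, σ.sum⟩
  | none => ⟨σ.b + 1, σ.next, σ.s, σ.sum⟩

/-- The result of the scan as a function of the driving noise; `h` is a third of a block. -/
def noiseScan (ψ : Hamiltonian n) (i j : Fin n) (h : ℝ) (M r : ℕ) :
    ℕ → ScanState → Config n → Drive n → Option ℝ
  | 0, σ, _, _ => if M ≤ σ.s then some σ.sum else none
  | left + 1, σ, x, ω =>
    if M ≤ σ.s then some σ.sum else
      noiseScan ψ i j h M r left
        (σ.advance r (blockStat i j (outcome ψ h x ω).2
          (outcome ψ h (outcome ψ h x ω).1 (shift h ω)).2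
          (outcome ψ h (outcome ψ h (outcome ψ h x ω).1 (shift h ω)).1 (shift h (shift h ω))).2))
        (outcome ψ h (outcome ψ h (outcome ψ h x ω).1 (shift h ω)).1 (shift h (shift h ω))).1
        (shift h (shift h (shift h ω)))

/-- The record of a site, with the clock started at `c`. -/
def recordFrom (ψ : Hamiltonian n) (c T : ℝ) (x : Config n) (ω : Drive n) (i : Fin n) :
    SiteRecord :=
  (siteRecord ψ (x, ω) T i).map fun p => (c + p.1, p.2)

lemma Regular.splitBefore_recordFrom (ψ : Hamiltonian n) (x : Config n) {ω : Drive n}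
    (hw : Regular ω.1) {h T : ℝ} (hT : h ≤ T) (c : ℝ) (i : Fin n) :
    (splitBefore (c + h) (recordFrom ψ c T x ω i)).val.1.map Prod.snd =
        valsOf i (outcome ψ h x ω).2 ∧
      (splitBefore (c + h) (recordFrom ψ c T x ω i)).val.2 =
        recordFrom ψ (c + h) (T - h) (outcome ψ h x ω).1 (shift h ω) i := by
  obtain ⟨A, h1, h2, h3⟩ := hw.siteRecord_split ψ x hT i
  have h4 : recordFrom ψ c T x ω i = A.map (fun p => (c + p.1, p.2)) ++
      recordFrom ψ (c + h) (T - h) (outcome ψ h x ω).1 (shift h ω) i := by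
    rw [recordFrom, h3, List.map_append, List.map_map, recordFrom]
    congr 1
    refine List.map_congr_left fun p _ => ?_
    simp [add_assoc]
  have h5 := splitBefore_append (c + h) (A.map fun p => (c + p.1, p.2))
    (recordFrom ψ (c + h) (T - h) (outcome ψ h x ω).1 (shift h ω) i)
    (by
      intro p hp
      obtain ⟨a, ha, rfl⟩ := List.mem_map.1 hp
      simpa using h2 a ha)
    (by
      intro p hp
      obtain ⟨a, ha, rfl⟩ := List.mem_map.1 hp
      have := Regular.siteRecord_nonneg ψ (outcome ψ h x ω).1 (ω := shift h ω)
        (hw.shiftClocks h) _ _ _ ha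
      simpa using this)
  rw [h4, h5]
  refine ⟨?_, rfl⟩
  rw [List.map_map, ← h1]
  rfl

/-- The loop invariant: at the start of block `b` the unread parts of the two records are the
records of the dynamics restarted at time `b L`, with the clock showing `b L`. Each block consumes
three restarts after `h = L / 3`, and the bound on `T` keeps all cuts inside the observed horizon.
-/
lemma Regular.scan_val (ψ : Hamiltonian n) (i j : Fin n) (p : Params) {h : ℝ} (hh : 0 ≤ h)
    (hp : p.L = 3 * h) (left : ℕ) : ∀ (σ : ScanState) (x : Config n) (ω : Drive n) (T : ℝ),
    Regular ω.1 → left * p.L ≤ T →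
    (scan p left σ.b σ.next σ.s σ.sum (recordFrom ψ (σ.b * p.L) T x ω i)
      (recordFrom ψ (σ.b * p.L) T x ω j)).val = noiseScan ψ i j h p.M p.r left σ x ω := by
  induction left with
  | zero =>
    intro σ x ω T _ _
    simp [scan, noiseScan]
  | succ left ih =>
    intro σ x ω T hw hT
    by_cases hM : p.M ≤ σ.s
    · simp [scan, noiseScan, hM]
    · have hleft : 0 ≤ (left : ℝ) * p.L := by rw [hp]; positivity
      push_cast at hT
      rw [add_mul, one_mul] at hT
      have hL := hp
      set x1 := (outcome ψ h x ω).1 with hx1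
      set x2 := (outcome ψ h x1 (shift h ω)).1 with hx2
      set x3 := (outcome ψ h x2 (shift h (shift h ω))).1 with hx3
      have hw1 : Regular (shift h ω).1 := hw.shiftClocks h
      have hw2 : Regular (shift h (shift h ω)).1 := hw1.shiftClocks h
      have hw3 : Regular (shift h (shift h (shift h ω))).1 := hw2.shiftClocks h
      have e1 : ((σ.b : ℝ) + 1 / 3) * p.L = σ.b * p.L + h := by rw [hp]; ring
      have e2 : ((σ.b : ℝ) + 2 / 3) * p.L = σ.b * p.L + h + h := by rw [hp]; ring
      have e3 : ((σ.b : ℝ) + 1) * p.L = σ.b * p.L + h + h + h := by rw [hp]; ring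
      have s1 := fun a => hw.splitBefore_recordFrom ψ x (h := h) (T := T) (by linarith)
        (σ.b * p.L) a
      have s2 := fun a => hw1.splitBefore_recordFrom ψ x1 (h := h) (T := T - h) (by linarith)
        (σ.b * p.L + h) a
      have s3 := fun a => hw2.splitBefore_recordFrom ψ x2 (h := h) (T := T - h - h)
        (by linarith) (σ.b * p.L + h + h) a
      have key := fun (σ' : ScanState) (hb : σ'.b = σ.b + 1) =>
        ih σ' x3 (shift h (shift h (shift h ω))) (T - h - h - h) hw3 (by linarith)
      have e4 : σ.b * p.L + h + h + h = ((σ.b + 1 : ℕ) : ℝ) * p.L := by push_cast; rw [← e3]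
      rw [← hx1] at s1
      rw [← hx2] at s2
      rw [← hx3] at s3
      rw [noiseScan, if_neg hM, scan]
      simp only [Timed.bind_val, if_neg hM, e1, e2, e3, (s1 _).2, (s2 _).2, (s3 _).2, ← hx1, ← hx2,
        ← hx3]
      rw [statistic_eq]
      simp only [(s1 _).1, (s2 _).1, (s3 _).1]
      rw [← blockStat]
      cases blockStat i j (outcome ψ h x ω).2 (outcome ψ h x1 (shift h ω)).2
        (outcome ψ h x2 (shift h (shift h ω))).2 with
      | none =>
        have k2 := key ⟨σ.b + 1, σ.next, σ.s, σ.sum⟩ rfl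
        rw [← e4] at k2
        simp only [ScanState.advance]
        split_ifs <;> exact k2
      | some z =>
        simp only [ScanState.advance]
        split_ifs with hc
        · have k1 := key ⟨σ.b + 1, σ.b + 1, σ.s + 1, σ.sum + z⟩ rfl
          rw [← e4] at k1
          exact k1
        · have k2 := key ⟨σ.b + 1, σ.next, σ.s, σ.sum⟩ rfl
          rw [← e4] at k2
          exact k2

/-- Here `74 = 50 + 6 · 4` is the charge of a block together with the overhead of its six splits;
the entries that are read are paid for by the shrinking records. -/
lemma scan_cost (p : Params) (left : ℕ) : ∀ (b next s : ℕ) (sum : ℝ) (A B : SiteRecord),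
    (scan p left b next s sum A B).cost ≤ 74 * left + 50 + 4 * (A.length + B.length) := by
  induction left with
  | zero =>
    intro b next s sum A B
    simp [scan]
    omega
  | succ left ih =>
    intro b next s sum A B
    rw [scan]
    simp only [Timed.bind_cost, tick_cost]
    by_cases hM : p.M ≤ s
    · simp [if_pos hM]
      omega
    · rw [if_neg hM]
      simp only [Timed.bind_cost]
      have a1 := splitBefore_cost ((b + 1 / 3) * p.L) A
      have b1 := splitBefore_cost ((b + 1 / 3) * p.L) B
      set A1 := splitBefore ((b + 1 / 3) * p.L) A
      set B1 := splitBefore ((b + 1 / 3) * p.L) B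
      have a2 := splitBefore_cost ((b + 2 / 3) * p.L) A1.val.2
      have b2 := splitBefore_cost ((b + 2 / 3) * p.L) B1.val.2
      set A2 := splitBefore ((b + 2 / 3) * p.L) A1.val.2
      set B2 := splitBefore ((b + 2 / 3) * p.L) B1.val.2
      have a3 := splitBefore_cost ((b + 1) * p.L) A2.val.2
      have b3 := splitBefore_cost ((b + 1) * p.L) B2.val.2
      set A3 := splitBefore ((b + 1) * p.L) A2.val.2
      set B3 := splitBefore ((b + 1) * p.L) B2.val.2
      split_ifs
      · split
        · have := ih (b + 1) (b + 1) (s + 1) (sum + ‹ℝ›) A3.val.2 B3.val.2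
          omega
        · have := ih (b + 1) next s sum A3.val.2 B3.val.2
          omega
      · have := ih (b + 1) next s sum A3.val.2 B3.val.2
        omega

/-! ### The decision for a pair and the loops over pairs -/

lemma testPair_val (p : Params) (A B : SiteRecord) : (testPair p A B).val =
    ((scan p p.blocks 0 p.r 0 0 A B).val).map fun z => decide (p.κ ≤ z / p.M) := rfl

lemma testPair_cost (p : Params) (A B : SiteRecord) :
    (testPair p A B).cost ≤ 74 * p.blocks + 54 + 4 * (A.length + B.length) := by
  have := scan_cost p p.blocks 0 p.r 0 0 A B
  simp only [testPair, Timed.bind_cost, tick_cost, Timed.pure_cost]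
  omega

lemma testRow_val {V : Type} (p : Params) (i : V) (A : SiteRecord) (f : V → Bool) :
    ∀ (l : List (V × SiteRecord)) (E : List (V × V)),
    (∀ q ∈ l, (testPair p A q.2).val = some (f q.1)) →
    ∃ E', (testRow p i A l E).val = some E' ∧
      ∀ e, e ∈ E' ↔ e ∈ E ∨ (e.1 = i ∧ f e.2 = true ∧ e.2 ∈ l.map Prod.fst) := by
  intro l
  induction l with
  | nil => exact fun E _ => ⟨E, rfl, by simp⟩
  | cons q l ih =>
    intro E hq
    obtain ⟨j, B⟩ := q
    have h1 := hq (j, B) (by simp)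
    cases hf : f j with
    | true =>
      obtain ⟨E', hE', hm⟩ := ih ((i, j) :: E) fun q hq' => hq q (by simp [hq'])
      refine ⟨E', ?_, ?_⟩
      · rw [testRow]
        simp only [Timed.bind_val, h1, hf]
        exact hE'
      · rintro ⟨a, b⟩
        rw [hm]
        simp only [List.mem_cons, Prod.mk.injEq, List.map_cons]
        constructor
        · rintro ((⟨rfl, rfl⟩ | h) | ⟨rfl, h2, h3⟩)
          · exact Or.inr ⟨rfl, hf, Or.inl rfl⟩
          · exact Or.inl h
          · exact Or.inr ⟨rfl, h2, Or.inr h3⟩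
        · rintro (h | ⟨rfl, h2, rfl | h3⟩)
          · exact Or.inl (Or.inr h)
          · exact Or.inl (Or.inl ⟨rfl, rfl⟩)
          · exact Or.inr ⟨rfl, h2, h3⟩
    | false =>
      obtain ⟨E', hE', hm⟩ := ih E fun q hq' => hq q (by simp [hq'])
      refine ⟨E', ?_, ?_⟩
      · rw [testRow]
        simp only [Timed.bind_val, h1, hf]
        exact hE'
      · rintro ⟨a, b⟩
        rw [hm]
        simp only [List.map_cons, List.mem_cons]
        constructor
        · rintro (h | ⟨rfl, h2, h3⟩)
          · exact Or.inl h
          · exact Or.inr ⟨rfl, h2, Or.inr h3⟩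
        · rintro (h | ⟨rfl, h2, rfl | h3⟩)
          · exact Or.inl h
          · simp [hf] at h2
          · exact Or.inr ⟨rfl, h2, h3⟩

lemma testRow_cost {V : Type} (p : Params) (i : V) (A : SiteRecord) (K : ℕ) :
    ∀ (l : List (V × SiteRecord)) (E : List (V × V)),
    (∀ q ∈ l, (testPair p A q.2).cost ≤ K) → (testRow p i A l E).cost ≤ l.length * (K + 5) + 2 := by
  intro l
  induction l with
  | nil => exact fun E _ => by simp [testRow]
  | cons q l ih =>
    intro E hq
    obtain ⟨j, B⟩ := q
    have h1 : (testPair p A B).cost ≤ K := hq (j, B) (by simp)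
    have h2 := fun E => ih E fun q hq' => hq q (by simp [hq'])
    rw [testRow]
    simp only [Timed.bind_cost, tick_cost, List.length_cons, add_mul, one_mul] at h2 ⊢
    cases (testPair p A B).val with
    | none =>
      simp only [Timed.pure_cost]
      omega
    | some c =>
      cases c
      · have := h2 E
        simp only
        omega
      · have := h2 ((i, j) :: E)
        simp only
        omega

/-- The loops test each pair of positions once, the earlier one first; the sublist condition records
this order. -/
lemma testAll_val {V : Type} (p : Params) (f : V → V → Bool) :
    ∀ (l : List (V × SiteRecord)) (E : List (V × V)),
    l.Pairwise (fun q q' => (testPair p q.2 q'.2).val = some (f q.1 q'.1)) →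
    ∃ E', (testAll p l E).val = some E' ∧
      ∀ e, e ∈ E' ↔ e ∈ E ∨ (f e.1 e.2 = true ∧ [e.1, e.2].Sublist (l.map Prod.fst)) := by
  intro l
  induction l with
  | nil => exact fun E _ => ⟨E, rfl, by simp⟩
  | cons q l ih =>
    intro E hq
    obtain ⟨i, A⟩ := q
    rw [List.pairwise_cons] at hq
    obtain ⟨E1, hE1, hm1⟩ := testRow_val p i A (f i) l E hq.1
    obtain ⟨E', hE', hm⟩ := ih E1 hq.2
    refine ⟨E', ?_, ?_⟩
    · rw [testAll]
      simp only [Timed.bind_val, hE1]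
      exact hE'
    · rintro ⟨a, b⟩
      rw [hm, hm1, List.map_cons]
      have : [a, b].Sublist (i :: l.map Prod.fst) ↔
          (a = i ∧ b ∈ l.map Prod.fst) ∨ [a, b].Sublist (l.map Prod.fst) := by
        rw [List.sublist_cons_iff]
        constructor
        · rintro (h | ⟨r, hr, h⟩)
          · exact Or.inr h
          · rw [List.cons.injEq] at hr
            obtain ⟨rfl, rfl⟩ := hr
            exact Or.inl ⟨rfl, List.singleton_sublist.1 h⟩
        · rintro (⟨rfl, h⟩ | h)
          · exact Or.inr ⟨[b], rfl, List.singleton_sublist.2 h⟩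
          · exact Or.inl h
      simp only [this]
      constructor
      · rintro ((h | ⟨rfl, h2, h3⟩) | ⟨h1, h2⟩)
        · exact Or.inl h
        · exact Or.inr ⟨h2, Or.inl ⟨rfl, h3⟩⟩
        · exact Or.inr ⟨h1, Or.inr h2⟩
      · rintro (h | ⟨h1, ⟨rfl, h2⟩ | h2⟩)
        · exact Or.inl (Or.inl h)
        · exact Or.inl (Or.inr ⟨rfl, h1, h2⟩)
        · exact Or.inr ⟨h1, h2⟩

lemma testAll_cost {V : Type} (p : Params) (K N : ℕ) :
    ∀ (l : List (V × SiteRecord)) (E : List (V × V)), l.length ≤ N →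
    (∀ q ∈ l, ∀ q' ∈ l, (testPair p q.2 q'.2).cost ≤ K) →
    (testAll p l E).cost ≤ l.length * (N * (K + 5) + 6) + 2 := by
  intro l
  induction l with
  | nil => exact fun E _ _ => by simp [testAll]
  | cons q l ih =>
    intro E hN hq
    obtain ⟨i, A⟩ := q
    simp only [List.length_cons] at hN
    have h1 := testRow_cost p i A K l E fun q' hq' =>
      hq (i, A) (by simp) q' (by simp [hq'])
    have h2 := fun E => ih E (by omega) fun q hq' q' hq'' => hq q (by simp [hq']) q' (by simp [hq''])
    have h3 : l.length * (K + 5) ≤ N * (K + 5) := Nat.mul_le_mul_right _ (by omega)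
    rw [testAll]
    simp only [Timed.bind_cost, tick_cost, List.length_cons]
    rw [add_mul, one_mul]
    cases (testRow p i A l E).val with
    | none =>
      simp only [Timed.pure_cost]
      omega
    | some E' =>
      have := h2 E'
      simp only
      omega

/-! ## Restarting a marked Poisson process -/

/-- The law of one waiting time together with one mark. -/
def stepLaw : Measure (ℝ × unitInterval) := stdExp.prod volume

instance : IsProbabilityMeasure stepLaw := by unfold stepLaw; infer_instance

/-- The law of the waiting times and marks of one site. -/
def siteLaw : Measure (ℕ → ℝ × unitInterval) := Measure.infinitePi fun _ => stepLaw

instance : IsProbabilityMeasure siteLaw := by unfold siteLaw; infer_instance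

lemma infinitePi_nat_apply {β : Type*} [MeasurableSpace β] (μ : Measure β)
    [IsProbabilityMeasure μ] (m : ℕ) {t : ℕ → Set β} (ht : ∀ k, MeasurableSet (t k)) :
    Measure.infinitePi (fun _ : ℕ => μ) {a | ∀ k < m, a k ∈ t k} =
      ∏ k ∈ Finset.range m, μ (t k) := by
  rw [← Measure.infinitePi_pi (fun _ : ℕ => μ) (s := Finset.range m) fun k _ => ht k]
  congr 1
  ext a
  simp [Set.mem_pi]

/-- A box over any finite index set becomes one over an initial segment after padding with
`Set.univ`. Initial segments suit the inductions on the length in `spliceSeq_box`. -/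
lemma eq_infinitePi_nat {β : Type*} [MeasurableSpace β] (μ : Measure β)
    [IsProbabilityMeasure μ] {ν : Measure (ℕ → β)}
    (h : ∀ (m : ℕ) (t : ℕ → Set β), (∀ k, MeasurableSet (t k)) →
      ν {a | ∀ k < m, a k ∈ t k} = ∏ k ∈ Finset.range m, μ (t k)) :
    ν = Measure.infinitePi fun _ => μ := by
  classical
  refine Measure.eq_infinitePi _ fun s t ht => ?_
  obtain ⟨m, hm⟩ : ∃ m, s ⊆ Finset.range m := s.exists_nat_subset_range
  have h1 := h m (fun k => if k ∈ s then t k else Set.univ) fun k => by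
    split_ifs
    exacts [ht k, MeasurableSet.univ]
  have h2 : {a : ℕ → β | ∀ k < m, a k ∈ if k ∈ s then t k else Set.univ} = (s : Set ℕ).pi t := by
    ext a
    simp only [Set.mem_ofPred_eq, Set.mem_pi, Finset.mem_coe]
    refine ⟨fun ha k hk => ?_, fun ha k _ => ?_⟩
    · simpa [hk] using ha k (Finset.mem_range.1 (hm hk))
    · by_cases hk : k ∈ s
      · simpa [hk] using ha k hk
      · simp [hk]
  rw [← h2, h1]
  have : ∀ k, μ (if k ∈ s then t k else Set.univ) = if k ∈ s then μ (t k) else 1 := by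
    intro k
    split_ifs <;> simp
  simp only [this]
  rw [Finset.prod_ite_mem, Finset.inter_eq_right.2 hm]

/-- Prepend an element to a sequence. -/
def seqCons {β : Type*} (z : β) (a : ℕ → β) : ℕ → β
  | 0 => z
  | k + 1 => a k

lemma measurable_seqCons {β : Type*} [MeasurableSpace β] :
    Measurable fun p : β × (ℕ → β) => seqCons p.1 p.2 := by
  refine measurable_pi_lambda _ fun k => ?_
  cases k with
  | zero => exact measurable_fst
  | succ k => exact (measurable_pi_apply k).comp measurable_snd

lemma measurePreserving_seqCons {β : Type*} [MeasurableSpace β] (μ : Measure β)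
    [IsProbabilityMeasure μ] :
    MeasurePreserving (fun p : β × (ℕ → β) => seqCons p.1 p.2)
      (μ.prod (Measure.infinitePi fun _ => μ)) (Measure.infinitePi fun _ => μ) := by
  refine ⟨measurable_seqCons, eq_infinitePi_nat μ fun m t ht => ?_⟩
  rw [Measure.map_apply measurable_seqCons]
  · cases m with
    | zero => simp
    | succ m =>
      have : (fun p : β × (ℕ → β) => seqCons p.1 p.2) ⁻¹' {a | ∀ k < m + 1, a k ∈ t k} =
          t 0 ×ˢ {a | ∀ k < m, a k ∈ t (k + 1)} := by
        ext p
        simp only [Set.mem_preimage, Set.mem_ofPred_eq, Set.mem_prod]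
        refine ⟨fun h => ⟨h 0 (by omega), fun k hk => h (k + 1) (by omega)⟩, fun h k hk => ?_⟩
        cases k with
        | zero => exact h.1
        | succ k => exact h.2 k (by omega)
      rw [this, Measure.prod_prod, infinitePi_nat_apply μ m fun k => ht (k + 1),
        Finset.prod_range_succ', mul_comm]
  · have : {a : ℕ → β | ∀ k < m, a k ∈ t k} = (Finset.range m : Set ℕ).pi t := by
      ext a
      simp [Set.mem_pi]
    rw [this]
    exact MeasurableSet.pi (Finset.countable_toSet _) fun k _ => ht k

/-- Memorylessness of the exponential law, read off from the translation of its density. The restart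
at a fixed time rests on it. -/
lemma stdExp_inter_Ici {h : ℝ} (hh : 0 ≤ h) {s : Set ℝ} (hs : MeasurableSet s) :
    stdExp (s ∩ Set.Ici h) = ENNReal.ofReal (Real.exp (-h)) * stdExp ((fun y => h + y) ⁻¹' s) := by
  have hm : Measurable fun y : ℝ => h + y := measurable_const_add h
  have hpdf : ∀ t : Set ℝ, MeasurableSet t →
      stdExp t = ∫⁻ x, t.indicator (ProbabilityTheory.exponentialPDF 1) x := by
    intro t ht
    rw [lintegral_indicator ht]
    change (volume.withDensity (ProbabilityTheory.exponentialPDF 1)) t = _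
    rw [withDensity_apply _ ht]
  rw [hpdf _ (hs.inter measurableSet_Ici), hpdf _ (hm hs),
    ← lintegral_const_mul' _ _ ENNReal.ofReal_ne_top,
    ← lintegral_add_left_eq_self (fun x =>
      (s ∩ Set.Ici h).indicator (ProbabilityTheory.exponentialPDF 1) x) h]
  refine lintegral_congr fun y => ?_
  by_cases hy : h + y ∈ s
  · by_cases hy0 : 0 ≤ y
    · rw [Set.indicator_of_mem (show h + y ∈ s ∩ Set.Ici h from ⟨hy, by simpa using hy0⟩),
        Set.indicator_of_mem (show y ∈ (fun y => h + y) ⁻¹' s from hy),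
        ProbabilityTheory.exponentialPDF_of_nonneg hy0,
        ProbabilityTheory.exponentialPDF_of_nonneg (by linarith), ← ENNReal.ofReal_mul
        (Real.exp_pos _).le]
      congr 1
      rw [one_mul, one_mul, one_mul, one_mul, ← Real.exp_add]
      congr 1
      ring
    · rw [Set.indicator_of_notMem (fun hc => hy0 (by simpa using hc.2)),
        Set.indicator_of_mem (show y ∈ (fun y => h + y) ⁻¹' s from hy),
        ProbabilityTheory.exponentialPDF_of_neg (not_le.1 hy0), mul_zero]
  · rw [Set.indicator_of_notMem (fun hc => hy hc.1),
      Set.indicator_of_notMem (show y ∉ (fun y => h + y) ⁻¹' s from hy), mul_zero]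

lemma stdExp_Ici {h : ℝ} (hh : 0 ≤ h) : stdExp (Set.Ici h) = ENNReal.ofReal (Real.exp (-h)) := by
  have := stdExp_inter_Ici hh MeasurableSet.univ
  simpa using this

lemma stepLaw_inter_Ici {h : ℝ} (hh : 0 ≤ h) {s : Set (ℝ × unitInterval)}
    (hs : MeasurableSet s) :
    stepLaw (s ∩ {z | h ≤ z.1}) =
      ENNReal.ofReal (Real.exp (-h)) * stepLaw ((fun z => (h + z.1, z.2)) ⁻¹' s) := by
  have hm : Measurable fun z : ℝ × unitInterval => (h + z.1, z.2) :=
    (measurable_fst.const_add h).prodMk measurable_snd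
  have hI : MeasurableSet {z : ℝ × unitInterval | h ≤ z.1} :=
    measurableSet_le measurable_const measurable_fst
  rw [stepLaw, Measure.prod_apply_symm (hs.inter hI), Measure.prod_apply_symm (hm hs),
    ← lintegral_const_mul' _ _ ENNReal.ofReal_ne_top]
  refine lintegral_congr fun v => ?_
  exact stdExp_inter_Ici hh (measurable_prodMk_right hs : MeasurableSet ((fun x => (x, v)) ⁻¹' s))

/-- Follow `a` before time `h`, and `a'` from then on. -/
def spliceSeq : ℝ → (ℕ → ℝ × unitInterval) → (ℕ → ℝ × unitInterval) → ℕ → ℝ × unitInterval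
  -- The waiting time that straddles `h` is replaced by `h` plus a fresh one, with a fresh mark.
  | h, a, a', 0 => if h ≤ (a 0).1 then (h + (a' 0).1, (a' 0).2) else a 0
  | h, a, a', k + 1 =>
    if h ≤ (a 0).1 then a' (k + 1) else spliceSeq (h - (a 0).1) (fun m => a (m + 1)) a' k

lemma measurable_spliceSeq (k : ℕ) : Measurable fun p : ℝ × (ℕ → ℝ × unitInterval) ×
    (ℕ → ℝ × unitInterval) => spliceSeq p.1 p.2.1 p.2.2 k := by
  have h0 : Measurable fun p : ℝ × (ℕ → ℝ × unitInterval) × (ℕ → ℝ × unitInterval) =>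
      (p.2.1 0).1 := by fun_prop
  have hset : MeasurableSet {p : ℝ × (ℕ → ℝ × unitInterval) × (ℕ → ℝ × unitInterval) |
      p.1 ≤ (p.2.1 0).1} := measurableSet_le measurable_fst h0
  induction k with
  | zero =>
    simp only [spliceSeq]
    exact Measurable.ite hset (by fun_prop) (by fun_prop)
  | succ k ih =>
    simp only [spliceSeq]
    refine Measurable.ite hset (by fun_prop) ?_
    have hg : Measurable fun p : ℝ × (ℕ → ℝ × unitInterval) × (ℕ → ℝ × unitInterval) =>
      (p.1 - (p.2.1 0).1, (fun m => p.2.1 (m + 1)), p.2.2) := by fun_prop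
    exact ih.comp hg

lemma measurable_spliceSeq_right (h : ℝ) : Measurable fun p : (ℕ → ℝ × unitInterval) ×
    (ℕ → ℝ × unitInterval) => spliceSeq h p.1 p.2 :=
  measurable_pi_lambda _ fun k => (measurable_spliceSeq k).comp (measurable_prodMk_left (x := h))

lemma measurableSet_box {β : Type*} [MeasurableSpace β] (m : ℕ) {t : ℕ → Set β}
    (ht : ∀ k, MeasurableSet (t k)) : MeasurableSet {a : ℕ → β | ∀ k < m, a k ∈ t k} := by
  have : {a : ℕ → β | ∀ k < m, a k ∈ t k} = (Finset.range m : Set ℕ).pi t := by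
    ext a
    simp [Set.mem_pi]
  rw [this]
  exact MeasurableSet.pi (Finset.countable_toSet _) fun k _ => ht k

/-- Condition on the first pair `z` of `a`. If its time is at least `h`, the spliced sequence is
`a'` with `h` added to the first time. Otherwise `z` is kept and the tail is a splice at the earlier
time `h - z.1`, to which the induction hypothesis applies; this is why `h` is quantified inside. -/
lemma spliceSeq_box (m : ℕ) : ∀ (h : ℝ), 0 ≤ h → ∀ t : ℕ → Set (ℝ × unitInterval),
    (∀ k, MeasurableSet (t k)) →
    ∫⁻ a, siteLaw {a' | ∀ k < m, spliceSeq h a a' k ∈ t k} ∂siteLaw =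
      ∏ k ∈ Finset.range m, stepLaw (t k) := by
  induction m with
  | zero => intro h _ t _; simp
  | succ m ih =>
    intro h hh t ht
    have hbox : MeasurableSet {q : (ℕ → ℝ × unitInterval) × (ℕ → ℝ × unitInterval) |
        ∀ k < m + 1, spliceSeq h q.1 q.2 k ∈ t k} :=
      measurable_spliceSeq_right h (measurableSet_box (m + 1) ht)
    have hmeas := measurable_measure_prodMk_left (ν := siteLaw) hbox
    have hmeas' : Measurable fun a => siteLaw {a' | ∀ k < m + 1, spliceSeq h a a' k ∈ t k} := hmeas
    have hcons := measurePreserving_seqCons stepLaw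
    change MeasurePreserving _ (stepLaw.prod siteLaw) siteLaw at hcons
    have hcm := hmeas'.comp hcons.measurable
    -- Separates the first pair of `a` from its tail.
    rw [← hcons.lintegral_comp hmeas', lintegral_prod _ (by exact hcm.aemeasurable)]
    set P' := ∏ k ∈ Finset.range m, stepLaw (t (k + 1)) with hP
    set c := stepLaw ((fun z => (h + z.1, z.2)) ⁻¹' t 0) with hc
    have hm : Measurable fun z : ℝ × unitInterval => (h + z.1, z.2) :=
      (measurable_fst.const_add h).prodMk measurable_snd
    have hI : MeasurableSet {z : ℝ × unitInterval | h ≤ z.1} :=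
      measurableSet_le measurable_const measurable_fst
    have inner : ∀ z : ℝ × unitInterval,
        ∫⁻ b, siteLaw {a' | ∀ k < m + 1, spliceSeq h (seqCons z b) a' k ∈ t k} ∂siteLaw =
          {z | h ≤ z.1}.indicator (fun _ => c * P') z +
            (t 0 ∩ {z | h ≤ z.1}ᶜ).indicator (fun _ => P') z := by
      intro z
      by_cases hz : h ≤ z.1
      · rw [Set.indicator_of_mem (show z ∈ {z : ℝ × unitInterval | h ≤ z.1} from hz),
          Set.indicator_of_notMem (fun hc => hc.2 hz), add_zero]
        have : ∀ b, {a' | ∀ k < m + 1, spliceSeq h (seqCons z b) a' k ∈ t k} =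
            {a' | ∀ k < m + 1, a' k ∈
              (fun k => if k = 0 then (fun z : ℝ × unitInterval => (h + z.1, z.2)) ⁻¹' t 0
                else t k) k} := by
          intro b
          ext a'
          refine forall_congr' fun k => imp_congr_right fun _ => ?_
          cases k with
          | zero => simp [spliceSeq, seqCons, hz]
          | succ k => simp [spliceSeq, seqCons, hz]
        simp only [this, lintegral_const, measure_univ, mul_one]
        rw [siteLaw, infinitePi_nat_apply _ _ (fun k => by
          split_ifs
          exacts [hm (ht 0), ht k]), Finset.prod_range_succ']
        simp only [Nat.add_eq_zero_iff, one_ne_zero, and_false, if_false, if_true]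
        rw [mul_comm]
      · rw [Set.indicator_of_notMem (show z ∉ {z : ℝ × unitInterval | h ≤ z.1} from hz), zero_add]
        have hs : ∀ b, {a' | ∀ k < m + 1, spliceSeq h (seqCons z b) a' k ∈ t k} =
            {a' | z ∈ t 0 ∧ ∀ k < m, spliceSeq (h - z.1) b a' k ∈ t (k + 1)} := by
          intro b
          ext a'
          simp only [Set.mem_ofPred_eq]
          refine ⟨fun H => ⟨?_, fun k hk => ?_⟩, fun H k hk => ?_⟩
          · simpa [spliceSeq, seqCons, hz] using H 0 (by omega)
          · simpa [spliceSeq, seqCons, hz] using H (k + 1) (by omega)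
          · cases k with
            | zero => simpa [spliceSeq, seqCons, hz] using H.1
            | succ k => simpa [spliceSeq, seqCons, hz] using H.2 k (by omega)
        simp only [hs]
        by_cases hz0 : z ∈ t 0
        · rw [Set.indicator_of_mem (show z ∈ t 0 ∩ {z | h ≤ z.1}ᶜ from ⟨hz0, hz⟩)]
          simp only [hz0, true_and]
          exact ih (h - z.1) (by linarith) (fun k => t (k + 1)) fun k => ht (k + 1)
        · rw [Set.indicator_of_notMem (fun hc => hz0 hc.1)]
          simp [hz0]
    rw [lintegral_congr inner, lintegral_add_left (measurable_const.indicator hI),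
      lintegral_indicator hI, lintegral_indicator ((ht 0).inter hI.compl)]
    simp only [lintegral_const, Measure.restrict_apply MeasurableSet.univ, Set.univ_inter]
    have e1 : stepLaw {z : ℝ × unitInterval | h ≤ z.1} = ENNReal.ofReal (Real.exp (-h)) := by
      simpa using stepLaw_inter_Ici hh MeasurableSet.univ
    -- Memorylessness identifies the contribution of the straddling case with the part of `t 0`
    -- beyond `h`, so that the two cases recombine to `stepLaw (t 0)`.
    have e2 : stepLaw (t 0) = ENNReal.ofReal (Real.exp (-h)) * c +
        stepLaw (t 0 ∩ {z | h ≤ z.1}ᶜ) := by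
      rw [hc, ← stepLaw_inter_Ici hh (ht 0), ← Set.sdiff_eq, measure_inter_add_sdiff _ hI]
    rw [Finset.prod_range_succ', e1, e2, ← hP]
    ring

lemma measurePreserving_spliceSeq {h : ℝ} (hh : 0 ≤ h) :
    MeasurePreserving (fun p : (ℕ → ℝ × unitInterval) × (ℕ → ℝ × unitInterval) =>
      spliceSeq h p.1 p.2) (siteLaw.prod siteLaw) siteLaw := by
  refine ⟨measurable_spliceSeq_right h, eq_infinitePi_nat stepLaw fun m t ht => ?_⟩
  rw [Measure.map_apply (measurable_spliceSeq_right h) (measurableSet_box m ht),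
    Measure.prod_apply (measurable_spliceSeq_right h (measurableSet_box m ht))]
  exact spliceSeq_box m h hh t ht

/-- The hypotheses say that `a` has exactly `N` updates before `h`. The later part is stated for
partial sums, because the waiting time with index `N` comes neither from `a` nor from `a'`, whereas
the update times are simply those of `a'` delayed by `h`. -/
lemma spliceSeq_eq (N : ℕ) : ∀ (h : ℝ) (a a' : ℕ → ℝ × unitInterval),
    (∀ m < N, ∑ k ∈ Finset.range (m + 1), (a k).1 < h) →
    h ≤ ∑ k ∈ Finset.range (N + 1), (a k).1 →
    (∀ m < N, spliceSeq h a a' m = a m) ∧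
      (∀ m, ∑ k ∈ Finset.range (N + m + 1), (spliceSeq h a a' k).1 =
        h + ∑ k ∈ Finset.range (m + 1), (a' k).1) ∧
      ∀ m, (spliceSeq h a a' (N + m)).2 = (a' m).2 := by
  induction N with
  | zero =>
    intro h a a' _ h2
    have h0 : h ≤ (a 0).1 := by simpa using h2
    refine ⟨fun m hm => by omega, fun m => ?_, fun m => ?_⟩
    · rw [zero_add, Finset.sum_range_succ', Finset.sum_range_succ' (fun k => (a' k).1)]
      simp only [spliceSeq, if_pos h0]
      ring
    · rw [zero_add]
      cases m <;> simp [spliceSeq, h0]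
  | succ N ih =>
    intro h a a' h1 h2
    have h0 : ¬ h ≤ (a 0).1 := not_le.2 (by simpa using h1 0 (by omega))
    obtain ⟨i1, i2, i3⟩ := ih (h - (a 0).1) (fun m => a (m + 1)) a'
      (fun m hm => by
        have := h1 (m + 1) (by omega)
        rw [Finset.sum_range_succ'] at this
        linarith)
      (by
        rw [Finset.sum_range_succ'] at h2
        linarith)
    refine ⟨fun m hm => ?_, fun m => ?_, fun m => ?_⟩
    · cases m with
      | zero => simp [spliceSeq, h0]
      | succ m => simpa [spliceSeq, h0] using i1 m (by omega)
    · rw [show N + 1 + m + 1 = (N + m + 1) + 1 by omega, Finset.sum_range_succ']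
      simp only [spliceSeq, if_neg h0]
      rw [i2]
      ring
    · rw [show N + 1 + m = N + m + 1 by omega]
      simpa [spliceSeq, h0] using i3 m

/-! ## The law of the driving noise -/

/-- The law of the waiting times. -/
def clockLaw (n : ℕ) : Measure (Clocks n) := Measure.infinitePi fun _ => stdExp

/-- The law of the marks. -/
def markLaw (n : ℕ) : Measure (Marks n) := Measure.infinitePi fun _ => volume

/-- The law of the driving noise without the initial configuration. -/
def driveLaw (n : ℕ) : Measure (Drive n) := (clockLaw n).prod (markLaw n)

instance : IsProbabilityMeasure (clockLaw n) := by unfold clockLaw; infer_instance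

instance : IsProbabilityMeasure (markLaw n) := by unfold markLaw; infer_instance

instance : IsProbabilityMeasure (driveLaw n) := by unfold driveLaw; infer_instance

lemma infinitePi_prod_infinitePi {ι β γ : Type*} [MeasurableSpace β] [MeasurableSpace γ]
    (μ : Measure β) (ν : Measure γ) [IsProbabilityMeasure μ] [IsProbabilityMeasure ν] :
    MeasurePreserving (fun (p : (ι → β) × (ι → γ)) e => (p.1 e, p.2 e))
      ((Measure.infinitePi fun _ : ι => μ).prod (Measure.infinitePi fun _ : ι => ν))
      (Measure.infinitePi fun _ : ι => μ.prod ν) := by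
  have hm : Measurable fun (p : (ι → β) × (ι → γ)) e => (p.1 e, p.2 e) := by fun_prop
  refine ⟨hm, Measure.eq_infinitePi _ fun s t ht => ?_⟩
  rw [Measure.map_apply hm (MeasurableSet.pi (Finset.countable_toSet s) fun k _ => ht k)]
  have h1 : MeasurePreserving (fun (p : (ι → β) × (ι → γ)) => (s.restrict p.1, s.restrict p.2))
      ((Measure.infinitePi fun _ : ι => μ).prod (Measure.infinitePi fun _ : ι => ν))
      ((Measure.pi fun _ : s => μ).prod (Measure.pi fun _ : s => ν)) :=
    MeasurePreserving.prod ⟨by fun_prop, Measure.infinitePi_map_restrict _⟩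
      ⟨by fun_prop, Measure.infinitePi_map_restrict _⟩
  have h2 := ((measurePreserving_arrowProdEquivProdArrow β γ s (fun _ => μ) fun _ => ν).symm).comp h1
  have hset : MeasurableSet (Set.univ.pi fun e : s => t e) :=
    MeasurableSet.univ_pi fun e => ht e
  have h3 := h2.measure_preimage hset.nullMeasurableSet
  rw [Measure.pi_pi, Finset.prod_coe_sort s fun e => (μ.prod ν) (t e)] at h3
  rw [← h3]
  congr 1
  ext p
  simp only [Set.mem_preimage, Set.mem_pi, Set.mem_univ, true_implies, Subtype.forall]
  rfl

/-- The noise of the separate sites. -/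
def bySite (ω : Drive n) : Fin n → ℕ → ℝ × unitInterval := fun i m => (ω.1 (i, m), ω.2 (i, m))

/-- The noise with given noises of the separate sites. -/
def ofSites (a : Fin n → ℕ → ℝ × unitInterval) : Drive n :=
  (fun e => (a e.1 e.2).1, fun e => (a e.1 e.2).2)

lemma measurable_ofSites : Measurable (ofSites (n := n)) := by unfold ofSites; fun_prop

lemma measurePreserving_bySite :
    MeasurePreserving (bySite (n := n)) (driveLaw n) (Measure.pi fun _ => siteLaw) := by
  have h1 : MeasurePreserving _ (driveLaw n) _ :=
    infinitePi_prod_infinitePi (ι := Fin n × ℕ) stdExp (volume : Measure unitInterval)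
  have h2 : MeasurePreserving (MeasurableEquiv.curry (Fin n) ℕ (ℝ × unitInterval))
      (Measure.infinitePi fun _ : Fin n × ℕ => stepLaw) (Measure.pi fun _ => siteLaw) := by
    refine ⟨(MeasurableEquiv.curry _ _ _).measurable, ?_⟩
    rw [← Measure.infinitePi_eq_pi]
    exact Measure.infinitePi_map_curry fun (_ : Fin n) (_ : ℕ) => stepLaw
  exact h2.comp h1

lemma measurePreserving_ofSites :
    MeasurePreserving (ofSites (n := n)) (Measure.pi fun _ => siteLaw) (driveLaw n) := by
  refine ⟨measurable_ofSites, ?_⟩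
  rw [← measurePreserving_bySite.map_eq, Measure.map_map measurable_ofSites
    measurePreserving_bySite.measurable]
  exact Measure.map_id

/-- Follow `ω` before time `h`, and `ω'` from then on. -/
def splice (h : ℝ) (ω ω' : Drive n) : Drive n :=
  ofSites fun i => spliceSeq h (bySite ω i) (bySite ω' i)

lemma measurePreserving_splice {h : ℝ} (hh : 0 ≤ h) :
    MeasurePreserving (fun p : Drive n × Drive n => splice h p.1 p.2)
      ((driveLaw n).prod (driveLaw n)) (driveLaw n) := by
  have h1 := (measurePreserving_bySite (n := n)).prod (measurePreserving_bySite (n := n))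
  have h2 := ((measurePreserving_arrowProdEquivProdArrow (ℕ → ℝ × unitInterval)
    (ℕ → ℝ × unitInterval) (Fin n) (fun _ => siteLaw) fun _ => siteLaw).symm).comp h1
  have h3 := (measurePreserving_pi (fun _ : Fin n => siteLaw.prod siteLaw) (fun _ => siteLaw)
    fun _ => measurePreserving_spliceSeq hh).comp h2
  exact measurePreserving_ofSites.comp h3

lemma Regular.splice_aux {ω : Drive n} (hω : Regular ω.1) (h : ℝ) (ω' : Drive n) (i : Fin n) :
    (∀ m < numBefore h ω.1 i, arr (splice h ω ω').1 (i, m) = arr ω.1 (i, m) ∧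
        (splice h ω ω').2 (i, m) = ω.2 (i, m)) ∧
      (∀ m, arr (splice h ω ω').1 (i, numBefore h ω.1 i + m) = h + arr ω'.1 (i, m)) ∧
      ∀ m, (splice h ω ω').2 (i, numBefore h ω.1 i + m) = ω'.2 (i, m) := by
  obtain ⟨h1, h2, h3⟩ := spliceSeq_eq (numBefore h ω.1 i) h (bySite ω i) (bySite ω' i)
    (fun m hm => (hω.lt_numBefore_iff h i m).1 hm)
    (not_lt.1 ((hω.lt_numBefore_iff h i _).not.1 (lt_irrefl _)))
  refine ⟨fun m hm => ⟨?_, ?_⟩, h2, h3⟩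
  · refine Finset.sum_congr rfl fun k hk => ?_
    change (spliceSeq h (bySite ω i) (bySite ω' i) k).1 = _
    rw [h1 k (by have := Finset.mem_range.1 hk; omega)]
    rfl
  · change (spliceSeq h (bySite ω i) (bySite ω' i) m).2 = _
    rw [h1 m hm]
    rfl

lemma Regular.arr_splice {ω : Drive n} (hω : Regular ω.1) {ω' : Drive n} (hω' : Regular ω'.1)
    (h : ℝ) (e : Fin n × ℕ) :
    (arr (splice h ω ω').1 e < h ↔ arr ω.1 e < h) ∧
      (arr ω.1 e < h → arr (splice h ω ω').1 e = arr ω.1 e) := by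
  obtain ⟨i, m⟩ := e
  obtain ⟨h1, h2, -⟩ := hω.splice_aux h ω' i
  by_cases hm : m < numBefore h ω.1 i
  · rw [(h1 m hm).1]
    simp
  · have hm' : ¬ arr ω.1 (i, m) < h := fun hc => hm ((hω.lt_numBefore_iff h i m).2 hc)
    have := h2 (m - numBefore h ω.1 i)
    rw [Nat.add_sub_cancel' (not_lt.1 hm)] at this
    have h0 := hω'.nonneg (i, m - numBefore h ω.1 i)
    refine ⟨⟨fun hc => ?_, fun hc => absurd hc hm'⟩, fun hc => absurd hc hm'⟩
    linarith

lemma Regular.word_splice {ω : Drive n} (hω : Regular ω.1) {ω' : Drive n} (hω' : Regular ω'.1)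
    (h : ℝ) : word h (splice h ω ω').1 = word h ω.1 := by
  have hE := hω.isEnum_word h
  refine word_eq_of_isEnum ⟨?_, fun e => ?_⟩
  · refine List.Pairwise.imp_of_mem ?_ hE.1
    intro a b ha hb hab
    rw [(hω.arr_splice hω' h a).2 ((hE.2 a).1 ha), (hω.arr_splice hω' h b).2 ((hE.2 b).1 hb)]
    exact hab
  · rw [hE.2]
    exact (hω.arr_splice hω' h e).1.symm

/-- Together with `outcome_splice`: on spliced noise the outcome before `h` is a function of `ω`
alone, and the future is `ω'`. As splicing preserves the law, past outcome and future are
independent. -/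
lemma Regular.shift_splice {ω : Drive n} (hω : Regular ω.1) {ω' : Drive n} (hω' : Regular ω'.1)
    (h : ℝ) : shift h (splice h ω ω') = ω' := by
  have hN : numBefore h (splice h ω ω').1 = numBefore h ω.1 := by
    funext i
    rw [numBefore, hω.word_splice hω' h, numBefore]
  refine Prod.ext (funext fun e => ?_) (funext fun e => ?_)
  · obtain ⟨i, m⟩ := e
    obtain ⟨-, h2, -⟩ := hω.splice_aux h ω' i
    simp only [shift, GlauberMRF.shiftClocks, hN, h2]
    cases m with
    | zero => simp [arr_zero]
    | succ m => simp [arr_succ]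
  · obtain ⟨i, m⟩ := e
    obtain ⟨-, -, h3⟩ := hω.splice_aux h ω' i
    simp only [shift, hN, h3]

lemma runTrace_congr (ψ : Hamiltonian n) {u u' : Marks n} (wd : List (Fin n × ℕ)) :
    ∀ x : Config n, (∀ e ∈ wd, u e = u' e) → runTrace ψ u x wd = runTrace ψ u' x wd := by
  induction wd with
  | nil => intros; rfl
  | cons e wd ih =>
    intro x hu
    have h1 : step ψ u x e = step ψ u' x e := by rw [step, step, hu e (by simp)]
    rw [runTrace, runTrace, h1, ih _ fun e he => hu e (by simp [he])]

lemma Regular.outcome_splice (ψ : Hamiltonian n) (x : Config n) {ω : Drive n}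
    (hω : Regular ω.1) {ω' : Drive n} (hω' : Regular ω'.1) (h : ℝ) :
    outcome ψ h x (splice h ω ω') = outcome ψ h x ω := by
  rw [outcome, hω.word_splice hω' h, outcome]
  refine runTrace_congr ψ _ x fun e he => ?_
  obtain ⟨i, m⟩ := e
  have hm : arr ω.1 (i, m) < h := ((hω.isEnum_word h).2 _).1 he
  exact ((hω.splice_aux h ω' i).1 m ((hω.lt_numBefore_iff h i m).2 hm)).2

/-! ### Measurability -/

instance : DiscreteMeasurableSpace ℤˣ := by
  have : MeasurableSingletonClass ℤˣ := by
    refine ⟨fun u => ⟨{(u : ℤ)}, MeasurableSet.of_discrete, ?_⟩⟩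
    ext v
    simp [Units.ext_iff]
  infer_instance

lemma measurable_arr (e : Fin n × ℕ) : Measurable fun w : Clocks n => arr w e := by
  unfold arr
  fun_prop

lemma measurableSet_isEnum (h : ℝ) (l : List (Fin n × ℕ)) :
    MeasurableSet {w : Clocks n | IsEnum w (Set.Iio h) l} := by
  have h1 : MeasurableSet {w : Clocks n | l.Pairwise fun e e' => arr w e < arr w e'} := by
    induction l with
    | nil => simp
    | cons e l ih =>
      have : {w : Clocks n | (e :: l).Pairwise fun e e' => arr w e < arr w e'} =
          (⋂ e' ∈ l.toFinset, {w | arr w e < arr w e'}) ∩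
            {w | l.Pairwise fun e e' => arr w e < arr w e'} := by
        ext w
        simp
      rw [this]
      exact (Finset.measurableSet_biInter _ fun e' _ =>
        measurableSet_lt (measurable_arr e) (measurable_arr e')).inter ih
  have h2 : MeasurableSet {w : Clocks n | ∀ e, e ∈ l ↔ arr w e ∈ Set.Iio h} := by
    simp only [Set.ofPred_forall]
    refine MeasurableSet.iInter fun e => ?_
    by_cases he : e ∈ l
    · simp only [he, true_iff]
      exact measurable_arr e measurableSet_Iio
    · simp only [he, false_iff]
      exact (measurable_arr e measurableSet_Iio).compl
  exact h1.inter h2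

lemma measurableSet_word (h : ℝ) (l : List (Fin n × ℕ)) :
    MeasurableSet {w : Clocks n | word h w = l} := by
  have hex : MeasurableSet {w : Clocks n | ∃ l, IsEnum w (Set.Iio h) l} := by
    simp only [Set.ofPred_exists]
    exact MeasurableSet.iUnion fun l => measurableSet_isEnum h l
  have : {w : Clocks n | word h w = l} = {w | IsEnum w (Set.Iio h) l} ∪
      ({w | ∃ l, IsEnum w (Set.Iio h) l}ᶜ ∩ {_w | [] = l}) := by
    ext w
    simp only [Set.mem_ofPred_eq, Set.mem_union, Set.mem_inter_iff, Set.mem_compl_iff]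
    by_cases hw : ∃ l, IsEnum w (Set.Iio h) l
    · constructor
      · rintro rfl
        left
        rw [word, dif_pos hw]
        exact hw.choose_spec
      · rintro (h1 | h1)
        · exact word_eq_of_isEnum h1
        · exact absurd hw h1.1
    · rw [word, dif_neg hw]
      refine ⟨fun h1 => Or.inr ⟨hw, h1⟩, ?_⟩
      rintro (h1 | h1)
      · exact absurd ⟨l, h1⟩ hw
      · exact h1.2
  rw [this]
  exact (measurableSet_isEnum h l).union (hex.compl.inter (MeasurableSet.const _))

/-- Functions of a countably valued variable with measurable fibres are measurable. -/
lemma measurable_of_fibres {Ω β γ : Type*} [MeasurableSpace Ω] [MeasurableSpace γ] [Countable β]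
    {f : Ω → β} (hf : ∀ b, MeasurableSet {ω | f ω = b}) {g : β → Ω → γ}
    (hg : ∀ b, Measurable (g b)) : Measurable fun ω => g (f ω) ω := by
  intro s hs
  have : (fun ω => g (f ω) ω) ⁻¹' s = ⋃ b, {ω | f ω = b} ∩ g b ⁻¹' s := by
    ext ω
    simp
  rw [this]
  exact MeasurableSet.iUnion fun b => (hf b).inter (hg b hs)

lemma measurable_shift (h : ℝ) : Measurable (shift h : Drive n → Drive n) := by
  have key : ∀ {γ : Type} [MeasurableSpace γ] (i : Fin n) (g : ℕ → Drive n → γ),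
      (∀ N, Measurable (g N)) → Measurable fun ω : Drive n => g (numBefore h ω.1 i) ω := by
    intro γ _ i g hg
    exact measurable_of_fibres (f := fun ω : Drive n => word h ω.1)
      (g := fun l ω => g (countSite i l) ω)
      (fun l => measurable_fst (measurableSet_word h l)) fun l => hg _
  refine Measurable.prodMk (measurable_pi_lambda _ fun e => ?_) (measurable_pi_lambda _ fun e => ?_)
  · refine key e.1 (fun N ω => arr ω.1 (e.1, N + e.2) -
      if e.2 = 0 then h else arr ω.1 (e.1, N + (e.2 - 1))) fun N => ?_
    refine ((measurable_arr _).comp measurable_fst).sub ?_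
    split_ifs
    · exact measurable_const
    · exact (measurable_arr _).comp measurable_fst
  · exact key e.1 (fun N ω => ω.2 (e.1, N + e.2)) fun N => by fun_prop

lemma measurableSet_runTrace (ψ : Hamiltonian n) (wd : List (Fin n × ℕ)) :
    ∀ (x : Config n) (o : Config n × List (Fin n × ℤˣ)),
    MeasurableSet {u : Marks n | runTrace ψ u x wd = o} := by
  induction wd with
  | nil =>
    intro x o
    simp only [runTrace]
    exact MeasurableSet.const _
  | cons e wd ih =>
    intro x o
    have hstep : ∀ y, MeasurableSet {u : Marks n | step ψ u x e = y} := by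
      intro y
      have hs : MeasurableSet {u : Marks n |
          (u e : ℝ) ≤ Real.sigmoid (2 * (ψ.deriv e.1).eval x)} :=
        measurableSet_le (by fun_prop) measurable_const
      have hm : Measurable fun u : Marks n => step ψ u x e := by
        refine measurable_pi_lambda _ fun a => ?_
        have : (fun u : Marks n => step ψ u x e a) = fun u => if a = e.1 then
            (if (u e : ℝ) ≤ Real.sigmoid (2 * (ψ.deriv e.1).eval x) then (1 : ℤˣ) else -1)
            else x a := by
          funext u
          simp [step, Function.update_apply]
        rw [this]
        split_ifs
        · exact Measurable.ite hs measurable_const measurable_const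
        · exact measurable_const
      exact hm (MeasurableSet.of_discrete (s := {y}))
    have : {u : Marks n | runTrace ψ u x (e :: wd) = o} =
        ⋃ y : Config n, ⋃ t : List (Fin n × ℤˣ), {u | step ψ u x e = y} ∩
          {u | runTrace ψ u y wd = (o.1, t)} ∩ {_u | (e.1, y e.1) :: t = o.2} := by
      ext u
      simp only [Set.mem_ofPred_eq, Set.mem_iUnion, Set.mem_inter_iff, runTrace]
      constructor
      · rintro rfl
        exact ⟨_, _, ⟨rfl, rfl⟩, rfl⟩
      · rintro ⟨y, t, ⟨rfl, h2⟩, h3⟩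
        rw [h2, h3]
    rw [this]
    exact MeasurableSet.iUnion fun y => MeasurableSet.iUnion fun t =>
      ((hstep y).inter (ih y _)).inter (MeasurableSet.const _)

lemma measurableSet_outcome (ψ : Hamiltonian n) (h : ℝ) (x : Config n)
    (o : Config n × List (Fin n × ℤˣ)) : MeasurableSet {ω : Drive n | outcome ψ h x ω = o} := by
  have : {ω : Drive n | outcome ψ h x ω = o} =
      ⋃ l, {ω | word h ω.1 = l} ∩ {ω | runTrace ψ ω.2 x l = o} := by
    ext ω
    simp [outcome]
  rw [this]
  exact MeasurableSet.iUnion fun l => (measurable_fst (measurableSet_word h l)).inter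
    (measurable_snd (measurableSet_runTrace ψ l x o))

lemma measurable_outcome {γ : Type*} [MeasurableSpace γ] (ψ : Hamiltonian n) (h : ℝ)
    (x : Config n) (F : Config n × List (Fin n × ℤˣ) → γ) :
    Measurable fun ω : Drive n => F (outcome ψ h x ω) :=
  measurable_of_fibres (f := outcome ψ h x) (g := fun o _ => F o) (measurableSet_outcome ψ h x)
    fun _ => measurable_const

/-! ### Almost sure regularity -/

/-- Resampling of one coordinate. It serves to show that a tie pins a waiting time to a single
value, and to integrate out the mark of the first update in a list. -/
lemma measurePreserving_update {ι : Type*} [DecidableEq ι] {β : Type*} [MeasurableSpace β]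
    (μ : Measure β) [IsProbabilityMeasure μ] (e : ι) :
    MeasurePreserving (fun p : (ι → β) × β => Function.update p.1 e p.2)
      ((Measure.infinitePi fun _ : ι => μ).prod μ) (Measure.infinitePi fun _ : ι => μ) := by
  have hm : Measurable fun p : (ι → β) × β => Function.update p.1 e p.2 := by
    refine measurable_pi_lambda _ fun a => ?_
    by_cases ha : a = e
    · subst ha
      simpa using measurable_snd
    · simp only [Function.update_of_ne ha]
      fun_prop
  refine ⟨hm, Measure.eq_infinitePi _ fun s t ht => ?_⟩
  rw [Measure.map_apply hm (MeasurableSet.pi (Finset.countable_toSet s) fun k _ => ht k)]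
  by_cases he : e ∈ s
  · have : (fun p : (ι → β) × β => Function.update p.1 e p.2) ⁻¹' (s : Set ι).pi t =
        ((s.erase e : Finset ι) : Set ι).pi t ×ˢ t e := by
      ext p
      simp only [Set.mem_preimage, Set.mem_pi, Finset.mem_coe, Set.mem_prod, Finset.mem_erase]
      constructor
      · intro h
        refine ⟨fun a ha => ?_, by simpa using h e he⟩
        simpa [Function.update_of_ne ha.1] using h a ha.2
      · rintro ⟨h1, h2⟩ a ha
        by_cases hae : a = e
        · subst hae
          simpa using h2
        · simpa [Function.update_of_ne hae] using h1 a ⟨hae, ha⟩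
    rw [this, Measure.prod_prod, Measure.infinitePi_pi _ fun i _ => ht i,
      Finset.prod_erase_mul s (fun i => μ (t i)) he]
  · have : (fun p : (ι → β) × β => Function.update p.1 e p.2) ⁻¹' (s : Set ι).pi t =
        (s : Set ι).pi t ×ˢ Set.univ := by
      ext p
      simp only [Set.mem_preimage, Set.mem_pi, Finset.mem_coe, Set.mem_prod, Set.mem_univ, and_true]
      refine forall₂_congr fun a ha => ?_
      rw [Function.update_of_ne (ne_of_mem_of_not_mem ha he)]
    rw [this, Measure.prod_prod, Measure.infinitePi_pi _ fun i _ => ht i, measure_univ, mul_one]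

lemma stdExp_singleton (x : ℝ) : stdExp {x} = 0 := by
  change (volume.withDensity (ProbabilityTheory.exponentialPDF 1)) {x} = 0
  rw [withDensity_apply _ (measurableSet_singleton x)]
  simp

lemma ae_clock_pos : ∀ᵐ w ∂clockLaw n, ∀ e, 0 < w e := by
  rw [ae_all_iff]
  intro e
  have h1 : ∀ᵐ x ∂stdExp, 0 < x := by
    rw [ae_iff]
    have h2 : stdExp (Set.Ici 0)ᶜ = 0 := by
      rw [prob_compl_eq_zero_iff measurableSet_Ici, stdExp_Ici le_rfl]
      simp
    refine measure_mono_null (t := (Set.Ici 0)ᶜ ∪ {0}) (fun x hx => ?_)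
      (measure_union_null h2 (stdExp_singleton 0))
    rcases lt_or_eq_of_le (not_lt.1 hx) with h | h
    · exact Or.inl (by simpa using h)
    · exact Or.inr h
  exact (measurePreserving_eval_infinitePi (fun _ : Fin n × ℕ => stdExp) e).quasiMeasurePreserving.ae h1

/-- With all other waiting times fixed, a tie determines the first waiting time of the site of `e`,
whose law has no atoms. -/
lemma ae_no_ties {e e' : Fin n × ℕ} (hne : e.1 ≠ e'.1) :
    ∀ᵐ w ∂clockLaw n, arr w e ≠ arr w e' := by
  obtain ⟨i, m⟩ := e
  obtain ⟨j, m'⟩ := e'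
  have hij : i ≠ j := hne
  rw [ae_iff]
  have hmp := measurePreserving_update (ι := Fin n × ℕ) stdExp (i, 0)
  change MeasurePreserving _ ((clockLaw n).prod stdExp) (clockLaw n) at hmp
  have hset : MeasurableSet {w : Clocks n | ¬ arr w (i, m) ≠ arr w (j, m')} := by
    simp only [ne_eq, not_not]
    exact measurableSet_eq_fun (measurable_arr _) (measurable_arr _)
  rw [← hmp.measure_preimage hset.nullMeasurableSet,
    Measure.measure_prod_null (hmp.measurable hset)]
  refine Filter.Eventually.of_forall fun w => ?_
  refine measure_mono_null (t := {arr w (j, m') - ∑ k ∈ Finset.range m, w (i, k + 1)})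
    (fun v hv => ?_) (stdExp_singleton _)
  have hv' : arr (Function.update w (i, 0) v) (i, m) = arr (Function.update w (i, 0) v) (j, m') := by
    simpa using hv
  have h1 : arr (Function.update w (i, 0) v) (i, m) =
      ∑ k ∈ Finset.range m, w (i, k + 1) + v := by
    rw [arr, Finset.sum_range_succ']
    simp
  have h2 : arr (Function.update w (i, 0) v) (j, m') = arr w (j, m') := by
    refine Finset.sum_congr rfl fun k _ => Function.update_of_ne ?_ _ _
    simp [hij.symm]
  rw [h1, h2] at hv'
  simp only [Set.mem_singleton_iff]
  linarith

lemma integral_exp_neg_stdExp : ∫ x, Real.exp (-1 * x) ∂stdExp = 1 / 2 := by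
  rw [integral_eq_lintegral_of_nonneg_ae (Filter.Eventually.of_forall fun x => (Real.exp_pos _).le)
    (by fun_prop)]
  have h1 : ∫⁻ x, ENNReal.ofReal (Real.exp (-1 * x)) ∂stdExp =
      ∫⁻ x, ENNReal.ofReal (1 / 2) * ProbabilityTheory.exponentialPDF 2 x := by
    change ∫⁻ x, ENNReal.ofReal (Real.exp (-1 * x))
      ∂(volume.withDensity (ProbabilityTheory.exponentialPDF 1)) = _
    have hpdf : Measurable (ProbabilityTheory.exponentialPDF 1) :=
      (ProbabilityTheory.measurable_exponentialPDFReal 1).ennreal_ofReal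
    rw [lintegral_withDensity_eq_lintegral_mul _ hpdf
      (f := ProbabilityTheory.exponentialPDF 1)
      (g := fun x : ℝ => ENNReal.ofReal (Real.exp (-1 * x))) (by fun_prop)]
    refine lintegral_congr fun x => ?_
    simp only [Pi.mul_apply]
    by_cases hx : 0 ≤ x
    · rw [ProbabilityTheory.exponentialPDF_of_nonneg hx,
        ProbabilityTheory.exponentialPDF_of_nonneg hx, ← ENNReal.ofReal_mul (by positivity),
        ← ENNReal.ofReal_mul (by norm_num)]
      congr 1
      rw [one_mul, one_mul, ← Real.exp_add, ← mul_assoc]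
      norm_num
      ring
    · rw [ProbabilityTheory.exponentialPDF_of_neg (not_le.1 hx),
        ProbabilityTheory.exponentialPDF_of_neg (not_le.1 hx)]
      simp
  rw [h1, lintegral_const_mul' _ _ ENNReal.ofReal_ne_top,
    ProbabilityTheory.lintegral_exponentialPDF_eq_one (by norm_num), mul_one,
    ENNReal.toReal_ofReal (by norm_num)]

/-- Chernoff's bound with parameter `-1`, where the moment generating function of a waiting time is
`1 / 2`. It shows that the update times are unbounded, and later it bounds the lengths of the
records. -/
lemma clockLaw_arr_le (i : Fin n) (m : ℕ) (T : ℝ) :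
    (clockLaw n).real {w | arr w (i, m) ≤ T} ≤ Real.exp T * (1 / 2) ^ (m + 1) := by
  have hind : ProbabilityTheory.iIndepFun (fun (k : ℕ) (w : Clocks n) => w (i, k)) (clockLaw n) := by
    have h1 := ProbabilityTheory.iIndepFun_infinitePi (P := fun _ : Fin n × ℕ => stdExp)
      (X := fun _ x => x) fun _ => measurable_id
    exact h1.precomp (g := fun k : ℕ => (i, k)) fun a b hab => by simpa using hab
  have hm : ∀ k : ℕ, Measurable fun w : Clocks n => w (i, k) := fun k => by fun_prop
  have hsum : (fun w : Clocks n => arr w (i, m)) =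
      ∑ k ∈ Finset.range (m + 1), fun w : Clocks n => w (i, k) := by
    funext w
    simp [arr]
  have hmgf : ∀ k : ℕ, ProbabilityTheory.mgf (fun w : Clocks n => w (i, k)) (clockLaw n) (-1) =
      1 / 2 := by
    intro k
    rw [← integral_exp_neg_stdExp]
    rw [ProbabilityTheory.mgf]
    have h2 := measurePreserving_eval_infinitePi (fun _ : Fin n × ℕ => stdExp) (i, k)
    rw [← h2.map_eq, integral_map h2.measurable.aemeasurable (by fun_prop)]
    rfl
  have hmg : ProbabilityTheory.mgf (fun w : Clocks n => arr w (i, m)) (clockLaw n) (-1) =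
      (1 / 2) ^ (m + 1) := by
    rw [hsum, hind.mgf_sum hm]
    simp [hmgf]
  have hint : Integrable (fun w : Clocks n => Real.exp (-1 * arr w (i, m))) (clockLaw n) := by
    -- The integral of a non-integrable function is `0` by convention, which contradicts the
    -- positive value just computed.
    by_contra hc
    have : ProbabilityTheory.mgf (fun w : Clocks n => arr w (i, m)) (clockLaw n) (-1) = 0 :=
      integral_undef hc
    rw [hmg] at this
    exact absurd this (by positivity)
  have := ProbabilityTheory.measure_le_le_exp_mul_mgf (X := fun w : Clocks n => arr w (i, m)) T
    (by norm_num : (-1 : ℝ) ≤ 0) hint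
  rw [hmg] at this
  simpa using this

lemma ae_exists_arr_gt (i : Fin n) (T : ℝ) : ∀ᵐ w ∂clockLaw n, ∃ m, T < arr w (i, m) := by
  rw [ae_iff]
  have h0 : ∀ m : ℕ, (clockLaw n).real {w | ¬ ∃ m, T < arr w (i, m)} ≤
      Real.exp T * (1 / 2) ^ (m + 1) := fun m =>
    (measureReal_mono (fun w hw => by
      simp only [not_exists, not_lt, Set.mem_ofPred_eq] at hw ⊢
      exact hw m)).trans (clockLaw_arr_le i m T)
  have h1 : Filter.Tendsto (fun m : ℕ => Real.exp T * (1 / 2 : ℝ) ^ (m + 1)) Filter.atTop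
      (nhds (Real.exp T * 0)) :=
    ((tendsto_pow_atTop_nhds_zero_of_lt_one (by norm_num) (by norm_num)).comp
      (Filter.tendsto_add_atTop_nat 1)).const_mul _
  rw [mul_zero] at h1
  have h2 := ge_of_tendsto' h1 h0
  rw [← measureReal_eq_zero_iff]
  exact le_antisymm h2 measureReal_nonneg

lemma ae_regular : ∀ᵐ w ∂clockLaw n, Regular w := by
  have h1 : ∀ᵐ w ∂clockLaw n, ∀ e e' : Fin n × ℕ, e.1 ≠ e'.1 → arr w e ≠ arr w e' := by
    rw [ae_all_iff]
    intro e
    rw [ae_all_iff]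
    intro e'
    by_cases hne : e.1 ≠ e'.1
    · filter_upwards [ae_no_ties hne] with w hw _ using hw
    · exact Filter.Eventually.of_forall fun w hc => absurd hc hne
  have h2 : ∀ᵐ w ∂clockLaw n, ∀ (i : Fin n) (T : ℕ), ∃ m, (T : ℝ) < arr w (i, m) := by
    rw [ae_all_iff]
    intro i
    rw [ae_all_iff]
    exact fun T => ae_exists_arr_gt i T
  filter_upwards [ae_clock_pos (n := n), h1, h2] with w hpos hties hlim
  have hmono : ∀ i, StrictMono fun m => arr w (i, m) := fun i =>
    strictMono_nat_of_lt_succ fun m => by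
      rw [arr_succ]
      linarith [hpos (i, m + 1)]
  refine ⟨fun e => Finset.sum_nonneg fun k _ => (hpos _).le, fun e e' hee => ?_, hmono, fun t => ?_⟩
  · obtain ⟨i, m⟩ := e
    obtain ⟨j, m'⟩ := e'
    by_cases hij : i = j
    · subst hij
      rw [(hmono i).injective hee]
    · exact absurd hee (hties _ _ hij)
  · obtain ⟨T, hT⟩ := exists_nat_ge t
    choose m hm using fun i => hlim i T
    refine Set.Finite.subset (Set.finite_iUnion fun i : Fin n =>
      ((Set.finite_Iio (m i)).image fun k => (i, k))) fun e he => ?_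
    refine Set.mem_iUnion.2 ⟨e.1, e.2, ?_, rfl⟩
    by_contra hc
    have h3 : arr w (e.1, m e.1) ≤ arr w e := (hmono e.1).monotone (not_lt.1 hc)
    have h4 : arr w e ≤ t := he
    linarith [hm e.1]

lemma ae_regular_drive : ∀ᵐ ω ∂driveLaw n, Regular ω.1 :=
  Measure.quasiMeasurePreserving_fst.ae ae_regular

/-! ### The Markov property -/

/-- The Markov property at the fixed time `h`. There are countably many outcomes, so measurability
reduces to the fibres; the identity is Fubini after the noise has been replaced by a splice. -/
lemma driveLaw_restart (ψ : Hamiltonian n) {h : ℝ} (hh : 0 ≤ h) (x : Config n)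
    (B : Config n × List (Fin n × ℤˣ) → Set (Drive n)) (hB : ∀ o, MeasurableSet (B o)) :
    MeasurableSet {ω | shift h ω ∈ B (outcome ψ h x ω)} ∧
      (driveLaw n).real {ω | shift h ω ∈ B (outcome ψ h x ω)} =
        ∫ ω, (driveLaw n).real (B (outcome ψ h x ω)) ∂driveLaw n := by
  have hms : MeasurableSet {ω | shift h ω ∈ B (outcome ψ h x ω)} := by
    have : {ω | shift h ω ∈ B (outcome ψ h x ω)} =
        ⋃ o, {ω | outcome ψ h x ω = o} ∩ shift h ⁻¹' B o := by
      ext ω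
      simp
    rw [this]
    exact MeasurableSet.iUnion fun o =>
      (measurableSet_outcome ψ h x o).inter (measurable_shift h (hB o))
  refine ⟨hms, ?_⟩
  have hms2 : MeasurableSet {p : Drive n × Drive n | p.2 ∈ B (outcome ψ h x p.1)} := by
    have : {p : Drive n × Drive n | p.2 ∈ B (outcome ψ h x p.1)} =
        ⋃ o, {ω | outcome ψ h x ω = o} ×ˢ B o := by
      ext p
      simp
    rw [this]
    exact MeasurableSet.iUnion fun o => (measurableSet_outcome ψ h x o).prod (hB o)
  have h1 : driveLaw n {ω | shift h ω ∈ B (outcome ψ h x ω)} =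
      ∫⁻ ω, driveLaw n (B (outcome ψ h x ω)) ∂driveLaw n := by
    rw [← (measurePreserving_splice hh).measure_preimage hms.nullMeasurableSet]
    have hae : (fun p : Drive n × Drive n => splice h p.1 p.2) ⁻¹'
        {ω | shift h ω ∈ B (outcome ψ h x ω)} =ᵐ[(driveLaw n).prod (driveLaw n)]
        {p | p.2 ∈ B (outcome ψ h x p.1)} := by
      have r1 : ∀ᵐ p ∂(driveLaw n).prod (driveLaw n), Regular p.1.1 :=
        Measure.quasiMeasurePreserving_fst.ae ae_regular_drive
      have r2 : ∀ᵐ p ∂(driveLaw n).prod (driveLaw n), Regular p.2.1 :=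
        Measure.quasiMeasurePreserving_snd.ae ae_regular_drive
      rw [Filter.eventuallyEq_set]
      filter_upwards [r1, r2] with p hp1 hp2
      simp only [Set.mem_preimage, Set.mem_ofPred_eq]
      rw [hp1.shift_splice hp2, hp1.outcome_splice ψ x hp2]
    rw [measure_congr hae, Measure.prod_apply hms2]
    rfl
  rw [measureReal_def, h1, integral_eq_lintegral_of_nonneg_ae
    (Filter.Eventually.of_forall fun ω => measureReal_nonneg)
    (measurable_outcome ψ h x fun o => (driveLaw n).real (B o)).aestronglyMeasurable]
  congr 1
  refine lintegral_congr fun ω => ?_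
  rw [ofReal_measureReal]

/-! ### Integrating out the marks -/

/-- The probability that site `a` becomes `1` when it is updated. -/
def upProb (ψ : Hamiltonian n) (a : Fin n) (x : Config n) : ℝ :=
  Real.sigmoid (2 * (ψ.deriv a).eval x)

lemma upProb_nonneg (ψ : Hamiltonian n) (a : Fin n) (x : Config n) : 0 ≤ upProb ψ a x :=
  Real.sigmoid_nonneg _

lemma upProb_le_one (ψ : Hamiltonian n) (a : Fin n) (x : Config n) : upProb ψ a x ≤ 1 :=
  Real.sigmoid_le_one _

/-- The expectation of `F`, applied to the final configuration and the list of new spins, when the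
given sites are updated one after the other. -/
def expW (ψ : Hamiltonian n) :
    List (Fin n) → Config n → (Config n × List (Fin n × ℤˣ) → ℝ) → ℝ
  | [], x, F => F (x, [])
  | a :: l, x, F =>
    upProb ψ a x * expW ψ l (Function.update x a 1) (fun o => F (o.1, (a, 1) :: o.2)) +
      (1 - upProb ψ a x) *
        expW ψ l (Function.update x a (-1)) (fun o => F (o.1, (a, -1) :: o.2))

lemma integral_threshold {p : ℝ} (h0 : 0 ≤ p) (h1 : p ≤ 1) (A B : ℝ) :
    ∫ v : unitInterval, (if (v : ℝ) ≤ p then A else B) = p * A + (1 - p) * B := by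
  have hs : {v : unitInterval | (v : ℝ) ≤ p} = Set.Iic ⟨p, h0, h1⟩ := by
    ext v
    exact Iff.rfl
  have hm : MeasurableSet {v : unitInterval | (v : ℝ) ≤ p} := by
    rw [hs]
    exact measurableSet_Iic
  have hv : (volume : Measure unitInterval).real {v | (v : ℝ) ≤ p} = p := by
    rw [measureReal_def, hs, unitInterval.volume_Iic, ENNReal.toReal_ofReal h0]
  have : ∀ v : unitInterval, (if (v : ℝ) ≤ p then A else B) =
      {v : unitInterval | (v : ℝ) ≤ p}.indicator (fun _ => A - B) v + B := by
    intro v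
    by_cases hv : (v : ℝ) ≤ p
    · rw [if_pos hv, Set.indicator_of_mem (show v ∈ {v : unitInterval | (v : ℝ) ≤ p} from hv)]
      ring
    · rw [if_neg hv, Set.indicator_of_notMem (show v ∉ {v : unitInterval | (v : ℝ) ≤ p} from hv)]
      ring
  simp only [this]
  rw [integral_add ((integrable_const _).indicator hm) (integrable_const _),
    integral_indicator_const _ hm, hv]
  simp
  ring

lemma measurable_runTrace (ψ : Hamiltonian n) (wd : List (Fin n × ℕ)) (x : Config n)
    (F : Config n × List (Fin n × ℤˣ) → ℝ) :
    Measurable fun u : Marks n => F (runTrace ψ u x wd) :=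
  measurable_of_fibres (f := fun u : Marks n => runTrace ψ u x wd) (g := fun o _ => F o)
    (measurableSet_runTrace ψ wd x) fun _ => measurable_const

/-- The mark of the first update is resampled and acts as a coin with parameter `upProb`. The
remaining updates do not see it, because the list has no repetitions. -/
lemma integral_runTrace (ψ : Hamiltonian n) (wd : List (Fin n × ℕ)) :
    ∀ (x : Config n) (F : Config n × List (Fin n × ℤˣ) → ℝ) (C : ℝ), wd.Nodup →
    (∀ o, |F o| ≤ C) →
    ∫ u, F (runTrace ψ u x wd) ∂markLaw n = expW ψ (wd.map Prod.fst) x F := by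
  induction wd with
  | nil =>
    intro x F C _ _
    simp [runTrace, expW]
  | cons e wd ih =>
    intro x F C hnd hF
    rw [List.nodup_cons] at hnd
    have hmp := measurePreserving_update (ι := Fin n × ℕ) (volume : Measure unitInterval) e
    change MeasurePreserving _ ((markLaw n).prod volume) (markLaw n) at hmp
    have hint : ∀ (μ : Measure (Marks n)) [IsFiniteMeasure μ] (x : Config n)
        (F' : Config n × List (Fin n × ℤˣ) → ℝ) (wd' : List (Fin n × ℕ)), (∀ o, |F' o| ≤ C) →
        Integrable (fun u => F' (runTrace ψ u x wd')) μ := fun μ _ x F' wd' hF' =>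
      Integrable.of_bound (measurable_runTrace ψ wd' x F').aestronglyMeasurable C
        (Filter.Eventually.of_forall fun u => hF' _)
    rw [← hmp.map_eq, integral_map hmp.measurable.aemeasurable
      (measurable_runTrace ψ _ x F).aestronglyMeasurable, integral_prod]
    · set y₁ := Function.update x e.1 (1 : ℤˣ)
      set y₂ := Function.update x e.1 (-1 : ℤˣ)
      have hin : ∀ u : Marks n, ∫ v : unitInterval,
          F (runTrace ψ (Function.update u e v) x (e :: wd)) =
          upProb ψ e.1 x * F ((runTrace ψ u y₁ wd).1, (e.1, 1) :: (runTrace ψ u y₁ wd).2) +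
            (1 - upProb ψ e.1 x) *
              F ((runTrace ψ u y₂ wd).1, (e.1, -1) :: (runTrace ψ u y₂ wd).2) := by
        intro u
        rw [← integral_threshold (upProb_nonneg ψ e.1 x) (upProb_le_one ψ e.1 x)]
        refine integral_congr_ae (Filter.Eventually.of_forall fun v => ?_)
        have hc : ∀ y, runTrace ψ (Function.update u e v) y wd = runTrace ψ u y wd := fun y =>
          runTrace_congr ψ wd y fun e' he' =>
            Function.update_of_ne (ne_of_mem_of_not_mem he' hnd.1) _ _
        simp only [runTrace, hc, step, Function.update_self]
        unfold upProb
        split_ifs <;> rfl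
      simp only [hin]
      rw [integral_add, integral_const_mul, integral_const_mul, List.map_cons, expW,
        ← ih y₁ (fun o => F (o.1, (e.1, 1) :: o.2)) C hnd.2 fun o => hF _,
        ← ih y₂ (fun o => F (o.1, (e.1, -1) :: o.2)) C hnd.2 fun o => hF _]
      · exact (hint (markLaw n) y₁ (fun o => F (o.1, (e.1, 1) :: o.2)) wd
          fun o => hF _).const_mul _
      · exact (hint (markLaw n) y₂ (fun o => F (o.1, (e.1, -1) :: o.2)) wd
          fun o => hF _).const_mul _
    · exact Integrable.of_bound ((measurable_runTrace ψ _ x F).comp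
        hmp.measurable).aestronglyMeasurable C (Filter.Eventually.of_forall fun u => hF _)

/-- The sites that are updated before time `h`, in chronological order. -/
def sites (h : ℝ) (w : Clocks n) : List (Fin n) := (word h w).map Prod.fst

lemma measurable_sites {γ : Type*} [MeasurableSpace γ] (h : ℝ) (G : List (Fin n) → γ) :
    Measurable fun w : Clocks n => G (sites h w) :=
  measurable_of_fibres (f := word h) (g := fun l _ => G (l.map Prod.fst)) (measurableSet_word h)
    fun _ => measurable_const

lemma integrable_outcome (ψ : Hamiltonian n) (h : ℝ) (x : Config n)
    {F : Config n × List (Fin n × ℤˣ) → ℝ} {C : ℝ} (hF : ∀ o, |F o| ≤ C) :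
    Integrable (fun ω => F (outcome ψ h x ω)) (driveLaw n) :=
  Integrable.of_bound (measurable_outcome ψ h x F).aestronglyMeasurable C
    (Filter.Eventually.of_forall fun _ => hF _)

/-- The expectation of a function of what happens before time `h`. -/
def avg (ψ : Hamiltonian n) (h : ℝ) (x : Config n) (F : Config n × List (Fin n × ℤˣ) → ℝ) : ℝ :=
  ∫ ω, F (outcome ψ h x ω) ∂driveLaw n

lemma avg_eq (ψ : Hamiltonian n) (h : ℝ) (x : Config n)
    {F : Config n × List (Fin n × ℤˣ) → ℝ} {C : ℝ} (hF : ∀ o, |F o| ≤ C) :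
    avg ψ h x F = ∫ w, expW ψ (sites h w) x F ∂clockLaw n := by
  rw [avg, driveLaw, integral_prod _ (integrable_outcome ψ h x hF)]
  refine integral_congr_ae (Filter.Eventually.of_forall fun w => ?_)
  exact integral_runTrace ψ (word h w) x F C (word_nodup w h) hF

/-! ### Independence of the sites -/

/-- The waiting times of one site. -/
def siteClock (a : Fin n) (w : Clocks n) : ℕ → ℝ := fun m => w (a, m)

lemma iIndepFun_siteClock :
    ProbabilityTheory.iIndepFun (fun (a : Fin n) (w : Clocks n) => siteClock a w) (clockLaw n) := by
  rw [ProbabilityTheory.iIndepFun_iff_map_fun_eq_infinitePi_map (by unfold siteClock; fun_prop)]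
  have h1 := Measure.infinitePi_map_curry fun (_ : Fin n) (_ : ℕ) => stdExp
  have h2 : ∀ a : Fin n, (clockLaw n).map (fun w => siteClock a w) =
      Measure.infinitePi fun _ : ℕ => stdExp := fun a =>
    Measure.map_infinitePi_infinitePi_of_inj (P := fun _ : Fin n × ℕ => stdExp)
      (f := fun m : ℕ => (a, m)) fun a b hab => by simpa using hab
  simp only [h2]
  exact h1

/-- The number of updates of a site before time `h`, capped at two. -/
def level (h : ℝ) (c : ℕ → ℝ) : ℕ := if h ≤ c 0 then 0 else if h ≤ c 0 + c 1 then 1 else 2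

lemma measurable_level (h : ℝ) : Measurable (level h) := by
  unfold level
  exact Measurable.ite (measurableSet_le (by fun_prop) (by fun_prop)) measurable_const
    (Measurable.ite (measurableSet_le (by fun_prop) (by fun_prop)) measurable_const measurable_const)

lemma Regular.level_eq {w : Clocks n} (hw : Regular w) (h : ℝ) (a : Fin n) :
    level h (siteClock a w) = min 2 ((sites h w).count a) := by
  have h0 : (sites h w).count a = numBefore h w a := by
    rw [sites, List.count, List.countP_map, numBefore, countSite]
    congr 1
  have e0 := hw.lt_numBefore_iff h a 0
  have e1 := hw.lt_numBefore_iff h a 1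
  rw [arr_zero] at e0
  rw [show (1 : ℕ) = 0 + 1 by rfl, arr_succ, arr_zero] at e1
  rw [h0, level]
  by_cases c0 : h ≤ w (a, 0)
  · have : ¬ 0 < numBefore h w a := fun hc => absurd (e0.1 hc) (not_lt.2 c0)
    rw [if_pos (show h ≤ siteClock a w 0 from c0)]
    omega
  · have h2 := e0.2 (not_le.1 c0)
    rw [if_neg (show ¬ h ≤ siteClock a w 0 from c0)]
    by_cases c1 : h ≤ w (a, 0) + w (a, 1)
    · have : ¬ 0 + 1 < numBefore h w a := fun hc => absurd (e1.1 hc) (not_lt.2 c1)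
      rw [if_pos (show h ≤ siteClock a w 0 + siteClock a w 1 from c1)]
      omega
    · have h3 := e1.2 (not_le.1 c1)
      rw [if_neg (show ¬ h ≤ siteClock a w 0 + siteClock a w 1 from c1)]
      omega

/-- The counts of `i` and `j` enter through an arbitrary joint condition, those of the sites in `D`
separately. The case `i = j` is allowed, and `patProb_prod` uses it. -/
lemma clockLaw_level_inter (h : ℝ) {i j : Fin n} (G : Set (ℕ × ℕ)) (D : Finset (Fin n))
    (hi : i ∉ D) (hj : j ∉ D) (H : Fin n → Set ℕ) :
    (clockLaw n).real {w | (level h (siteClock i w), level h (siteClock j w)) ∈ G ∧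
        ∀ a ∈ D, level h (siteClock a w) ∈ H a} =
      (clockLaw n).real {w | (level h (siteClock i w), level h (siteClock j w)) ∈ G} *
        ∏ a ∈ D, (clockLaw n).real {w | level h (siteClock a w) ∈ H a} := by
  have hm : ∀ a, Measurable fun w : Clocks n => level h (siteClock a w) := fun a =>
    (measurable_level h).comp (by unfold siteClock; fun_prop)
  have hind : ProbabilityTheory.iIndepFun (fun (a : Fin n) (w : Clocks n) =>
      level h (siteClock a w)) (clockLaw n) :=
    iIndepFun_siteClock.comp (fun _ => level h) fun _ => measurable_level h
  have hdis : Disjoint ({i, j} : Finset (Fin n)) D := by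
    rw [Finset.disjoint_left]
    intro a ha
    rcases Finset.mem_insert.1 ha with rfl | ha
    · exact hi
    · rw [Finset.mem_singleton.1 ha]
      exact hj
  have h1 := hind.indepFun_finset {i, j} D hdis hm
  have h2 := h1.measure_inter_preimage_eq_mul
    {v | (v ⟨i, by simp⟩, v ⟨j, by simp⟩) ∈ G} {v | ∀ a : D, v a ∈ H a}
    ((show Measurable fun v : ({i, j} : Finset (Fin n)) → ℕ =>
      (v ⟨i, by simp⟩, v ⟨j, by simp⟩) by fun_prop) (MeasurableSet.of_discrete (s := G)))
    (by
      simp only [Set.ofPred_forall]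
      exact MeasurableSet.iInter fun a =>
        (measurable_pi_apply a) (MeasurableSet.of_discrete (s := H a)))
  have h3 := hind.measure_inter_preimage_eq_mul D (sets := H) fun _ _ => MeasurableSet.of_discrete
  have e1 : {w : Clocks n | (level h (siteClock i w), level h (siteClock j w)) ∈ G ∧
        ∀ a ∈ D, level h (siteClock a w) ∈ H a} =
      ((fun w (a : ({i, j} : Finset (Fin n))) => level h (siteClock a.1 w)) ⁻¹'
        {v | (v ⟨i, by simp⟩, v ⟨j, by simp⟩) ∈ G}) ∩
      ((fun w (a : D) => level h (siteClock a.1 w)) ⁻¹' {v | ∀ a : D, v a ∈ H a}) := by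
    ext w
    simp
  have e2 : ((fun (w : Clocks n) (a : D) => level h (siteClock a.1 w)) ⁻¹'
      {v | ∀ a : D, v a ∈ H a}) =
      ⋂ a ∈ D, (fun w : Clocks n => level h (siteClock a w)) ⁻¹' H a := by
    ext w
    simp
  rw [measureReal_def, e1, h2, e2, h3, ENNReal.toReal_mul, ENNReal.toReal_prod]
  rfl

lemma clockLaw_level_eq_zero {h : ℝ} (hh : 0 ≤ h) (a : Fin n) :
    (clockLaw n).real {w | level h (siteClock a w) = 0} = Real.exp (-h) := by
  have h1 := (measurePreserving_eval_infinitePi (fun _ : Fin n × ℕ => stdExp) (a, 0)).measure_preimage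
    (s := Set.Ici h) measurableSet_Ici.nullMeasurableSet
  have h2 : {w : Clocks n | level h (siteClock a w) = 0} = Function.eval (a, 0) ⁻¹' Set.Ici h := by
    ext w
    change level h (siteClock a w) = 0 ↔ h ≤ siteClock a w 0
    unfold level
    split_ifs <;> simp_all
  rw [measureReal_def, h2]
  change ((Measure.infinitePi fun _ : Fin n × ℕ => stdExp) _).toReal = _
  rw [h1, stdExp_Ici hh, ENNReal.toReal_ofReal (Real.exp_pos _).le]

lemma clockLaw_level_ne_zero {h : ℝ} (hh : 0 ≤ h) (a : Fin n) :
    (clockLaw n).real {w | level h (siteClock a w) ≠ 0} = 1 - Real.exp (-h) := by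
  have hm : Measurable fun w : Clocks n => level h (siteClock a w) :=
    (measurable_level h).comp (by unfold siteClock; fun_prop)
  rw [← clockLaw_level_eq_zero hh a, ← probReal_compl_eq_one_sub]
  · rfl
  · exact hm (measurableSet_singleton 0)

/-- Two updates occur before `h` as soon as the first two waiting times, which are independent, are
both below `h / 2`. -/
lemma clockLaw_level_two {h : ℝ} (hh : 0 ≤ h) (a : Fin n) :
    (1 - Real.exp (-(h / 2))) ^ 2 ≤ (clockLaw n).real {w | level h (siteClock a w) = 2} := by
  have h1 : (clockLaw n).real {w | ∀ k < 2, siteClock a w k < h / 2} =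
      (1 - Real.exp (-(h / 2))) ^ 2 := by
    have hmp : MeasurePreserving (siteClock a) (clockLaw n) (Measure.infinitePi fun _ => stdExp) :=
      ⟨by unfold siteClock; fun_prop,
        Measure.map_infinitePi_infinitePi_of_inj (P := fun _ : Fin n × ℕ => stdExp)
          (f := fun m : ℕ => (a, m)) fun a b hab => by simpa using hab⟩
    have h2 := hmp.measure_preimage (measurableSet_box 2 (t := fun _ => Set.Iio (h / 2))
      fun _ => measurableSet_Iio).nullMeasurableSet
    rw [infinitePi_nat_apply stdExp 2 (t := fun _ => Set.Iio (h / 2))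
      fun _ => measurableSet_Iio] at h2
    have h3 : (stdExp (Set.Iio (h / 2))).toReal = 1 - Real.exp (-(h / 2)) := by
      have : Set.Iio (h / 2) = (Set.Ici (h / 2))ᶜ := by simp
      rw [← measureReal_def, this, probReal_compl_eq_one_sub measurableSet_Ici, measureReal_def,
        stdExp_Ici (by linarith), ENNReal.toReal_ofReal (Real.exp_pos _).le]
    have h4 := congrArg ENNReal.toReal h2
    simp only [Finset.prod_const, Finset.card_range, ENNReal.toReal_pow, h3] at h4
    rw [← h4]
    rfl
  rw [← h1]
  refine measureReal_mono fun w hw => ?_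
  have c0 : siteClock a w 0 < h / 2 := hw 0 (by norm_num)
  have c1 : siteClock a w 1 < h / 2 := hw 1 (by norm_num)
  simp only [Set.mem_ofPred_eq, level]
  rw [if_neg (by linarith), if_neg (by linarith)]

/-! ## Multilinear polynomials -/

lemma Hamiltonian.mem_supp {f : Hamiltonian n} {a : Fin n} :
    a ∈ f.supp ↔ ∃ S, f S ≠ 0 ∧ a ∈ S := by
  simp [Hamiltonian.supp]

lemma Hamiltonian.eval_congr (f : Hamiltonian n) {x y : Config n}
    (h : ∀ a ∈ f.supp, x a = y a) : f.eval x = f.eval y := by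
  refine Finset.sum_congr rfl fun S _ => ?_
  by_cases hS : f S = 0
  · simp [hS]
  · congr 1
    exact Finset.prod_congr rfl fun a ha => by
      rw [h a (Hamiltonian.mem_supp.2 ⟨S, hS, ha⟩)]

lemma Hamiltonian.abs_eval_le (f : Hamiltonian n) (x : Config n) :
    |f.eval x| ≤ ∑ S, |f S| := by
  refine (Finset.abs_sum_le_sum_abs _ _).trans (Finset.sum_le_sum fun S _ => ?_)
  rw [abs_mul, Finset.abs_prod]
  have : ∏ i ∈ S, |((x i : ℤ) : ℝ)| = 1 := by
    refine Finset.prod_eq_one fun i _ => ?_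
    rcases Int.units_eq_one_or (x i) with h | h <;> simp [h]
  rw [this, mul_one]

lemma Hamiltonian.supp_deriv (a : Fin n) (f : Hamiltonian n) :
    (f.deriv a).supp ⊆ f.supp.erase a := by
  intro b hb
  obtain ⟨S, hS, hbS⟩ := Hamiltonian.mem_supp.1 hb
  by_cases ha : a ∈ S
  · exact absurd (if_pos ha) hS
  · have : f.deriv a S = f (insert a S) := if_neg ha
    rw [this] at hS
    exact Finset.mem_erase.2 ⟨ne_of_mem_of_not_mem hbS ha,
      Hamiltonian.mem_supp.2 ⟨_, hS, Finset.mem_insert_of_mem hbS⟩⟩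

/-- The part of a multilinear polynomial without the variable `x_a`. -/
def Hamiltonian.drop (a : Fin n) (f : Hamiltonian n) : Hamiltonian n :=
  fun S => if a ∈ S then 0 else f S

lemma Hamiltonian.eval_eq (a : Fin n) (f : Hamiltonian n) (x : Config n) :
    f.eval x = ((x a : ℤ) : ℝ) * (f.deriv a).eval x + (f.drop a).eval x := by
  classical
  have key : ∀ g : Finset (Fin n) → ℝ, ∑ S, g S =
      ∑ S, (if a ∈ S then 0 else g (insert a S)) + ∑ S, if a ∈ S then 0 else g S := by
    intro g
    have h1 : ∑ S, g S = ∑ S with a ∈ S, g S + ∑ S with a ∉ S, g S :=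
      (Finset.sum_filter_add_sum_filter_not _ _ _).symm
    have h2 : ∑ S with a ∈ S, g S = ∑ S with a ∉ S, g (insert a S) := by
      symm
      refine Finset.sum_bij' (fun S _ => insert a S) (fun S _ => S.erase a) ?_ ?_ ?_ ?_ ?_
      · simp
      · simp
      · intro S hS
        exact Finset.erase_insert (Finset.mem_filter.1 hS).2
      · intro S hS
        exact Finset.insert_erase (Finset.mem_filter.1 hS).2
      · intros
        rfl
    rw [h1, h2, Finset.sum_filter, Finset.sum_filter]
    congr 1 <;> refine Finset.sum_congr rfl fun S _ => ?_ <;> by_cases ha : a ∈ S <;> simp [ha]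
  rw [Hamiltonian.eval, key, Hamiltonian.eval, Hamiltonian.eval, Finset.mul_sum]
  congr 1
  · refine Finset.sum_congr rfl fun S _ => ?_
    by_cases ha : a ∈ S
    · simp [ha, Hamiltonian.deriv]
    · rw [if_neg ha, Hamiltonian.deriv, if_neg ha, Finset.prod_insert ha]
      ring
  · refine Finset.sum_congr rfl fun S _ => ?_
    by_cases ha : a ∈ S <;> simp [ha, Hamiltonian.drop]

lemma Hamiltonian.supp_drop (a : Fin n) (f : Hamiltonian n) :
    (f.drop a).supp ⊆ f.supp.erase a := by
  intro b hb
  obtain ⟨S, hS, hbS⟩ := Hamiltonian.mem_supp.1 hb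
  by_cases ha : a ∈ S
  · exact absurd (if_pos ha) hS
  · have : f.drop a S = f S := if_neg ha
    rw [this] at hS
    exact Finset.mem_erase.2 ⟨ne_of_mem_of_not_mem hbS ha, Hamiltonian.mem_supp.2 ⟨_, hS, hbS⟩⟩

lemma Hamiltonian.eval_of_supp_empty (f : Hamiltonian n) (h : ∀ S, S ≠ ∅ → f S = 0)
    (x : Config n) : f.eval x = f ∅ := by
  rw [Hamiltonian.eval, Finset.sum_eq_single ∅]
  · simp
  · intro S _ hS
    rw [h S hS, zero_mul]
  · simp

/-- Iterated partial derivatives. -/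
def Hamiltonian.derivs (f : Hamiltonian n) (l : List (Fin n)) : Hamiltonian n :=
  l.foldl (fun g a => g.deriv a) f

lemma Hamiltonian.supp_derivs (f : Hamiltonian n) (l : List (Fin n)) :
    (f.derivs l).supp ⊆ f.supp := by
  induction l generalizing f with
  | nil => exact subset_rfl
  | cons a l ih =>
    exact (ih (f.deriv a)).trans ((f.supp_deriv a).trans (Finset.erase_subset _ _))

lemma Hamiltonian.derivs_apply (f : Hamiltonian n) (l : List (Fin n)) (hl : l.Nodup)
    (S : Finset (Fin n)) :
    f.derivs l S = if Disjoint S l.toFinset then f (S ∪ l.toFinset) else 0 := by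
  induction l generalizing f with
  | nil => simp [Hamiltonian.derivs]
  | cons a l ih =>
    rw [List.nodup_cons] at hl
    change (f.deriv a).derivs l S = _
    rw [ih _ hl.2]
    have hal : a ∉ l.toFinset := by simpa using hl.1
    by_cases hd : Disjoint S l.toFinset
    · rw [if_pos hd, Hamiltonian.deriv]
      by_cases ha : a ∈ S
      · rw [if_pos (Finset.mem_union_left _ ha), if_neg]
        exact fun hc => Finset.disjoint_left.1 hc ha (by simp)
      · rw [if_neg (by simp [ha, hl.1]), if_pos]
        · congr 1
          ext b
          simp
        · rw [List.toFinset_cons, Finset.disjoint_insert_right]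
          exact ⟨ha, hd⟩
    · rw [if_neg hd, if_neg]
      exact fun hc => hd (hc.mono_right (by simp))

/-! ## Updating a list of sites -/

section ExpW

variable (ψ : Hamiltonian n)

/-- Only reachable outcomes have to be compared: sites outside `l` keep their spins, and the trace
visits exactly the sites of `l`. Most later uses exploit these restrictions. -/
lemma expW_mono (l : List (Fin n)) : ∀ (x : Config n)
    (F F' : Config n × List (Fin n × ℤˣ) → ℝ),
    (∀ y t, (∀ a ∉ l, y a = x a) → t.map Prod.fst = l → F (y, t) ≤ F' (y, t)) →
    expW ψ l x F ≤ expW ψ l x F' := by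
  induction l with
  | nil => intro x F F' h; exact h x [] (fun _ _ => rfl) rfl
  | cons a l ih =>
    intro x F F' h
    have key : ∀ s : ℤˣ, expW ψ l (Function.update x a s) (fun o => F (o.1, (a, s) :: o.2)) ≤
        expW ψ l (Function.update x a s) (fun o => F' (o.1, (a, s) :: o.2)) := by
      intro s
      refine ih _ _ _ fun y t hy ht => h y _ (fun b hb => ?_) (by simp [ht])
      rw [List.mem_cons, not_or] at hb
      rw [hy b hb.2, Function.update_of_ne hb.1]
    have h1 := upProb_nonneg ψ a x
    have h2 := upProb_le_one ψ a x
    exact add_le_add (mul_le_mul_of_nonneg_left (key 1) h1)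
      (mul_le_mul_of_nonneg_left (key (-1)) (by linarith))

lemma expW_congr (l : List (Fin n)) (x : Config n)
    (F F' : Config n × List (Fin n × ℤˣ) → ℝ)
    (h : ∀ y t, (∀ a ∉ l, y a = x a) → t.map Prod.fst = l → F (y, t) = F' (y, t)) :
    expW ψ l x F = expW ψ l x F' :=
  le_antisymm (expW_mono ψ l x F F' fun y t h1 h2 => (h y t h1 h2).le)
    (expW_mono ψ l x F' F fun y t h1 h2 => (h y t h1 h2).ge)

lemma expW_const (l : List (Fin n)) (c : ℝ) : ∀ x : Config n, expW ψ l x (fun _ => c) = c := by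
  induction l with
  | nil => intro x; rfl
  | cons a l ih => intro x; rw [expW, ih, ih]; ring

lemma expW_add (l : List (Fin n)) : ∀ (x : Config n) (F G : Config n × List (Fin n × ℤˣ) → ℝ),
    expW ψ l x (fun o => F o + G o) = expW ψ l x F + expW ψ l x G := by
  induction l with
  | nil => intros; rfl
  | cons a l ih =>
    intro x F G
    rw [expW, expW, expW, ih _ (fun o => F (o.1, (a, 1) :: o.2)) fun o => G (o.1, (a, 1) :: o.2),
      ih _ (fun o => F (o.1, (a, -1) :: o.2)) fun o => G (o.1, (a, -1) :: o.2)]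
    ring

lemma expW_mul (l : List (Fin n)) (c : ℝ) :
    ∀ (x : Config n) (F : Config n × List (Fin n × ℤˣ) → ℝ),
    expW ψ l x (fun o => c * F o) = c * expW ψ l x F := by
  induction l with
  | nil => intros; rfl
  | cons a l ih =>
    intro x F
    rw [expW, expW, ih _ fun o => F (o.1, (a, 1) :: o.2),
      ih _ fun o => F (o.1, (a, -1) :: o.2)]
    ring

lemma abs_expW_le (l : List (Fin n)) (x : Config n) {F : Config n × List (Fin n × ℤˣ) → ℝ}
    {C : ℝ} (hF : ∀ o, |F o| ≤ C) : |expW ψ l x F| ≤ C := by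
  refine abs_le.2 ⟨?_, ?_⟩
  · rw [← expW_const ψ l (-C) x]
    exact expW_mono ψ l x _ _ fun y t _ _ => (abs_le.1 (hF _)).1
  · rw [← expW_const ψ l C x]
    exact expW_mono ψ l x _ _ fun y t _ _ => (abs_le.1 (hF _)).2

/-- The final spin of an updated site takes both values with probability at least `m`. -/
lemma le_expW_spin {a : Fin n} {m : ℝ} (hm : ∀ x, m ≤ upProb ψ a x ∧ m ≤ 1 - upProb ψ a x)
    (s : ℤˣ) (l : List (Fin n)) (ha : a ∈ l) : ∀ x : Config n,
    m ≤ expW ψ l x fun o => if o.1 a = s then 1 else 0 := by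
  induction l with
  | nil => simp at ha
  | cons b l ih =>
    intro x
    have h1 := upProb_nonneg ψ b x
    have h2 := upProb_le_one ψ b x
    -- Only the last update of `a` matters. If `a` comes up again, the bound is an average of the
    -- bounds for the two continuations; otherwise the spin drawn here is final.
    by_cases hal : a ∈ l
    · have i1 := ih hal (Function.update x b 1)
      have i2 := ih hal (Function.update x b (-1))
      rw [expW]
      nlinarith
    · have hab : a = b := by
        rcases List.mem_cons.1 ha with h | h
        · exact h
        · exact absurd h hal
      subst hab
      have key : ∀ s' : ℤˣ, expW ψ l (Function.update x a s')
          (fun o => if o.1 a = s then (1 : ℝ) else 0) = if s' = s then 1 else 0 := by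
        intro s'
        rw [expW_congr ψ l _ _ (fun _ => if s' = s then 1 else 0), expW_const]
        intro y t hy _
        simp only [hy a hal, Function.update_self]
      rw [expW, key, key]
      rcases Int.units_eq_one_or s with rfl | rfl
      · simpa using (hm x).1
      · simpa using (hm x).2

lemma upProb_congr {a : Fin n} {x y : Config n} (h : ∀ b ∈ (ψ.deriv a).supp, x b = y b) :
    upProb ψ a x = upProb ψ a y := by
  rw [upProb, upProb, Hamiltonian.eval_congr _ h]

lemma upProb_update {a i : Fin n} (h : ¬ (dependencyGraph ψ).Adj a i) (x : Config n) (s : ℤˣ) :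
    upProb ψ a (Function.update x i s) = upProb ψ a x :=
  upProb_congr ψ fun _ hb => Function.update_of_ne (ne_of_mem_of_not_mem hb h) _ _

/-- If no neighbour of `i` is updated, but `i` is, then the initial spin of `i` is irrelevant. -/
lemma expW_update {i : Fin n} (l : List (Fin n)) (hi : i ∈ l)
    (hl : ∀ a ∈ l, ¬ (dependencyGraph ψ).Adj i a) (s : ℤˣ) :
    ∀ (x : Config n) (F : Config n × List (Fin n × ℤˣ) → ℝ),
    expW ψ l (Function.update x i s) F = expW ψ l x F := by
  induction l with
  | nil => simp at hi
  | cons a l ih =>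
    intro x F
    have ha : ¬ (dependencyGraph ψ).Adj a i := fun hc => hl a (by simp) hc.symm
    rw [expW, expW, upProb_update ψ ha]
    by_cases hai : a = i
    · subst hai
      simp only [Function.update_idem]
    · have hil : i ∈ l := by
        rcases List.mem_cons.1 hi with h | h
        · exact absurd h.symm hai
        · exact h
      rw [Function.update_comm (Ne.symm hai), Function.update_comm (Ne.symm hai),
        ih hil (fun b hb => hl b (by simp [hb])), ih hil (fun b hb => hl b (by simp [hb]))]

/-- The indicator that the first value is `1`. -/
def headInd : List ℤˣ → ℝ
  | [] => 0
  | y :: _ => ind y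

/-- The indicator that the first two values are `1`. -/
def pairInd : List ℤˣ → ℝ
  | y₁ :: y₂ :: _ => ind y₁ * ind y₂
  | _ => 0

lemma ind_nonneg (s : ℤˣ) : 0 ≤ ind s := by unfold ind; split_ifs <;> norm_num

lemma ind_le_one (s : ℤˣ) : ind s ≤ 1 := by unfold ind; split_ifs <;> norm_num

lemma headInd_mem (v : List ℤˣ) : 0 ≤ headInd v ∧ headInd v ≤ 1 := by
  cases v
  · simp [headInd]
  · exact ⟨ind_nonneg _, ind_le_one _⟩

lemma pairInd_mem (v : List ℤˣ) : 0 ≤ pairInd v ∧ pairInd v ≤ 1 := by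
  rcases v with _ | ⟨a, _ | ⟨b, v⟩⟩
  · simp [pairInd]
  · simp [pairInd]
  · exact ⟨mul_nonneg (ind_nonneg _) (ind_nonneg _),
      mul_le_one₀ (ind_le_one _) (ind_nonneg _) (ind_le_one _)⟩

lemma valsOf_cons_self (i : Fin n) (s : ℤˣ) (t : List (Fin n × ℤˣ)) :
    valsOf i ((i, s) :: t) = s :: valsOf i t := by simp [valsOf]

lemma valsOf_cons_of_ne {i a : Fin n} (h : a ≠ i) (s : ℤˣ) (t : List (Fin n × ℤˣ)) :
    valsOf i ((a, s) :: t) = valsOf i t := by simp [valsOf, h]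

lemma length_valsOf (i : Fin n) (t : List (Fin n × ℤˣ)) :
    (valsOf i t).length = (t.map Prod.fst).count i := by
  rw [valsOf, List.length_map, ← List.countP_eq_length_filter, List.count, List.countP_map]
  rfl

lemma ind_one : ind 1 = 1 := by simp [ind]

lemma ind_neg_one : ind (-1) = 0 := by
  rw [ind, if_neg]
  decide

/-- The first new spin of `i` is `1` with the probability determined by the initial configuration,
independently of the final configuration when `i` is updated again. -/
lemma expW_headInd_mul {i : Fin n} (φ : Config n → ℝ) (l : List (Fin n)) (hi : 2 ≤ l.count i)
    (hl : ∀ a ∈ l, ¬ (dependencyGraph ψ).Adj i a) : ∀ x : Config n,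
    expW ψ l x (fun o => headInd (valsOf i o.2) * φ o.1) =
      upProb ψ i x * expW ψ l x fun o => φ o.1 := by
  induction l with
  | nil => simp at hi
  | cons a l ih =>
    intro x
    have hl' : ∀ b ∈ l, ¬ (dependencyGraph ψ).Adj i b := fun b hb => hl b (by simp [hb])
    rw [expW, expW]
    by_cases hai : a = i
    · subst hai
      have hil : a ∈ l := by
        rw [List.count_cons_self] at hi
        exact List.count_pos_iff.1 (by omega)
      simp only [valsOf_cons_self, headInd, ind_one, ind_neg_one, one_mul, zero_mul, expW_const]
      rw [expW_update ψ l hil hl', expW_update ψ l hil hl']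
      ring
    · rw [List.count_cons_of_ne hai] at hi
      simp only [valsOf_cons_of_ne hai]
      have hadj := hl a (by simp)
      rw [ih hi hl', ih hi hl', upProb_update ψ hadj, upProb_update ψ hadj]
      ring

lemma expW_headInd {i : Fin n} (l : List (Fin n)) (hi : 1 ≤ l.count i)
    (hl : ∀ a ∈ l, ¬ (dependencyGraph ψ).Adj i a) : ∀ x : Config n,
    expW ψ l x (fun o => headInd (valsOf i o.2)) = upProb ψ i x := by
  induction l with
  | nil => simp at hi
  | cons a l ih =>
    intro x
    have hl' : ∀ b ∈ l, ¬ (dependencyGraph ψ).Adj i b := fun b hb => hl b (by simp [hb])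
    rw [expW]
    by_cases hai : a = i
    · subst hai
      simp only [valsOf_cons_self, headInd, ind_one, ind_neg_one, expW_const]
      ring
    · rw [List.count_cons_of_ne hai] at hi
      simp only [valsOf_cons_of_ne hai]
      have hadj := hl a (by simp)
      rw [ih hi hl', ih hi hl', upProb_update ψ hadj, upProb_update ψ hadj]
      ring

/-- As no neighbour of `i` moves, both updates use the same probability, and the changed spin of `i`
itself does not enter it. -/
lemma expW_pairInd {i : Fin n} (l : List (Fin n)) (hi : 2 ≤ l.count i)
    (hl : ∀ a ∈ l, ¬ (dependencyGraph ψ).Adj i a) : ∀ x : Config n,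
    expW ψ l x (fun o => pairInd (valsOf i o.2)) = upProb ψ i x ^ 2 := by
  induction l with
  | nil => simp at hi
  | cons a l ih =>
    intro x
    have hl' : ∀ b ∈ l, ¬ (dependencyGraph ψ).Adj i b := fun b hb => hl b (by simp [hb])
    rw [expW]
    by_cases hai : a = i
    · subst hai
      rw [List.count_cons_self] at hi
      have hp : ∀ (s : ℤˣ) (v : List ℤˣ), pairInd (s :: v) = ind s * headInd v := by
        intro s v
        cases v <;> simp [pairInd, headInd]
      simp only [valsOf_cons_self, hp, ind_one, ind_neg_one, one_mul, zero_mul, expW_const]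
      rw [expW_headInd ψ l (by omega) hl', upProb_update ψ (hl a (by simp))]
      ring
    · rw [List.count_cons_of_ne hai] at hi
      simp only [valsOf_cons_of_ne hai]
      have hadj := hl a (by simp)
      rw [ih hi hl', ih hi hl', upProb_update ψ hadj, upProb_update ψ hadj]
      ring

end ExpW

/-! ## What happens in one third of a block -/

open Classical in
/-- The indicator of a proposition. -/
def bool (P : Prop) : ℝ := if P then 1 else 0

lemma bool_nonneg (P : Prop) : 0 ≤ bool P := by unfold bool; split_ifs <;> norm_num

lemma bool_le_one (P : Prop) : bool P ≤ 1 := by unfold bool; split_ifs <;> norm_num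

lemma bool_of_true {P : Prop} (h : P) : bool P = 1 := if_pos h

lemma bool_of_false {P : Prop} (h : ¬ P) : bool P = 0 := if_neg h

lemma abs_bool_le (P : Prop) : |bool P| ≤ 1 := by
  rw [abs_of_nonneg (bool_nonneg P)]
  exact bool_le_one P

lemma bool_and (P Q : Prop) : bool (P ∧ Q) = bool P * bool Q := by
  by_cases hP : P <;> by_cases hQ : Q <;> simp [bool, hP, hQ]

lemma bool_not (P : Prop) : bool (¬ P) = 1 - bool P := by
  by_cases hP : P <;> simp [bool, hP]

/-- A condition on the numbers of updates of `i` and `j`, capped at two. -/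
def Pattern (i j : Fin n) (G : Set (ℕ × ℕ)) (l : List (Fin n)) : Prop :=
  (min 2 (l.count i), min 2 (l.count j)) ∈ G

/-- The probability of a pattern in a time interval of length `h`. -/
def patProb (h : ℝ) (i j : Fin n) (G : Set (ℕ × ℕ)) : ℝ :=
  (clockLaw n).real {w | (level h (siteClock i w), level h (siteClock j w)) ∈ G}

lemma patProb_nonneg (h : ℝ) (i j : Fin n) (G : Set (ℕ × ℕ)) : 0 ≤ patProb h i j G :=
  measureReal_nonneg

lemma patProb_le_one (h : ℝ) (i j : Fin n) (G : Set (ℕ × ℕ)) : patProb h i j G ≤ 1 :=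
  measureReal_le_one

lemma measurable_level_siteClock (h : ℝ) (a : Fin n) :
    Measurable fun w : Clocks n => level h (siteClock a w) :=
  (measurable_level h).comp (by unfold siteClock; fun_prop)

lemma patProb_compl (h : ℝ) (i j : Fin n) (G : Set (ℕ × ℕ)) :
    patProb h i j Gᶜ = 1 - patProb h i j G := by
  rw [patProb, patProb, ← probReal_compl_eq_one_sub]
  · rfl
  · exact ((measurable_level_siteClock h i).prodMk (measurable_level_siteClock h j))
      (MeasurableSet.of_discrete (s := G))

lemma patProb_univ (h : ℝ) (i j : Fin n) : patProb h i j Set.univ = 1 := by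
  simp [patProb]

/-- No site of `D` is updated. -/
def Quiet (D : Finset (Fin n)) (l : List (Fin n)) : Prop := ∀ a ∈ D, a ∉ l

lemma integral_bool {P : Clocks n → Prop} (hP : MeasurableSet {w | P w}) :
    ∫ w, bool (P w) ∂clockLaw n = (clockLaw n).real {w | P w} := by
  rw [← integral_indicator_one hP]
  refine integral_congr_ae (Filter.Eventually.of_forall fun w => ?_)
  by_cases hw : P w
  · simp [bool, hw]
  · simp [bool, hw]

lemma integral_pattern (h : ℝ) {i j : Fin n} (G : Set (ℕ × ℕ)) (D : Finset (Fin n))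
    (hi : i ∉ D) (hj : j ∉ D) (H : Fin n → Set ℕ) :
    ∫ w, bool (Pattern i j G (sites h w) ∧ ∀ a ∈ D, min 2 ((sites h w).count a) ∈ H a)
        ∂clockLaw n =
      patProb h i j G * ∏ a ∈ D, (clockLaw n).real {w | level h (siteClock a w) ∈ H a} := by
  rw [patProb, ← clockLaw_level_inter h G D hi hj H, ← integral_bool]
  · refine integral_congr_ae ?_
    filter_upwards [ae_regular] with w hw
    simp only [Pattern, hw.level_eq]
  · refine MeasurableSet.inter ?_ ?_
    · exact ((measurable_level_siteClock h i).prodMk (measurable_level_siteClock h j))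
        (MeasurableSet.of_discrete (s := G))
    · have : {w : Clocks n | ∀ a ∈ D, level h (siteClock a w) ∈ H a} =
          ⋂ a ∈ D, (fun w => level h (siteClock a w)) ⁻¹' H a := by
        ext w
        simp
      have h2 : MeasurableSet {w : Clocks n | ∀ a ∈ D, level h (siteClock a w) ∈ H a} := by
        rw [this]
        exact Finset.measurableSet_biInter _ fun a _ =>
          measurable_level_siteClock h a MeasurableSet.of_discrete
      exact h2

lemma integral_pattern_quiet {h : ℝ} (hh : 0 ≤ h) {i j : Fin n} (G : Set (ℕ × ℕ))
    (D : Finset (Fin n)) (hi : i ∉ D) (hj : j ∉ D) :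
    ∫ w, bool (Pattern i j G (sites h w) ∧ Quiet D (sites h w)) ∂clockLaw n =
      patProb h i j G * Real.exp (-h) ^ D.card := by
  have h1 := integral_pattern h G D hi hj fun _ => {0}
  simp only [Set.mem_singleton_iff, clockLaw_level_eq_zero hh, Finset.prod_const] at h1
  rw [← h1]
  have : ∀ (l : List (Fin n)) (a : Fin n), min 2 (l.count a) = 0 ↔ a ∉ l := by
    intro l a
    rw [← List.count_eq_zero]
    omega
  simp only [this]
  rfl

lemma integral_pattern_quiet_mem {h : ℝ} (hh : 0 ≤ h) {i j : Fin n} (G : Set (ℕ × ℕ))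
    (D : Finset (Fin n)) (hi : i ∉ D) (hj : j ∉ D) {a : Fin n} (ha : a ∉ D) (hai : a ≠ i)
    (haj : a ≠ j) :
    ∫ w, bool (Pattern i j G (sites h w) ∧ a ∈ sites h w ∧ Quiet D (sites h w)) ∂clockLaw n =
      patProb h i j G * ((1 - Real.exp (-h)) * Real.exp (-h) ^ D.card) := by
  classical
  have hi' : i ∉ insert a D := by simp [hi, hai.symm]
  have hj' : j ∉ insert a D := by simp [hj, haj.symm]
  have h1 := integral_pattern h G (insert a D) hi' hj' fun b => if b = a then {0}ᶜ else {0}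
  rw [Finset.prod_insert ha] at h1
  have h2 : ∏ b ∈ D, (clockLaw n).real {w | level h (siteClock b w) ∈
      (fun b => if b = a then ({0}ᶜ : Set ℕ) else {0}) b} = Real.exp (-h) ^ D.card := by
    rw [← Finset.prod_const]
    refine Finset.prod_congr rfl fun b hb => ?_
    simp only [if_neg (ne_of_mem_of_not_mem hb ha), Set.mem_singleton_iff,
      clockLaw_level_eq_zero hh]
  have h3 : (clockLaw n).real {w | level h (siteClock a w) ∈
      (fun b => if b = a then ({0}ᶜ : Set ℕ) else {0}) a} = 1 - Real.exp (-h) := by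
    simp only [if_true, Set.mem_compl_iff, Set.mem_singleton_iff]
    exact clockLaw_level_ne_zero hh a
  rw [h2, h3] at h1
  rw [← h1]
  refine integral_congr_ae (Filter.Eventually.of_forall fun w => ?_)
  have hc : ∀ a : Fin n, min 2 ((sites h w).count a) = 0 ↔ a ∉ sites h w := by
    intro a
    rw [← List.count_eq_zero]
    omega
  have : (a ∈ sites h w ∧ Quiet D (sites h w)) ↔ ∀ b ∈ insert a D,
      min 2 ((sites h w).count b) ∈ if b = a then ({0}ᶜ : Set ℕ) else {0} := by
    rw [Finset.forall_mem_insert]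
    simp only [if_true, Set.mem_compl_iff, Set.mem_singleton_iff, hc, not_not]
    refine and_congr_right fun _ => forall₂_congr fun b hb => ?_
    rw [if_neg (ne_of_mem_of_not_mem hb ha), Set.mem_singleton_iff, hc]
  simp only [this]

lemma avg_mono_of_bdd (ψ : Hamiltonian n) (h : ℝ) (x : Config n)
    {F F' : Config n × List (Fin n × ℤˣ) → ℝ} {C C' : ℝ} (hF : ∀ o, |F o| ≤ C)
    (hF' : ∀ o, |F' o| ≤ C')
    (hle : ∀ y t, (∀ a ∉ t.map Prod.fst, y a = x a) → F (y, t) ≤ F' (y, t)) :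
    avg ψ h x F ≤ avg ψ h x F' := by
  have hsupp : ∀ (u : Marks n) (wd : List (Fin n × ℕ)) (x : Config n),
      ∀ a ∉ (runTrace ψ u x wd).2.map Prod.fst, (runTrace ψ u x wd).1 a = x a := by
    intro u wd
    induction wd with
    | nil => intros; rfl
    | cons e wd ih =>
      intro x a ha
      simp only [runTrace, List.map_cons, List.mem_cons, not_or] at ha ⊢
      rw [ih _ a ha.2, step, Function.update_of_ne ha.1]
  exact integral_mono (integrable_outcome ψ h x hF) (integrable_outcome ψ h x hF')
    fun ω => hle _ _ (hsupp _ _ _)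

lemma avg_congr (ψ : Hamiltonian n) (h : ℝ) (x : Config n)
    {F F' : Config n × List (Fin n × ℤˣ) → ℝ} {C C' : ℝ} (hF : ∀ o, |F o| ≤ C)
    (hF' : ∀ o, |F' o| ≤ C')
    (hle : ∀ y t, (∀ a ∉ t.map Prod.fst, y a = x a) → F (y, t) = F' (y, t)) :
    avg ψ h x F = avg ψ h x F' :=
  le_antisymm (avg_mono_of_bdd ψ h x hF hF' fun y t h1 => (hle y t h1).le)
    (avg_mono_of_bdd ψ h x hF' hF fun y t h1 => (hle y t h1).ge)

lemma avg_const_mul (ψ : Hamiltonian n) (h : ℝ) (x : Config n) (c : ℝ)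
    (F : Config n × List (Fin n × ℤˣ) → ℝ) : avg ψ h x (fun o => c * F o) = c * avg ψ h x F :=
  integral_const_mul _ _

lemma avg_add (ψ : Hamiltonian n) (h : ℝ) (x : Config n)
    {F F' : Config n × List (Fin n × ℤˣ) → ℝ} {C C' : ℝ} (hF : ∀ o, |F o| ≤ C)
    (hF' : ∀ o, |F' o| ≤ C') :
    avg ψ h x (fun o => F o + F' o) = avg ψ h x F + avg ψ h x F' :=
  integral_add (integrable_outcome ψ h x hF) (integrable_outcome ψ h x hF')

lemma abs_avg_le (ψ : Hamiltonian n) (h : ℝ) (x : Config n)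
    {F : Config n × List (Fin n × ℤˣ) → ℝ} {C : ℝ} (hF : ∀ o, |F o| ≤ C) :
    |avg ψ h x F| ≤ C := by
  have := norm_integral_le_of_norm_le_const (μ := driveLaw n)
    (f := fun ω => F (outcome ψ h x ω)) (C := C) (Filter.Eventually.of_forall fun ω => hF (outcome ψ h x ω))
  simpa [avg] using this

/-- The sites in a list of new spins. -/
def traceSites (o : Config n × List (Fin n × ℤˣ)) : List (Fin n) := o.2.map Prod.fst

lemma avg_bool_mul (ψ : Hamiltonian n) (h : ℝ) (x : Config n) (P : List (Fin n) → Prop)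
    {F : Config n × List (Fin n × ℤˣ) → ℝ} {C : ℝ} (hF : ∀ o, |F o| ≤ C) :
    avg ψ h x (fun o => bool (P (traceSites o)) * F o) =
      ∫ w, bool (P (sites h w)) * expW ψ (sites h w) x F ∂clockLaw n := by
  have hC : 0 ≤ C := (abs_nonneg _).trans (hF (x, []))
  rw [avg_eq (C := C)]
  · refine integral_congr_ae (Filter.Eventually.of_forall fun w => ?_)
    dsimp only
    rw [← expW_mul]
    refine expW_congr ψ _ _ _ _ fun y t _ ht => ?_
    simp only [traceSites, ht]
  · intro o
    rw [abs_mul]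
    exact (mul_le_mul (abs_bool_le _) (hF o) (abs_nonneg _) zero_le_one).trans (one_mul C).le

lemma integrable_sites {G : List (Fin n) → ℝ} {C : ℝ} (h : ℝ) (hG : ∀ l, |G l| ≤ C) :
    Integrable (fun w => G (sites h w)) (clockLaw n) :=
  Integrable.of_bound (measurable_sites h G).aestronglyMeasurable C
    (Filter.Eventually.of_forall fun _ => hG _)

lemma integrable_bool_expW (ψ : Hamiltonian n) (h : ℝ) (x : Config n) (P : List (Fin n) → Prop)
    {F : Config n × List (Fin n × ℤˣ) → ℝ} {C : ℝ} (hF : ∀ o, |F o| ≤ C) :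
    Integrable (fun w => bool (P (sites h w)) * expW ψ (sites h w) x F) (clockLaw n) := by
  have hC : 0 ≤ C := (abs_nonneg _).trans (hF (x, []))
  refine integrable_sites (G := fun l => bool (P l) * expW ψ l x F) (C := C) h fun l => ?_
  rw [abs_mul]
  exact (mul_le_mul (abs_bool_le _) (abs_expW_le ψ l x hF) (abs_nonneg _) zero_le_one).trans
    (one_mul C).le

/-- If, given `P`, the conditional expectation of `F` is `c`, then so it is on average. -/
lemma avg_bool_mul_eq (ψ : Hamiltonian n) (h : ℝ) (x : Config n) (P : List (Fin n) → Prop)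
    {F : Config n × List (Fin n × ℤˣ) → ℝ} {C : ℝ} (hF : ∀ o, |F o| ≤ C) (c : ℝ)
    (hc : ∀ l, P l → expW ψ l x F = c) :
    avg ψ h x (fun o => bool (P (traceSites o)) * F o) =
      c * ∫ w, bool (P (sites h w)) ∂clockLaw n := by
  rw [avg_bool_mul ψ h x P hF, ← integral_const_mul]
  refine integral_congr_ae (Filter.Eventually.of_forall fun w => ?_)
  dsimp only
  by_cases hP : P (sites h w)
  · rw [hc _ hP, mul_comm]
  · rw [bool_of_false hP]
    ring

lemma le_avg_bool_mul (ψ : Hamiltonian n) (h : ℝ) (x : Config n) (P : List (Fin n) → Prop)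
    {F : Config n × List (Fin n × ℤˣ) → ℝ} {C : ℝ} (hF : ∀ o, |F o| ≤ C) (c : ℝ)
    (hc : ∀ l, P l → c ≤ expW ψ l x F) :
    c * ∫ w, bool (P (sites h w)) ∂clockLaw n ≤
      avg ψ h x (fun o => bool (P (traceSites o)) * F o) := by
  rw [avg_bool_mul ψ h x P hF, ← integral_const_mul]
  refine integral_mono (integrable_sites (G := fun l => c * bool (P l)) (C := |c|) h fun l => ?_)
    (integrable_bool_expW ψ h x P hF) fun w => ?_
  · rw [abs_mul]
    exact mul_le_of_le_one_right (abs_nonneg c) (abs_bool_le _)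
  · dsimp only
    by_cases hP : P (sites h w)
    · rw [bool_of_true hP]
      linarith [hc _ hP]
    · rw [bool_of_false hP]
      simp

lemma avg_bool (ψ : Hamiltonian n) (h : ℝ) (x : Config n) (P : List (Fin n) → Prop) :
    avg ψ h x (fun o => bool (P (traceSites o))) = ∫ w, bool (P (sites h w)) ∂clockLaw n := by
  have := avg_bool_mul_eq ψ h x P (F := fun _ => 1) (C := 1) (fun _ => by simp) 1
    fun l _ => expW_const ψ l 1 x
  simpa using this

/-! ### The burn-in -/

lemma sq_eval_le (f : Hamiltonian n) (x : Config n) : |f.eval x ^ 2| ≤ (∑ S, |f S|) ^ 2 := by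
  rw [abs_pow]
  exact pow_le_pow_left₀ (abs_nonneg _) (f.abs_eval_le x) 2

/-- The effect of one time step on the second moment of a polynomial. -/
lemma burnIn_step (ψ : Hamiltonian n) {h m : ℝ} (hh : 0 ≤ h)
    (hm0 : 0 ≤ m) (hm : ∀ a x, m ≤ upProb ψ a x ∧ m ≤ 1 - upProb ψ a x) {i j a : Fin n} {d : ℕ}
    (f : Hamiltonian n) (hi : i ∉ f.supp) (hj : j ∉ f.supp) (hd : f.supp.card ≤ d)
    (G : Set (ℕ × ℕ)) (x : Config n) :
    patProb h i j G * ((1 - d * (1 - Real.exp (-h))) * f.eval x ^ 2 +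
        (1 - Real.exp (-h)) * Real.exp (-h) ^ d * (2 * m) * (f.deriv a).eval x ^ 2) ≤
      avg ψ h x fun o => bool (Pattern i j G (traceSites o)) * f.eval o.1 ^ 2 := by
  classical
  set ρ := Real.exp (-h) with hρ
  have hρ0 : 0 < ρ := Real.exp_pos _
  have hρ1 : ρ ≤ 1 := Real.exp_le_one_iff.2 (by linarith)
  have hpow : ∀ k ≤ d, ρ ^ d ≤ ρ ^ k := fun k hk => pow_le_pow_of_le_one hρ0.le hρ1 hk
  -- Bernoulli's inequality for the probability `ρ ^ d` that `d` given sites all rest.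
  have hbern : 1 - d * (1 - ρ) ≤ ρ ^ d := by
    have := one_add_mul_le_pow (a := ρ - 1) (by linarith) d
    rw [show (1 : ℝ) + (ρ - 1) = ρ by ring] at this
    linarith
  have hp := patProb_nonneg h i j G
  have hF : ∀ o : Config n × List (Fin n × ℤˣ), |f.eval o.1 ^ 2| ≤ (∑ S, |f S|) ^ 2 :=
    fun o => sq_eval_le f o.1
  have hquiet : ∀ l, Quiet f.supp l → expW ψ l x (fun o => f.eval o.1 ^ 2) = f.eval x ^ 2 := by
    intro l hl
    rw [expW_congr ψ l x _ (fun _ => f.eval x ^ 2), expW_const]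
    intro y t hy _
    simp only
    rw [f.eval_congr fun b hb => hy b (hl b hb)]
  rw [avg_bool_mul ψ h x _ hF]
  -- If `a` is a variable of `f`, two disjoint events are used: either no variable of `f` is
  -- updated, or `a` is updated and no other one is. Both are independent of the counts of `i` and
  -- `j`, which are not variables of `f`.
  by_cases ha : a ∈ f.supp
  · have hai : a ≠ i := ne_of_mem_of_not_mem ha hi
    have haj : a ≠ j := ne_of_mem_of_not_mem ha hj
    set D := f.supp.erase a
    have hDc : D.card ≤ d := (Finset.card_le_card (Finset.erase_subset _ _)).trans hd
    set g := (f.deriv a).eval x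
    have i1 := integral_pattern_quiet hh G f.supp hi hj
    have i2 := integral_pattern_quiet_mem hh G D (fun hc => hi (Finset.mem_of_mem_erase hc))
      (fun hc => hj (Finset.mem_of_mem_erase hc)) (Finset.notMem_erase a f.supp) hai haj
    -- Here `f = x_a g + r` with `g` and `r` frozen, and `x_a` ends at each value with probability
    -- at least `m`. The bound is `m ((r + g)² + (r - g)²) ≥ 2 m g²`.
    have hone : ∀ l, a ∈ l → Quiet D l → 2 * m * g ^ 2 ≤ expW ψ l x fun o => f.eval o.1 ^ 2 := by
      intro l hal hl
      set r := (f.drop a).eval x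
      have hval : ∀ y : Config n, (∀ b ∉ l, y b = x b) →
          f.eval y ^ 2 = (r + g) ^ 2 * (if y a = 1 then 1 else 0) +
            (r - g) ^ 2 * (if y a = -1 then 1 else 0) := by
        intro y hy
        have e1 : (f.deriv a).eval y = g :=
          (f.deriv a).eval_congr fun b hb => hy b (hl b (f.supp_deriv a hb))
        have e2 : (f.drop a).eval y = r :=
          (f.drop a).eval_congr fun b hb => hy b (hl b (f.supp_drop a hb))
        rw [f.eval_eq a, e1, e2]
        have hne : (1 : ℤˣ) ≠ -1 := by decide
        rcases Int.units_eq_one_or (y a) with h1 | h1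
        · rw [h1, if_pos rfl, if_neg hne]
          push_cast
          ring
        · rw [h1, if_pos rfl, if_neg hne.symm]
          push_cast
          ring
      rw [expW_congr ψ l x _ (fun o => (r + g) ^ 2 * (if o.1 a = 1 then 1 else 0) +
        (r - g) ^ 2 * (if o.1 a = -1 then 1 else 0)) fun y t hy _ => hval y hy,
        expW_add, expW_mul, expW_mul]
      have s1 := le_expW_spin ψ (hm a) 1 l hal x
      have s2 := le_expW_spin ψ (hm a) (-1) l hal x
      nlinarith [mul_le_mul_of_nonneg_left s1 (sq_nonneg (r + g)),
        mul_le_mul_of_nonneg_left s2 (sq_nonneg (r - g)), mul_nonneg hm0 (sq_nonneg r)]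
    have hpt : ∀ l, f.eval x ^ 2 * bool (Pattern i j G l ∧ Quiet f.supp l) +
        2 * m * g ^ 2 * bool (Pattern i j G l ∧ a ∈ l ∧ Quiet D l) ≤
        bool (Pattern i j G l) * expW ψ l x fun o => f.eval o.1 ^ 2 := by
      intro l
      by_cases hG : Pattern i j G l
      · rw [bool_of_true hG]
        by_cases hq : Quiet f.supp l
        · rw [bool_of_true ⟨hG, hq⟩, bool_of_false (fun hc => hq a ha hc.2.1), hquiet l hq]
          linarith
        · rw [bool_of_false fun hc => hq hc.2]
          by_cases hq2 : a ∈ l ∧ Quiet D l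
          · rw [bool_of_true ⟨hG, hq2⟩]
            linarith [hone l hq2.1 hq2.2]
          · rw [bool_of_false fun hc => hq2 hc.2]
            have : 0 ≤ expW ψ l x fun o => f.eval o.1 ^ 2 := by
              rw [← expW_const ψ l 0 x]
              exact expW_mono ψ l x _ _ fun y t _ _ => sq_nonneg _
            linarith
      · rw [bool_of_false hG, bool_of_false fun hc => hG hc.1, bool_of_false fun hc => hG hc.1]
        simp
    have hI1 := integrable_sites (G := fun l => bool (Pattern i j G l ∧ Quiet f.supp l)) (C := 1) h
      fun l => abs_bool_le _
    have hI2 := integrable_sites (G := fun l => bool (Pattern i j G l ∧ a ∈ l ∧ Quiet D l))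
      (C := 1) h fun l => abs_bool_le _
    have := integral_mono ((hI1.const_mul (f.eval x ^ 2)).add (hI2.const_mul (2 * m * g ^ 2)))
      (integrable_bool_expW ψ h x _ hF) fun w => hpt (sites h w)
    simp only [Pi.add_apply] at this
    rw [integral_add (hI1.const_mul _) (hI2.const_mul _), integral_const_mul, integral_const_mul,
      i1, i2] at this
    refine le_trans ?_ this
    have t1 : (1 - d * (1 - ρ)) ≤ ρ ^ f.supp.card := hbern.trans (hpow _ hd)
    have t2 : (1 - ρ) * ρ ^ d ≤ (1 - ρ) * ρ ^ D.card :=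
      mul_le_mul_of_nonneg_left (hpow _ hDc) (by linarith)
    have u1 := mul_le_mul_of_nonneg_left t1 (mul_nonneg hp (sq_nonneg (f.eval x)))
    have u2 := mul_le_mul_of_nonneg_left t2 (mul_nonneg hp (mul_nonneg (mul_nonneg zero_le_two hm0)
      (sq_nonneg g)))
    linarith
  -- If `a` is not a variable of `f`, the derivative vanishes and the event that `f` is frozen
  -- suffices.
  · have hg : (f.deriv a).eval x = 0 := by
      refine Finset.sum_eq_zero fun S _ => ?_
      have : f.deriv a S = 0 := by
        by_contra hc
        by_cases haS : a ∈ S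
        · exact hc (if_pos haS)
        · rw [Hamiltonian.deriv, if_neg haS] at hc
          exact ha (Hamiltonian.mem_supp.2 ⟨_, hc, Finset.mem_insert_self _ _⟩)
      rw [this, zero_mul]
    rw [hg]
    have i1 := integral_pattern_quiet hh G f.supp hi hj
    have hpt : ∀ l, f.eval x ^ 2 * bool (Pattern i j G l ∧ Quiet f.supp l) ≤
        bool (Pattern i j G l) * expW ψ l x fun o => f.eval o.1 ^ 2 := by
      intro l
      rw [bool_and]
      by_cases hq : Quiet f.supp l
      · rw [hquiet l hq, bool_of_true hq]
        linarith
      · rw [bool_of_false hq, mul_zero, mul_zero]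
        refine mul_nonneg (bool_nonneg _) ?_
        rw [← expW_const ψ l 0 x]
        exact expW_mono ψ l x _ _ fun y t _ _ => sq_nonneg _
    have hI1 := integrable_sites (G := fun l => bool (Pattern i j G l ∧ Quiet f.supp l)) (C := 1) h
      fun l => abs_bool_le _
    have := integral_mono (hI1.const_mul (f.eval x ^ 2))
      (integrable_bool_expW ψ h x _ hF) fun w => hpt (sites h w)
    rw [integral_const_mul, i1] at this
    refine le_trans ?_ this
    have t1 : (1 - d * (1 - ρ)) ≤ ρ ^ f.supp.card := hbern.trans (hpow _ hd)
    have u1 := mul_le_mul_of_nonneg_left t1 (mul_nonneg hp (sq_nonneg (f.eval x)))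
    linarith

/-! ## The expected statistic of a block -/

/-- The expectation over three consecutive time intervals of length `h`. -/
def avg3 (ψ : Hamiltonian n) (h : ℝ) (x : Config n)
    (F : Config n × List (Fin n × ℤˣ) → Config n × List (Fin n × ℤˣ) →
      Config n × List (Fin n × ℤˣ) → ℝ) : ℝ :=
  avg ψ h x fun o₁ => avg ψ h o₁.1 fun o₂ => avg ψ h o₂.1 fun o₃ => F o₁ o₂ o₃

section Avg3

variable (ψ : Hamiltonian n) (h : ℝ) (x : Config n)
  {F F' : Config n × List (Fin n × ℤˣ) → Config n × List (Fin n × ℤˣ) →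
    Config n × List (Fin n × ℤˣ) → ℝ} {C C' : ℝ}

lemma avg_mono (x : Config n) {f f' : Config n × List (Fin n × ℤˣ) → ℝ} {C C' : ℝ}
    (hf : ∀ o, |f o| ≤ C) (hf' : ∀ o, |f' o| ≤ C') (hle : ∀ o, f o ≤ f' o) :
    avg ψ h x f ≤ avg ψ h x f' :=
  avg_mono_of_bdd ψ h x hf hf' fun _ _ _ => hle _

lemma avg3_mono (hF : ∀ a b c, |F a b c| ≤ C) (hF' : ∀ a b c, |F' a b c| ≤ C')
    (hle : ∀ a b c, F a b c ≤ F' a b c) : avg3 ψ h x F ≤ avg3 ψ h x F' :=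
  avg_mono ψ h x (fun _ => abs_avg_le ψ h _ fun _ => abs_avg_le ψ h _ fun _ => hF _ _ _)
    (fun _ => abs_avg_le ψ h _ fun _ => abs_avg_le ψ h _ fun _ => hF' _ _ _) fun _ =>
    avg_mono ψ h _ (fun _ => abs_avg_le ψ h _ fun _ => hF _ _ _)
      (fun _ => abs_avg_le ψ h _ fun _ => hF' _ _ _) fun _ =>
      avg_mono ψ h _ (fun _ => hF _ _ _) (fun _ => hF' _ _ _) fun _ => hle _ _ _

lemma avg3_add (hF : ∀ a b c, |F a b c| ≤ C) (hF' : ∀ a b c, |F' a b c| ≤ C') :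
    avg3 ψ h x (fun a b c => F a b c + F' a b c) = avg3 ψ h x F + avg3 ψ h x F' := by
  unfold avg3
  rw [← avg_add ψ h x (fun _ => abs_avg_le ψ h _ fun _ => abs_avg_le ψ h _ fun _ => hF _ _ _)
    (fun _ => abs_avg_le ψ h _ fun _ => abs_avg_le ψ h _ fun _ => hF' _ _ _)]
  congr 1
  funext o₁
  rw [← avg_add ψ h _ (fun _ => abs_avg_le ψ h _ fun _ => hF _ _ _)
    (fun _ => abs_avg_le ψ h _ fun _ => hF' _ _ _)]
  congr 1
  funext o₂
  rw [← avg_add ψ h _ (fun _ => hF _ _ _) (fun _ => hF' _ _ _)]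

lemma avg3_const_mul (c : ℝ) : avg3 ψ h x (fun o₁ o₂ o₃ => c * F o₁ o₂ o₃) = c * avg3 ψ h x F := by
  simp only [avg3, avg_const_mul]

lemma avg3_bool (P₁ P₂ P₃ : List (Fin n) → Prop) :
    avg3 ψ h x (fun o₁ o₂ o₃ =>
      bool (P₁ (traceSites o₁)) * bool (P₂ (traceSites o₂)) * bool (P₃ (traceSites o₃))) =
      (∫ w, bool (P₁ (sites h w)) ∂clockLaw n) * (∫ w, bool (P₂ (sites h w)) ∂clockLaw n) *
        ∫ w, bool (P₃ (sites h w)) ∂clockLaw n := by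
  have e1 : ∀ (x : Config n) (P : List (Fin n) → Prop) (a b : ℝ),
      avg ψ h x (fun o => a * bool (P (traceSites o)) * b) =
        a * (∫ w, bool (P (sites h w)) ∂clockLaw n) * b := by
    intro x P a b
    rw [← avg_bool ψ h x P, ← avg_const_mul, mul_comm, ← avg_const_mul]
    congr 1
    funext o
    ring
  simp only [avg3, avg_const_mul, avg_bool]
  have h2 := fun (x : Config n) (a : ℝ) => e1 x P₂ a (∫ w, bool (P₃ (sites h w)) ∂clockLaw n)
  simp only [h2]
  have h3 := e1 x P₁ 1 ((∫ w, bool (P₂ (sites h w)) ∂clockLaw n) *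
    ∫ w, bool (P₃ (sites h w)) ∂clockLaw n)
  simp only [one_mul] at h3
  simp only [mul_assoc] at h3 ⊢
  exact h3

end Avg3

/-- The pattern in the outer two thirds. -/
def outerPat : Set (ℕ × ℕ) := {(2, 0)}

/-- The pattern in the middle third. -/
def middlePat : Set (ℕ × ℕ) := {q | q.1 = 0 ∧ q.2 ≠ 0}

/-- The statistic as a function of the spins in the outer two thirds. -/
def stat (i : Fin n) (o₁ o₃ : Config n × List (Fin n × ℤˣ)) : ℝ :=
  pairInd (valsOf i o₁.2) - 2 * headInd (valsOf i o₁.2) * headInd (valsOf i o₃.2) +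
    pairInd (valsOf i o₃.2)

/-- The event that the statistic of the block is defined. -/
def Good (i j : Fin n) (o₁ o₂ o₃ : Config n × List (Fin n × ℤˣ)) : Prop :=
  Pattern i j outerPat (traceSites o₁) ∧ Pattern i j middlePat (traceSites o₂) ∧
    Pattern i j outerPat (traceSites o₃)

lemma pattern_outer {i j : Fin n} {l : List (Fin n)} :
    Pattern i j outerPat l ↔ 2 ≤ l.count i ∧ l.count j = 0 := by
  simp only [Pattern, outerPat, Set.mem_singleton_iff, Prod.mk.injEq]
  omega

lemma pattern_middle {i j : Fin n} {l : List (Fin n)} :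
    Pattern i j middlePat l ↔ l.count i = 0 ∧ 1 ≤ l.count j := by
  simp only [Pattern, middlePat, Set.mem_ofPred_eq]
  omega

lemma blockStat_eq (i j : Fin n) (o₁ o₂ o₃ : Config n × List (Fin n × ℤˣ)) :
    (Good i j o₁ o₂ o₃ → blockStat i j o₁.2 o₂.2 o₃.2 = some (stat i o₁ o₃)) ∧
      (¬ Good i j o₁ o₂ o₃ → blockStat i j o₁.2 o₂.2 o₃.2 = none) := by
  rw [Good, pattern_outer, pattern_middle, pattern_outer]
  simp only [traceSites, ← length_valsOf, blockStat, stat]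
  generalize valsOf i o₁.2 = v₁
  generalize valsOf i o₂.2 = v₂
  generalize valsOf i o₃.2 = v₃
  generalize valsOf j o₁.2 = w₁
  generalize valsOf j o₂.2 = w₂
  generalize valsOf j o₃.2 = w₃
  rcases v₁ with _ | ⟨x, _ | ⟨y, v₁⟩⟩ <;> rcases v₂ with _ | ⟨z, v₂⟩ <;>
    rcases v₃ with _ | ⟨x', _ | ⟨y', v₃⟩⟩ <;> rcases w₁ with _ | ⟨_, w₁⟩ <;>
    rcases w₂ with _ | ⟨_, w₂⟩ <;> rcases w₃ with _ | ⟨_, w₃⟩ <;>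
    simp [statVals, pairInd, headInd]

lemma pairInd_le_headInd (v : List ℤˣ) : pairInd v ≤ headInd v := by
  rcases v with _ | ⟨a, _ | ⟨b, v⟩⟩
  · simp [pairInd, headInd]
  · exact ind_nonneg a
  · exact mul_le_of_le_one_right (ind_nonneg a) (ind_le_one b)

/-- From `Y₁ Y₂ ≤ Y₁` and `Y₁' Y₂' ≤ Y₁'` one gets `Z ≤ Y₁ - 2 Y₁ Y₁' + Y₁' ≤ 1`. The sharper upper
bound is why non-calm blocks cost only `ε` for non-adjacent pairs, but `2 ε` for adjacent ones. -/
lemma stat_mem (i : Fin n) (o₁ o₃ : Config n × List (Fin n × ℤˣ)) :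
    -2 ≤ stat i o₁ o₃ ∧ stat i o₁ o₃ ≤ 1 := by
  have a1 := headInd_mem (valsOf i o₁.2)
  have a3 := headInd_mem (valsOf i o₃.2)
  have b1 := pairInd_mem (valsOf i o₁.2)
  have b3 := pairInd_mem (valsOf i o₃.2)
  have c1 := pairInd_le_headInd (valsOf i o₁.2)
  have c3 := pairInd_le_headInd (valsOf i o₃.2)
  unfold stat
  constructor
  · nlinarith
  · nlinarith [mul_nonneg (sub_nonneg.2 a1.2) (sub_nonneg.2 a3.2), mul_nonneg a1.1 a3.1]

lemma avg_bool_congr (ψ : Hamiltonian n) (h : ℝ) (x : Config n) (P : List (Fin n) → Prop)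
    {F F' : Config n × List (Fin n × ℤˣ) → ℝ} {C C' : ℝ} (hF : ∀ o, |F o| ≤ C)
    (hF' : ∀ o, |F' o| ≤ C') (he : ∀ l, P l → expW ψ l x F = expW ψ l x F') :
    avg ψ h x (fun o => bool (P (traceSites o)) * F o) =
      avg ψ h x (fun o => bool (P (traceSites o)) * F' o) := by
  rw [avg_bool_mul ψ h x P hF, avg_bool_mul ψ h x P hF']
  refine integral_congr_ae (Filter.Eventually.of_forall fun w => ?_)
  dsimp only
  by_cases hP : P (sites h w)
  · rw [he _ hP]
  · simp [bool_of_false hP]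

section Block

variable (ψ : Hamiltonian n) (h : ℝ) (i j : Fin n)

/-- The neighbours of `i` other than `j`. -/
def otherNbrs : Finset (Fin n) := (ψ.deriv i).supp.erase j

/-- `G` occurs and no neighbour of `i` other than `j` is updated. -/
def Calm (G : Set (ℕ × ℕ)) (l : List (Fin n)) : Prop :=
  Pattern i j G l ∧ Quiet (otherNbrs ψ i j) l

variable {ψ i j}

lemma Calm.not_adj {l : List (Fin n)} (hl : Calm ψ i j outerPat l) :
    ∀ a ∈ l, ¬ (dependencyGraph ψ).Adj i a := by
  intro a ha hadj
  have h1 := (pattern_outer.1 hl.1).2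
  by_cases haj : a = j
  · subst haj
    exact List.count_eq_zero.1 h1 ha
  · exact hl.2 a (Finset.mem_erase.2 ⟨haj, hadj⟩) ha

lemma abs_mul_le_one {a b : ℝ} (ha : |a| ≤ 1) (hb : |b| ≤ 1) : |a * b| ≤ 1 := by
  rw [abs_mul]
  exact mul_le_one₀ ha (abs_nonneg _) hb

lemma abs_le_one_of_mem {a : ℝ} (h : 0 ≤ a ∧ a ≤ 1) : |a| ≤ 1 := abs_le.2 ⟨by linarith, h.2⟩

lemma upProb_mem (a : Fin n) (x : Config n) : |upProb ψ a x| ≤ 1 :=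
  abs_le_one_of_mem ⟨upProb_nonneg ψ a x, upProb_le_one ψ a x⟩

/-- The constants `A` and `B` stand for `Y₁ Y₂` and `Y₁`, which are fixed when the last third is
integrated. In `avg_second` they are also replaced by `p²` and `p`. -/
lemma avg_third (x : Config n) {A B : ℝ} (hA : |A| ≤ 1) (hB : |B| ≤ 1) :
    avg ψ h x (fun o => bool (Calm ψ i j outerPat (traceSites o)) *
      (A - 2 * B * headInd (valsOf i o.2) + pairInd (valsOf i o.2))) =
      (A - 2 * B * upProb ψ i x + upProb ψ i x ^ 2) *
        ∫ w, bool (Calm ψ i j outerPat (sites h w)) ∂clockLaw n := by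
  refine avg_bool_mul_eq ψ h x _ (C := 4) (fun o => ?_) _ fun l hl => ?_
  · have h1 := abs_le.1 hA
    have h2 := abs_le.1 (abs_mul_le_one hB (abs_le_one_of_mem (headInd_mem (valsOf i o.2))))
    have h3 := pairInd_mem (valsOf i o.2)
    rw [abs_le]
    constructor <;> nlinarith
  · have hc := (pattern_outer.1 hl.1).1
    have e1 : ∀ o : Config n × List (Fin n × ℤˣ),
        A - 2 * B * headInd (valsOf i o.2) + pairInd (valsOf i o.2) =
          (A + (-2 * B) * headInd (valsOf i o.2)) + pairInd (valsOf i o.2) := fun o => by ring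
    simp only [e1]
    rw [expW_add, expW_add, expW_mul, expW_const, expW_headInd ψ l (by omega) hl.not_adj,
      expW_pairInd ψ l hc hl.not_adj]
    ring

lemma avg_second (x : Config n) {A B : ℝ} (hA : |A| ≤ 1) (hB : |B| ≤ 1) :
    avg ψ h x (fun o => bool (Calm ψ i j middlePat (traceSites o)) *
      (A - 2 * B * upProb ψ i o.1 + upProb ψ i o.1 ^ 2)) =
      A * (∫ w, bool (Calm ψ i j middlePat (sites h w)) ∂clockLaw n) -
        2 * B * avg ψ h x (fun o => bool (Calm ψ i j middlePat (traceSites o)) * upProb ψ i o.1) +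
        avg ψ h x (fun o => bool (Calm ψ i j middlePat (traceSites o)) * upProb ψ i o.1 ^ 2) := by
  have e1 : ∀ o : Config n × List (Fin n × ℤˣ),
      bool (Calm ψ i j middlePat (traceSites o)) *
        (A - 2 * B * upProb ψ i o.1 + upProb ψ i o.1 ^ 2) =
      (A * bool (Calm ψ i j middlePat (traceSites o)) +
        (-2 * B) * (bool (Calm ψ i j middlePat (traceSites o)) * upProb ψ i o.1)) +
        bool (Calm ψ i j middlePat (traceSites o)) * upProb ψ i o.1 ^ 2 := fun o => by ring
  simp only [e1]
  have b1 : ∀ o : Config n × List (Fin n × ℤˣ),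
      |A * bool (Calm ψ i j middlePat (traceSites o))| ≤ 1 := fun o =>
    abs_mul_le_one hA (abs_bool_le _)
  have b2 : ∀ o : Config n × List (Fin n × ℤˣ),
      |(-2 * B) * (bool (Calm ψ i j middlePat (traceSites o)) * upProb ψ i o.1)| ≤ 2 := fun o => by
    have := abs_mul_le_one hB (abs_mul_le_one (abs_bool_le (Calm ψ i j middlePat (traceSites o)))
      (upProb_mem (ψ := ψ) i o.1))
    rw [show (-2 * B) * (bool (Calm ψ i j middlePat (traceSites o)) * upProb ψ i o.1) =
      -2 * (B * (bool (Calm ψ i j middlePat (traceSites o)) * upProb ψ i o.1)) by ring, abs_mul,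
      show |(-2 : ℝ)| = 2 by norm_num]
    linarith
  have b3 : ∀ o : Config n × List (Fin n × ℤˣ),
      |bool (Calm ψ i j middlePat (traceSites o)) * upProb ψ i o.1 ^ 2| ≤ 1 := fun o => by
    rw [pow_two]
    exact abs_mul_le_one (abs_bool_le _) (abs_mul_le_one (upProb_mem i _) (upProb_mem i _))
  rw [avg_add ψ h x (fun o => (abs_add_le _ _).trans (add_le_add (b1 o) (b2 o))) b3,
    avg_add ψ h x b1 b2, avg_const_mul, avg_const_mul, avg_bool]
  ring

/-- On calm blocks the expected statistic is the expected squared change of the update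
probability. -/
lemma avg3_calm (x : Config n) :
    avg3 ψ h x (fun o₁ o₂ o₃ => bool (Calm ψ i j outerPat (traceSites o₁)) *
      bool (Calm ψ i j middlePat (traceSites o₂)) * bool (Calm ψ i j outerPat (traceSites o₃)) *
        stat i o₁ o₃) =
      (∫ w, bool (Calm ψ i j outerPat (sites h w)) ∂clockLaw n) *
        avg ψ h x fun o₁ => bool (Calm ψ i j outerPat (traceSites o₁)) *
          avg ψ h o₁.1 fun o₂ => bool (Calm ψ i j middlePat (traceSites o₂)) *
            (upProb ψ i x - upProb ψ i o₂.1) ^ 2 := by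
  set aO := ∫ w, bool (Calm ψ i j outerPat (sites h w)) ∂clockLaw n
  set aM := ∫ w, bool (Calm ψ i j middlePat (sites h w)) ∂clockLaw n with haM
  set φ₁ : Config n → ℝ := fun x => avg ψ h x fun o =>
    bool (Calm ψ i j middlePat (traceSites o)) * upProb ψ i o.1
  set φ₂ : Config n → ℝ := fun x => avg ψ h x fun o =>
    bool (Calm ψ i j middlePat (traceSites o)) * upProb ψ i o.1 ^ 2
  have hφ₁ : ∀ x, |φ₁ x| ≤ 1 := fun x => abs_avg_le ψ h x fun o =>
    abs_mul_le_one (abs_bool_le _) (upProb_mem i _)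
  have hφ₂ : ∀ x, |φ₂ x| ≤ 1 := fun x => abs_avg_le ψ h x fun o => by
    rw [pow_two]
    exact abs_mul_le_one (abs_bool_le _) (abs_mul_le_one (upProb_mem i _) (upProb_mem i _))
  have haM1 : |aM| ≤ 1 := by
    rw [haM, ← avg_bool ψ h x]
    exact abs_avg_le ψ h x fun _ => abs_bool_le _
  have H : ∀ o : Config n × List (Fin n × ℤˣ), |headInd (valsOf i o.2)| ≤ 1 := fun o =>
    abs_le_one_of_mem (headInd_mem _)
  have P : ∀ o : Config n × List (Fin n × ℤˣ), |pairInd (valsOf i o.2)| ≤ 1 := fun o =>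
    abs_le_one_of_mem (pairInd_mem _)
  have third : ∀ o₁ o₂ : Config n × List (Fin n × ℤˣ), avg ψ h o₂.1 (fun o₃ =>
      bool (Calm ψ i j outerPat (traceSites o₁)) * bool (Calm ψ i j middlePat (traceSites o₂)) *
        bool (Calm ψ i j outerPat (traceSites o₃)) * stat i o₁ o₃) =
      (bool (Calm ψ i j outerPat (traceSites o₁)) * aO) *
        (bool (Calm ψ i j middlePat (traceSites o₂)) *
        (pairInd (valsOf i o₁.2) - 2 * headInd (valsOf i o₁.2) * upProb ψ i o₂.1 +
          upProb ψ i o₂.1 ^ 2)) := by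
    intro o₁ o₂
    have := avg_third h (ψ := ψ) (i := i) (j := j) o₂.1 (P o₁) (H o₁)
    simp only [mul_assoc, stat] at this ⊢
    rw [avg_const_mul, avg_const_mul, this]
    ring
  have second : ∀ o₁ : Config n × List (Fin n × ℤˣ), avg ψ h o₁.1 (fun o₂ =>
      (bool (Calm ψ i j outerPat (traceSites o₁)) * aO) *
        (bool (Calm ψ i j middlePat (traceSites o₂)) *
        (pairInd (valsOf i o₁.2) - 2 * headInd (valsOf i o₁.2) * upProb ψ i o₂.1 +
          upProb ψ i o₂.1 ^ 2))) =
      aO * (bool (Calm ψ i j outerPat (traceSites o₁)) * (pairInd (valsOf i o₁.2) * aM -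
        2 * headInd (valsOf i o₁.2) * φ₁ o₁.1 + φ₂ o₁.1)) := by
    intro o₁
    rw [avg_const_mul, avg_second h o₁.1 (P o₁) (H o₁)]
    ring
  unfold avg3
  simp only [third, second]
  rw [avg_const_mul]
  congr 1
  -- The right side has the form given by `avg_second` with `A = p²` and `B = p`. It remains to
  -- replace `Y₁ Y₂` by `p²` and `Y₁` by `p` under the average over the first third.
  have target : ∀ o₁ : Config n × List (Fin n × ℤˣ), (avg ψ h o₁.1 fun o₂ =>
      bool (Calm ψ i j middlePat (traceSites o₂)) * (upProb ψ i x - upProb ψ i o₂.1) ^ 2) =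
      upProb ψ i x ^ 2 * aM - 2 * upProb ψ i x * φ₁ o₁.1 + φ₂ o₁.1 := by
    intro o₁
    rw [← avg_second h o₁.1 (by
      rw [pow_two]
      exact abs_mul_le_one (upProb_mem i _) (upProb_mem i _)) (upProb_mem i _)]
    congr 1
    funext o₂
    ring
  simp only [target]
  have hbd : ∀ {a b c d e : ℝ}, |a| ≤ 1 → |b| ≤ 1 → |c| ≤ 1 → |d| ≤ 1 → |e| ≤ 1 →
      |a * b - 2 * c * d + e| ≤ 4 := by
    intro a b c d e ha hb hc hd he
    have h1 := abs_le.1 (abs_mul_le_one ha hb)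
    have h2 := abs_le.1 (abs_mul_le_one hc hd)
    have h3 := abs_le.1 he
    rw [abs_le]
    constructor <;> nlinarith
  -- The function `φ₁` depends on the configuration after the first third. Since `i` is updated a
  -- second time there, that configuration keeps no memory of `Y₁`, and `expW_headInd_mul` factors
  -- the product.
  refine avg_bool_congr ψ h x _ (fun o => hbd (P o) haM1 (H o) (hφ₁ _) (hφ₂ _))
    (fun o => hbd (by
      rw [pow_two]
      exact abs_mul_le_one (upProb_mem i _) (upProb_mem i _)) haM1 (upProb_mem i _) (hφ₁ _)
      (hφ₂ _)) fun l hl => ?_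
  have hc := (pattern_outer.1 hl.1).1
  have e1 : ∀ o : Config n × List (Fin n × ℤˣ), pairInd (valsOf i o.2) * aM -
      2 * headInd (valsOf i o.2) * φ₁ o.1 + φ₂ o.1 =
      (aM * pairInd (valsOf i o.2) + (-2) * (headInd (valsOf i o.2) * φ₁ o.1)) + φ₂ o.1 :=
    fun o => by ring
  have e2 : ∀ o : Config n × List (Fin n × ℤˣ), upProb ψ i x ^ 2 * aM -
      2 * upProb ψ i x * φ₁ o.1 + φ₂ o.1 =
      (upProb ψ i x ^ 2 * aM + (-2 * upProb ψ i x) * φ₁ o.1) + φ₂ o.1 := fun o => by ring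
  simp only [e1, e2]
  rw [expW_add, expW_add, expW_mul, expW_mul, expW_pairInd ψ l hc hl.not_adj,
    expW_headInd_mul ψ φ₁ l hc hl.not_adj, expW_add ψ l x (fun o => upProb ψ i x ^ 2 * aM +
      -2 * upProb ψ i x * φ₁ o.1), expW_add ψ l x (fun _ => upProb ψ i x ^ 2 * aM), expW_const,
    expW_mul ψ l _ x fun o => φ₁ o.1]
  ring

end Block

/-! ## Bounds for the expected statistic -/

lemma half_exp_le_sigmoid {lam z : ℝ} (hz : |z| ≤ 2 * lam) :
    Real.exp (-2 * lam) / 2 ≤ Real.sigmoid z ∧ Real.exp (-2 * lam) / 2 ≤ 1 - Real.sigmoid z := by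
  have key : ∀ z : ℝ, |z| ≤ 2 * lam → Real.exp (-2 * lam) / 2 ≤ Real.sigmoid z := by
    intro z hz
    have hz' := abs_le.1 hz
    have h0 : 0 ≤ lam := by linarith [abs_nonneg z]
    rw [Real.sigmoid_def, div_le_iff₀ two_pos, inv_mul_eq_div, le_div_iff₀ (by positivity)]
    have h1 : Real.exp (-2 * lam) * Real.exp (-z) ≤ 1 := by
      rw [← Real.exp_add]
      exact Real.exp_le_one_iff.2 (by linarith)
    have h2 : Real.exp (-2 * lam) ≤ 1 := Real.exp_le_one_iff.2 (by linarith)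
    linarith
  refine ⟨key z hz, ?_⟩
  rw [← Real.sigmoid_neg]
  exact key (-z) (by rwa [abs_neg])

lemma mul_abs_sub_le_abs_sigmoid_sub {lam u v : ℝ} (hu : |u| ≤ 2 * lam) (hv : |v| ≤ 2 * lam) :
    Real.exp (-2 * lam) / 4 * |u - v| ≤ |Real.sigmoid u - Real.sigmoid v| := by
  have key : ∀ u v : ℝ, |u| ≤ 2 * lam → |v| ≤ 2 * lam → u ≤ v →
      Real.exp (-2 * lam) / 4 * (v - u) ≤ Real.sigmoid v - Real.sigmoid u := by
    intro u v hu hv huv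
    refine (convex_Icc (-(2 * lam)) (2 * lam)).mul_sub_le_image_sub_of_le_deriv
      differentiable_sigmoid.continuous.continuousOn
      differentiable_sigmoid.differentiableOn (fun z hz => ?_) u (abs_le.1 hu) v (abs_le.1 hv) huv
    have hz0 : z ∈ Set.Icc (-(2 * lam)) (2 * lam) := interior_subset hz
    have hz' := half_exp_le_sigmoid (abs_le.2 (Set.mem_Icc.1 hz0))
    rw [Real.deriv_sigmoid]
    have he := Real.exp_pos (-2 * lam)
    -- The derivative is `σ (1 - σ)`: one factor is at least `1 / 2`, the other at least `e^{-2λ} /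
    -- 2`.
    rcases le_total (Real.sigmoid z) (1 / 2) with h | h <;> nlinarith
  rcases le_total u v with h | h
  · rw [abs_sub_comm u, abs_sub_comm (Real.sigmoid u), abs_of_nonneg (sub_nonneg.2 h)]
    exact (key u v hu hv h).trans (le_abs_self _)
  · rw [abs_of_nonneg (sub_nonneg.2 h)]
    exact (key v u hv hu h).trans (le_abs_self _)

section Width

variable {ψ : Hamiltonian n} {lam : ℝ} (hlam : ∀ i : Fin n, ∑ S, |ψ.deriv i S| ≤ lam)

include hlam

lemma abs_two_mul_deriv_le (a : Fin n) (x : Config n) :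
    |2 * (ψ.deriv a).eval x| ≤ 2 * lam := by
  rw [abs_mul, abs_two]
  linarith [(ψ.deriv a).abs_eval_le x, hlam a]

lemma half_exp_le_upProb (a : Fin n) (x : Config n) :
    Real.exp (-2 * lam) / 2 ≤ upProb ψ a x ∧ Real.exp (-2 * lam) / 2 ≤ 1 - upProb ψ a x :=
  half_exp_le_sigmoid (abs_two_mul_deriv_le hlam a x)

/-- Flipping the neighbour `j` changes the update probability of `i` in terms of the mixed
derivative. -/
lemma sq_upProb_sub_ge {i j : Fin n} {x z : Config n} (hj : z j = -x j)
    (hz : ∀ a ∈ otherNbrs ψ i j, z a = x a) :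
    Real.exp (-4 * lam) * ((ψ.deriv i).deriv j).eval x ^ 2 ≤
      (upProb ψ i x - upProb ψ i z) ^ 2 := by
  have e1 := (ψ.deriv i).eval_eq j x
  have e2 := (ψ.deriv i).eval_eq j z
  have e3 : ((ψ.deriv i).deriv j).eval z = ((ψ.deriv i).deriv j).eval x :=
    Hamiltonian.eval_congr _ fun a ha => hz a (Hamiltonian.supp_deriv _ _ ha)
  have e4 : ((ψ.deriv i).drop j).eval z = ((ψ.deriv i).drop j).eval x :=
    Hamiltonian.eval_congr _ fun a ha => hz a (Hamiltonian.supp_drop _ _ ha)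
  have h1 := mul_abs_sub_le_abs_sigmoid_sub (abs_two_mul_deriv_le hlam i x)
    (abs_two_mul_deriv_le hlam i z)
  -- Both parts of `∂_i ψ = x_j ∂_j ∂_i ψ + rest` are unaffected by `j` and by the other frozen
  -- neighbours, so a flip of `x_j` changes the argument of the sigmoid by `4 |∂_j ∂_i ψ|`.
  have e5 : |2 * (ψ.deriv i).eval x - 2 * (ψ.deriv i).eval z| =
      4 * |((ψ.deriv i).deriv j).eval x| := by
    rw [e1, e2, e3, e4, hj]
    rcases Int.units_eq_one_or (x j) with h | h
    · rw [h, show (2 : ℝ) * (((1 : ℤˣ) : ℤ) * ((ψ.deriv i).deriv j).eval x +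
        ((ψ.deriv i).drop j).eval x) - 2 * (((-1 : ℤˣ) : ℤ) * ((ψ.deriv i).deriv j).eval x +
        ((ψ.deriv i).drop j).eval x) = 4 * ((ψ.deriv i).deriv j).eval x by push_cast; ring,
        abs_mul]
      norm_num
    · rw [h, show (2 : ℝ) * (((-1 : ℤˣ) : ℤ) * ((ψ.deriv i).deriv j).eval x +
        ((ψ.deriv i).drop j).eval x) - 2 * (((- -1 : ℤˣ) : ℤ) * ((ψ.deriv i).deriv j).eval x +
        ((ψ.deriv i).drop j).eval x) = -4 * ((ψ.deriv i).deriv j).eval x by push_cast; ring,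
        abs_mul]
      norm_num
  rw [e5] at h1
  have h2 : (Real.exp (-2 * lam) * |((ψ.deriv i).deriv j).eval x|) ^ 2 ≤
      |upProb ψ i x - upProb ψ i z| ^ 2 := by
    refine pow_le_pow_left₀ (by positivity) ?_ 2
    calc _ = Real.exp (-2 * lam) / 4 * (4 * |((ψ.deriv i).deriv j).eval x|) := by ring
      _ ≤ _ := h1
  rw [sq_abs, mul_pow, sq_abs, ← Real.exp_nat_mul] at h2
  convert h2 using 3
  push_cast
  ring_nf

end Width

section Good

variable (ψ : Hamiltonian n) {h : ℝ} (i j : Fin n)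

/-- The probability that the statistic of a block is defined. -/
def goodProb (h : ℝ) (i j : Fin n) : ℝ :=
  patProb h i j outerPat * patProb h i j middlePat * patProb h i j outerPat

lemma goodProb_nonneg (h : ℝ) (i j : Fin n) : 0 ≤ goodProb h i j :=
  mul_nonneg (mul_nonneg (patProb_nonneg _ _ _ _) (patProb_nonneg _ _ _ _)) (patProb_nonneg _ _ _ _)

lemma goodProb_le_one (h : ℝ) (i j : Fin n) : goodProb h i j ≤ 1 :=
  mul_le_one₀ (mul_le_one₀ (patProb_le_one _ _ _ _) (patProb_nonneg _ _ _ _)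
    (patProb_le_one _ _ _ _)) (patProb_nonneg _ _ _ _) (patProb_le_one _ _ _ _)

lemma bool_good_eq (o₁ o₂ o₃ : Config n × List (Fin n × ℤˣ)) :
    bool (Good i j o₁ o₂ o₃) = bool (Pattern i j outerPat (traceSites o₁)) *
      bool (Pattern i j middlePat (traceSites o₂)) *
        bool (Pattern i j outerPat (traceSites o₃)) := by
  rw [Good, bool_and, bool_and, mul_assoc]

lemma integral_bool_pattern (hh : 0 ≤ h) (G : Set (ℕ × ℕ)) :
    ∫ w, bool (Pattern i j G (sites h w)) ∂clockLaw n = patProb h i j G := by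
  have := integral_pattern_quiet hh G ∅ (Finset.notMem_empty i) (Finset.notMem_empty j)
  simpa [Quiet] using this

lemma avg3_good (hh : 0 ≤ h) (x : Config n) :
    avg3 ψ h x (fun o₁ o₂ o₃ => bool (Good i j o₁ o₂ o₃)) = goodProb h i j := by
  simp only [bool_good_eq]
  rw [avg3_bool, integral_bool_pattern i j hh, integral_bool_pattern i j hh, goodProb]

/-- The indicator that the statistic is defined and no other neighbour of `i` is updated. -/
def calmInd (o₁ o₂ o₃ : Config n × List (Fin n × ℤˣ)) : ℝ :=
  bool (Calm ψ i j outerPat (traceSites o₁)) * bool (Calm ψ i j middlePat (traceSites o₂)) *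
    bool (Calm ψ i j outerPat (traceSites o₃))

lemma calmInd_mem (o₁ o₂ o₃ : Config n × List (Fin n × ℤˣ)) :
    0 ≤ calmInd ψ i j o₁ o₂ o₃ ∧ calmInd ψ i j o₁ o₂ o₃ ≤ bool (Good i j o₁ o₂ o₃) := by
  have hb : ∀ (G : Set (ℕ × ℕ)) (l : List (Fin n)),
      bool (Calm ψ i j G l) ≤ bool (Pattern i j G l) := fun G l => by
    rw [Calm, bool_and]
    exact mul_le_of_le_one_right (bool_nonneg _) (bool_le_one _)
  rw [bool_good_eq]
  refine ⟨mul_nonneg (mul_nonneg (bool_nonneg _) (bool_nonneg _)) (bool_nonneg _), ?_⟩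
  exact mul_le_mul (mul_le_mul (hb _ _) (hb _ _) (bool_nonneg _) (bool_nonneg _)) (hb _ _)
    (bool_nonneg _) (mul_nonneg (bool_nonneg _) (bool_nonneg _))

lemma abs_calmInd_le (o₁ o₂ o₃ : Config n × List (Fin n × ℤˣ)) : |calmInd ψ i j o₁ o₂ o₃| ≤ 1 :=
  abs_le_one_of_mem ⟨(calmInd_mem ψ i j o₁ o₂ o₃).1,
    (calmInd_mem ψ i j o₁ o₂ o₃).2.trans (bool_le_one _)⟩

lemma integral_calm (hh : 0 ≤ h) (G : Set (ℕ × ℕ)) :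
    ∫ w, bool (Calm ψ i j G (sites h w)) ∂clockLaw n =
      patProb h i j G * Real.exp (-h) ^ (otherNbrs ψ i j).card :=
  integral_pattern_quiet hh G _ (fun hi => (dependencyGraph ψ).loopless.irrefl i
    (Finset.mem_of_mem_erase hi)) (Finset.notMem_erase _ _)

lemma avg3_calmInd (hh : 0 ≤ h) (x : Config n) :
    avg3 ψ h x (calmInd ψ i j) =
      goodProb h i j * (Real.exp (-h) ^ (otherNbrs ψ i j).card) ^ 3 := by
  have := avg3_bool ψ h x (Calm ψ i j outerPat) (Calm ψ i j middlePat) (Calm ψ i j outerPat)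
  rw [integral_calm ψ i j hh, integral_calm ψ i j hh] at this
  refine this.trans ?_
  rw [goodProb]
  ring

variable {ψ} {d : ℕ} {ε : ℝ}

lemma one_sub_le_quiet_pow (hh : 0 ≤ h) (hd : (ψ.deriv i).supp.card ≤ d)
    (hε : 1 - ε ≤ (Real.exp (-h) ^ d) ^ 3) :
    1 - ε ≤ (Real.exp (-h) ^ (otherNbrs ψ i j).card) ^ 3 := by
  refine hε.trans (pow_le_pow_left₀ (by positivity) ?_ 3)
  exact pow_le_pow_of_le_one (Real.exp_pos _).le (Real.exp_le_one_iff.2 (by linarith))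
    ((Finset.card_le_card (Finset.erase_subset _ _)).trans hd)

lemma abs_stat_le (o₁ o₃ : Config n × List (Fin n × ℤˣ)) : |stat i o₁ o₃| ≤ 2 := by
  have := stat_mem i o₁ o₃
  exact abs_le.2 ⟨this.1, by linarith [this.2]⟩

lemma abs_bool_mul_stat_le (P : Prop) (o₁ o₃ : Config n × List (Fin n × ℤˣ)) :
    |bool P * stat i o₁ o₃| ≤ 2 := by
  rw [abs_mul]
  calc _ ≤ 1 * 2 := mul_le_mul (abs_bool_le P) (abs_stat_le i o₁ o₃) (abs_nonneg _) zero_le_one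
    _ = 2 := by norm_num

lemma abs_calmInd_mul_stat_le (o₁ o₂ o₃ : Config n × List (Fin n × ℤˣ)) :
    |calmInd ψ i j o₁ o₂ o₃ * stat i o₁ o₃| ≤ 2 := by
  rw [abs_mul]
  calc _ ≤ 1 * 2 := mul_le_mul (abs_calmInd_le ψ i j o₁ o₂ o₃) (abs_stat_le i o₁ o₃)
        (abs_nonneg _) zero_le_one
    _ = 2 := by norm_num

lemma abs_uncalm_le (o₁ o₂ o₃ : Config n × List (Fin n × ℤˣ)) :
    |bool (Good i j o₁ o₂ o₃) + -1 * calmInd ψ i j o₁ o₂ o₃| ≤ 1 := by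
  have := calmInd_mem ψ i j o₁ o₂ o₃
  have h2 := bool_le_one (Good i j o₁ o₂ o₃)
  exact abs_le.2 ⟨by linarith, by linarith⟩

/-- Independently of the counts of `i` and `j`, the other neighbours of `i` rest through all three
thirds with probability at least `1 - ε`. -/
lemma avg3_uncalm_le (hh : 0 ≤ h) (hd : (ψ.deriv i).supp.card ≤ d)
    (hε : 1 - ε ≤ (Real.exp (-h) ^ d) ^ 3) (x : Config n) :
    avg3 ψ h x (fun o₁ o₂ o₃ => bool (Good i j o₁ o₂ o₃) + -1 * calmInd ψ i j o₁ o₂ o₃) ≤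
      goodProb h i j * ε := by
  rw [avg3_add ψ h x (C := 1) (C' := 1) (fun _ _ _ => abs_bool_le _) (fun a b c => by
    rw [neg_one_mul, abs_neg]
    exact abs_calmInd_le ψ i j a b c), avg3_const_mul, avg3_good ψ i j hh,
    show avg3 ψ h x (fun o₁ o₂ o₃ => calmInd ψ i j o₁ o₂ o₃) = _ from avg3_calmInd ψ i j hh x]
  nlinarith [one_sub_le_quiet_pow i j hh hd hε, goodProb_nonneg h i j]

/-- For non-adjacent sites the expected statistic is small. -/
lemma avg3_stat_le_of_not_adj (hh : 0 ≤ h) (hd : (ψ.deriv i).supp.card ≤ d)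
    (hε : 1 - ε ≤ (Real.exp (-h) ^ d) ^ 3) (hij : ¬ (dependencyGraph ψ).Adj i j) (x : Config n) :
    avg3 ψ h x (fun o₁ o₂ o₃ => bool (Good i j o₁ o₂ o₃) * stat i o₁ o₃) ≤ goodProb h i j * ε := by
  have hN : ∀ a ∈ (ψ.deriv i).supp, a ∈ otherNbrs ψ i j := fun a ha =>
    Finset.mem_erase.2 ⟨fun e => hij (e ▸ ha), ha⟩
  have zero : avg3 ψ h x (fun o₁ o₂ o₃ => calmInd ψ i j o₁ o₂ o₃ * stat i o₁ o₃) = 0 := by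
    have h1 := avg3_calm h (ψ := ψ) (i := i) (j := j) x
    refine h1.trans ?_
    have hb : ∀ (P : Prop) (z : Config n), |bool P * (upProb ψ i x - upProb ψ i z) ^ 2| ≤ 1 :=
      fun P z => by
        rw [pow_two]
        have : |upProb ψ i x - upProb ψ i z| ≤ 1 := abs_le.2
          ⟨by linarith [upProb_nonneg ψ i x, upProb_le_one ψ i z],
            by linarith [upProb_nonneg ψ i z, upProb_le_one ψ i x]⟩
        exact abs_mul_le_one (abs_bool_le _) (abs_mul_le_one this this)
    rw [avg_congr ψ h x (F' := fun _ => 0) (C := 1) (C' := 0), show avg ψ h x (fun _ => 0) = 0 by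
      simp [avg], mul_zero]
    · exact fun o => abs_mul_le_one (abs_bool_le _) (abs_avg_le ψ h _ fun o => hb _ _)
    · simp
    · intro y t hy
      by_cases hc : Calm ψ i j outerPat (traceSites (y, t))
      · rw [mul_eq_zero]
        right
        dsimp only
        rw [avg_congr ψ h y (F' := fun _ => 0) (C := 1) (C' := 0), show avg ψ h y (fun _ => 0) = 0 by
          simp [avg]]
        · exact fun o => hb _ _
        · simp
        · intro z t' hz
          by_cases hc' : Calm ψ i j middlePat (traceSites (z, t'))
          · rw [upProb_congr ψ (x := x) (y := z), sub_self]
            · simp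
            · intro a ha
              rw [hz a (hc'.2 a (hN a ha)), hy a (hc.2 a (hN a ha))]
          · simp [bool_of_false hc']
      · simp [bool_of_false hc]
  -- On good blocks that are not calm the statistic is bounded by `1`.
  calc _ ≤ avg3 ψ h x (fun o₁ o₂ o₃ => calmInd ψ i j o₁ o₂ o₃ * stat i o₁ o₃ +
        (bool (Good i j o₁ o₂ o₃) + -1 * calmInd ψ i j o₁ o₂ o₃)) := by
        refine avg3_mono ψ h x (C := 2) (C' := 2 + 1)
          (fun _ _ _ => abs_bool_mul_stat_le i _ _ _) (fun a b c => (abs_add_le _ _).trans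
            (add_le_add (abs_calmInd_mul_stat_le i j a b c) (abs_uncalm_le i j a b c)))
          fun a b c => ?_
        have h1 := calmInd_mem ψ i j a b c
        have h2 := stat_mem i a c
        nlinarith
    _ ≤ _ := by
        rw [avg3_add ψ h x (fun a b c => abs_calmInd_mul_stat_le i j a b c)
          (fun a b c => abs_uncalm_le i j a b c), zero, zero_add]
        exact avg3_uncalm_le i j hh hd hε x

/-- A lower bound for the expected statistic in terms of the mixed derivative. -/
lemma le_avg3_stat (hh : 0 ≤ h) (hd : (ψ.deriv i).supp.card ≤ d)
    (hε : 1 - ε ≤ (Real.exp (-h) ^ d) ^ 3) {lam : ℝ} (hlam : ∀ i : Fin n, ∑ S, |ψ.deriv i S| ≤ lam)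
    (x : Config n) :
    goodProb h i j * ((1 - ε) * (Real.exp (-6 * lam) / 2) * ((ψ.deriv i).deriv j).eval x ^ 2 -
        2 * ε) ≤
      avg3 ψ h x (fun o₁ o₂ o₃ => bool (Good i j o₁ o₂ o₃) * stat i o₁ o₃) := by
  set b := ((ψ.deriv i).deriv j).eval x
  set c := Real.exp (-6 * lam) / 2 * b ^ 2 with hc
  have hc0 : 0 ≤ c := by positivity
  set aO := ∫ w, bool (Calm ψ i j outerPat (sites h w)) ∂clockLaw n with haO
  set aM := ∫ w, bool (Calm ψ i j middlePat (sites h w)) ∂clockLaw n with haM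
  have haO0 : 0 ≤ aO := integral_nonneg fun _ => bool_nonneg _
  have haM0 : 0 ≤ aM := integral_nonneg fun _ => bool_nonneg _
  have hb : ∀ (P : Prop) (z : Config n), |bool P * (upProb ψ i x - upProb ψ i z) ^ 2| ≤ 1 :=
    fun P z => by
      rw [pow_two]
      have : |upProb ψ i x - upProb ψ i z| ≤ 1 := abs_le.2
        ⟨by linarith [upProb_nonneg ψ i x, upProb_le_one ψ i z],
          by linarith [upProb_nonneg ψ i z, upProb_le_one ψ i x]⟩
      exact abs_mul_le_one (abs_bool_le _) (abs_mul_le_one this this)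
  have inner : ∀ y : Config n, (∀ a ∈ otherNbrs ψ i j, y a = x a) →
      c * aM ≤ avg ψ h y fun o₂ => bool (Calm ψ i j middlePat (traceSites o₂)) *
            (upProb ψ i x - upProb ψ i o₂.1) ^ 2 := by
    intro y hy
    refine le_avg_bool_mul ψ h y _ (C := 1) (fun o => ?_) c fun l hl => ?_
    · simpa [bool] using hb True o.1
    · have hjl : j ∈ l := List.count_pos_iff.1 (pattern_middle.1 hl.1).2
      -- Whatever the configuration `y` at the start of the middle third, the last update of `j`
      -- there yields the opposite of its spin in `x` with probability at least `e^{-2λ} / 2`.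
      have h1 := le_expW_spin ψ (fun x => half_exp_le_upProb hlam j x) (-x j) l hjl y
      have h2 : expW ψ l y (fun o => (Real.exp (-4 * lam) * b ^ 2) *
          if o.1 j = -x j then 1 else 0) ≤
          expW ψ l y fun o => (upProb ψ i x - upProb ψ i o.1) ^ 2 := by
        refine expW_mono ψ l y _ _ fun z t hz _ => ?_
        dsimp only
        split_ifs with hzj
        · rw [mul_one]
          exact sq_upProb_sub_ge hlam hzj fun a ha => by rw [hz a (hl.2 a ha), hy a ha]
        · rw [mul_zero]
          positivity
      rw [expW_mul] at h2
      refine le_trans ?_ h2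
      calc c = Real.exp (-4 * lam) * b ^ 2 * (Real.exp (-2 * lam) / 2) := by
            rw [hc, show -6 * lam = -4 * lam + -2 * lam by ring, Real.exp_add]
            ring
        _ ≤ _ := mul_le_mul_of_nonneg_left h1 (by positivity)
  have main : aO * (c * aM * aO) ≤
      avg3 ψ h x (fun o₁ o₂ o₃ => calmInd ψ i j o₁ o₂ o₃ * stat i o₁ o₃) := by
    have h1 := avg3_calm h (ψ := ψ) (i := i) (j := j) x
    refine le_of_le_of_eq ?_ h1.symm
    refine mul_le_mul_of_nonneg_left ?_ haO0
    rw [haO, ← avg_bool ψ h x, ← avg_const_mul]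
    refine avg_mono_of_bdd ψ h x (C := |c * aM|) (C' := 1) (fun o => ?_)
      (fun o => abs_mul_le_one (abs_bool_le _) (abs_avg_le ψ h _ fun o => hb _ _)) fun y t hy => ?_
    · rw [abs_mul]
      exact mul_le_of_le_one_right (abs_nonneg _) (abs_bool_le _)
    · by_cases hcalm : Calm ψ i j outerPat (traceSites (y, t))
      · rw [bool_of_true hcalm, mul_one, one_mul]
        exact inner y fun a ha => hy a (hcalm.2 a ha)
      · simp [bool_of_false hcalm]
  have prod : goodProb h i j * (1 - ε) ≤ aO * aM * aO := by
    have h1 := one_sub_le_quiet_pow i j hh hd hε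
    have h2 : aO * aM * aO = goodProb h i j * (Real.exp (-h) ^ (otherNbrs ψ i j).card) ^ 3 := by
      rw [haO, haM, integral_calm ψ i j hh, integral_calm ψ i j hh, goodProb]
      ring
    rw [h2]
    exact mul_le_mul_of_nonneg_left h1 (goodProb_nonneg h i j)
  have unc := avg3_uncalm_le i j hh hd hε x
  -- On good blocks that are not calm the statistic is at least `-2`.
  calc _ = goodProb h i j * (1 - ε) * c + -2 * (goodProb h i j * ε) := by rw [hc]; ring
    _ ≤ aO * aM * aO * c + -2 * avg3 ψ h x (fun o₁ o₂ o₃ =>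
          bool (Good i j o₁ o₂ o₃) + -1 * calmInd ψ i j o₁ o₂ o₃) := by
        have := mul_le_mul_of_nonneg_right prod hc0
        linarith
    _ ≤ avg3 ψ h x (fun o₁ o₂ o₃ => calmInd ψ i j o₁ o₂ o₃ * stat i o₁ o₃ +
        -2 * (bool (Good i j o₁ o₂ o₃) + -1 * calmInd ψ i j o₁ o₂ o₃)) := by
        rw [avg3_add ψ h x (fun a b c => abs_calmInd_mul_stat_le i j a b c) (C' := 2)
          (fun a b c => by
            rw [abs_mul]
            have := abs_uncalm_le (ψ := ψ) i j a b c
            norm_num at this ⊢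
            linarith), avg3_const_mul]
        linarith
    _ ≤ _ := by
        refine avg3_mono ψ h x (C := 2 + 2) (C' := 2)
          (fun a b c => (abs_add_le _ _).trans (add_le_add (abs_calmInd_mul_stat_le i j a b c) ?_))
          (fun _ _ _ => abs_bool_mul_stat_le i _ _ _) fun a b c => ?_
        · rw [abs_mul]
          have := abs_uncalm_le (ψ := ψ) i j a b c
          norm_num at this ⊢
          linarith
        · have h1 := calmInd_mem ψ i j a b c
          have h2 := stat_mem i a c
          nlinarith

end Good

/-! ## The law of the result of the scan -/

/-- The Markov property for a whole block, applied to the last third first. -/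
lemma driveLaw_restart_three (ψ : Hamiltonian n) {h : ℝ} (hh : 0 ≤ h) (x : Config n)
    (B : Config n × List (Fin n × ℤˣ) → Config n × List (Fin n × ℤˣ) →
      Config n × List (Fin n × ℤˣ) → Set (Drive n)) (hB : ∀ o₁ o₂ o₃, MeasurableSet (B o₁ o₂ o₃)) :
    MeasurableSet {ω | shift h (shift h (shift h ω)) ∈ B (outcome ψ h x ω)
        (outcome ψ h (outcome ψ h x ω).1 (shift h ω))
        (outcome ψ h (outcome ψ h (outcome ψ h x ω).1 (shift h ω)).1 (shift h (shift h ω)))} ∧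
      (driveLaw n).real {ω | shift h (shift h (shift h ω)) ∈ B (outcome ψ h x ω)
        (outcome ψ h (outcome ψ h x ω).1 (shift h ω))
        (outcome ψ h (outcome ψ h (outcome ψ h x ω).1 (shift h ω)).1 (shift h (shift h ω)))} =
        avg3 ψ h x fun o₁ o₂ o₃ => (driveLaw n).real (B o₁ o₂ o₃) := by
  have k3 := fun o₁ (o₂ : Config n × List (Fin n × ℤˣ)) =>
    driveLaw_restart ψ hh o₂.1 (B o₁ o₂) (hB o₁ o₂)
  have k2 := fun o₁ : Config n × List (Fin n × ℤˣ) => driveLaw_restart ψ hh o₁.1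
    (fun o₂ => {ω | shift h ω ∈ B o₁ o₂ (outcome ψ h o₂.1 ω)}) fun o₂ => (k3 o₁ o₂).1
  simp only [Set.mem_ofPred_eq] at k2
  have k1 := driveLaw_restart ψ hh x (fun o₁ => {ω | shift h (shift h ω) ∈
    B o₁ (outcome ψ h o₁.1 ω) (outcome ψ h (outcome ψ h o₁.1 ω).1 (shift h ω))}) fun o₁ => (k2 o₁).1
  simp only [Set.mem_ofPred_eq] at k1
  refine ⟨k1.1, k1.2.trans ?_⟩
  simp only [avg3, avg, (k2 _).2, (k3 _ _).2]

section Scan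

variable (ψ : Hamiltonian n) (i j : Fin n) (h : ℝ) (M r : ℕ) (Bad : Option ℝ → Prop)

/-- The probability that the result of the scan satisfies `Bad`. -/
def scanProb (left : ℕ) (σ : ScanState) (x : Config n) : ℝ :=
  (driveLaw n).real {ω | Bad (noiseScan ψ i j h M r left σ x ω)}

lemma scanProb_nonneg (left : ℕ) (σ : ScanState) (x : Config n) :
    0 ≤ scanProb ψ i j h M r Bad left σ x := measureReal_nonneg

lemma scanProb_le_one (left : ℕ) (σ : ScanState) (x : Config n) :
    scanProb ψ i j h M r Bad left σ x ≤ 1 := measureReal_le_one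

lemma abs_scanProb_le (left : ℕ) (σ : ScanState) (x : Config n) :
    |scanProb ψ i j h M r Bad left σ x| ≤ 1 :=
  abs_le_one_of_mem ⟨scanProb_nonneg .., scanProb_le_one ..⟩

lemma real_setOf_const (P : Prop) : (driveLaw n).real {_ω | P} = bool P := by
  by_cases hP : P
  · simp [hP, bool]
  · simp [hP, bool]

lemma scanProb_zero (σ : ScanState) (x : Config n) : scanProb ψ i j h M r Bad 0 σ x =
    bool (Bad (if M ≤ σ.s then some σ.sum else none)) := by
  rw [← real_setOf_const (n := n), scanProb]
  simp only [noiseScan]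

lemma scanProb_of_le {σ : ScanState} (hσ : M ≤ σ.s) (left : ℕ) (x : Config n) :
    scanProb ψ i j h M r Bad left σ x = bool (Bad (some σ.sum)) := by
  rw [← real_setOf_const (n := n), scanProb]
  cases left <;> simp [noiseScan, hσ]

variable {h}

lemma measurableSet_noiseScan (hh : 0 ≤ h) (left : ℕ) : ∀ (σ : ScanState) (x : Config n),
    MeasurableSet {ω | Bad (noiseScan ψ i j h M r left σ x ω)} := by
  induction left with
  | zero =>
    intro σ x
    simp only [noiseScan]
    exact MeasurableSet.const _
  | succ left ih =>
    intro σ x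
    by_cases hM : M ≤ σ.s
    · simp only [noiseScan, if_pos hM]
      exact MeasurableSet.const _
    · simp only [noiseScan, if_neg hM]
      have := (driveLaw_restart_three ψ hh x (fun o₁ o₂ o₃ =>
        {ω | Bad (noiseScan ψ i j h M r left (σ.advance r (blockStat i j o₁.2 o₂.2 o₃.2)) o₃.1 ω)})
        fun o₁ o₂ o₃ => ih _ _).1
      simpa only [Set.mem_ofPred_eq] using this

lemma scanProb_succ (hh : 0 ≤ h) (left : ℕ) {σ : ScanState} (hσ : σ.s < M) (x : Config n) :
    scanProb ψ i j h M r Bad (left + 1) σ x = avg3 ψ h x fun o₁ o₂ o₃ =>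
      scanProb ψ i j h M r Bad left (σ.advance r (blockStat i j o₁.2 o₂.2 o₃.2)) o₃.1 := by
  have := (driveLaw_restart_three ψ hh x (fun o₁ o₂ o₃ =>
    {ω | Bad (noiseScan ψ i j h M r left (σ.advance r (blockStat i j o₁.2 o₂.2 o₃.2)) o₃.1 ω)})
    fun o₁ o₂ o₃ => measurableSet_noiseScan ψ i j M r Bad hh left _ _).2
  simp only [Set.mem_ofPred_eq] at this
  rw [scanProb]
  simp only [noiseScan, if_neg hσ.not_ge]
  exact this

/-- The scan does not react to blocks inside the waiting time. -/
lemma scanProb_wait (hh : 0 ≤ h) (left b next s : ℕ) (sum : ℝ) (hs : s < M)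
    (hb : b + 1 < next + r) (x : Config n) :
    scanProb ψ i j h M r Bad (left + 1) ⟨b, next, s, sum⟩ x = avg3 ψ h x fun _ _ o₃ =>
      scanProb ψ i j h M r Bad left ⟨b + 1, next, s, sum⟩ o₃.1 := by
  rw [scanProb_succ ψ i j M r Bad hh left (σ := ⟨b, next, s, sum⟩) hs]
  congr 1
  funext o₁ o₂ o₃
  cases blockStat i j o₁.2 o₂.2 o₃.2
  · rfl
  · simp only [ScanState.advance, if_neg hb.not_ge]

lemma scanProb_active (hh : 0 ≤ h) (left b next s : ℕ) (sum : ℝ) (hs : s < M)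
    (hb : next + r ≤ b + 1) (x : Config n) :
    scanProb ψ i j h M r Bad (left + 1) ⟨b, next, s, sum⟩ x = avg3 ψ h x fun o₁ o₂ o₃ =>
      bool (Good i j o₁ o₂ o₃) * scanProb ψ i j h M r Bad left
          ⟨b + 1, b + 1, s + 1, sum + stat i o₁ o₃⟩ o₃.1 +
        bool (¬ Good i j o₁ o₂ o₃) *
          scanProb ψ i j h M r Bad left ⟨b + 1, next, s, sum⟩ o₃.1 := by
  rw [scanProb_succ ψ i j M r Bad hh left (σ := ⟨b, next, s, sum⟩) hs]
  congr 1
  funext o₁ o₂ o₃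
  have := blockStat_eq i j o₁ o₂ o₃
  by_cases hg : Good i j o₁ o₂ o₃
  · rw [this.1 hg, bool_of_true hg, bool_of_false (not_not.2 hg)]
    simp only [ScanState.advance, if_pos hb]
    ring
  · rw [this.2 hg, bool_of_false hg, bool_of_true hg]
    simp only [ScanState.advance]
    ring

end Scan

section Linear

variable (ψ : Hamiltonian n) {h : ℝ} (i j : Fin n)

lemma avg3_const (h : ℝ) (x : Config n) (c : ℝ) : avg3 ψ h x (fun _ _ _ => c) = c := by
  simp [avg3, avg]

lemma avg3_linear (hh : 0 ≤ h) (x : Config n) (c₀ c₁ c₂ : ℝ) :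
    avg3 ψ h x (fun o₁ o₂ o₃ => c₀ + c₁ * bool (Good i j o₁ o₂ o₃) +
      c₂ * (bool (Good i j o₁ o₂ o₃) * stat i o₁ o₃)) =
      c₀ + c₁ * goodProb h i j +
        c₂ * avg3 ψ h x fun o₁ o₂ o₃ => bool (Good i j o₁ o₂ o₃) * stat i o₁ o₃ := by
  have b0 : ∀ c P, |c * bool P| ≤ |c| := fun c P => by
    rw [abs_mul]
    exact mul_le_of_le_one_right (abs_nonneg _) (abs_bool_le _)
  rw [avg3_add ψ h x (C := |c₀| + |c₁|) (C' := |c₂| * 2)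
      (fun _ _ _ => (abs_add_le _ _).trans (add_le_add le_rfl (b0 _ _))) (fun _ _ _ => by
        rw [abs_mul]
        exact mul_le_mul_of_nonneg_left (abs_bool_mul_stat_le i _ _ _) (abs_nonneg _)),
    avg3_add ψ h x (C := |c₀|) (C' := |c₁|) (fun _ _ _ => le_rfl) (fun _ _ _ => b0 _ _),
    avg3_const, avg3_const_mul, avg3_const_mul, avg3_good ψ i j hh]

lemma abs_linear_le (c₀ c₁ c₂ : ℝ) (o₁ o₂ o₃ : Config n × List (Fin n × ℤˣ)) :
    |c₀ + c₁ * bool (Good i j o₁ o₂ o₃) + c₂ * (bool (Good i j o₁ o₂ o₃) * stat i o₁ o₃)| ≤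
      |c₀| + |c₁| + |c₂| * 2 := by
  refine (abs_add_le _ _).trans (add_le_add ((abs_add_le _ _).trans (add_le_add le_rfl ?_)) ?_)
  · rw [abs_mul]
    exact mul_le_of_le_one_right (abs_nonneg _) (abs_bool_le _)
  · rw [abs_mul]
    exact mul_le_mul_of_nonneg_left (abs_bool_mul_stat_le i _ _ _) (abs_nonneg _)

end Linear

/-! ### Too few stopping times -/

section Failure

variable (ψ : Hamiltonian n) {h : ℝ} (i j : Fin n) (M r : ℕ)

lemma abs_active_le (Bad : Option ℝ → Prop) (left : ℕ)
    (σ σ' : ScanState) (P : Prop) (x y : Config n) :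
    |bool P * scanProb ψ i j h M r Bad left σ x +
      bool (¬ P) * scanProb ψ i j h M r Bad left σ' y| ≤ 1 := by
  by_cases hP : P
  · rw [bool_of_true hP, bool_of_false (not_not.2 hP), one_mul, zero_mul, add_zero]
    exact abs_scanProb_le ..
  · rw [bool_of_false hP, bool_of_true hP, one_mul, zero_mul, zero_add]
    exact abs_scanProb_le ..

/-- The probability that the scan does not find enough stopping times. -/
lemma scanProb_none_le (hh : 0 ≤ h) {q : ℝ} (hq0 : 0 ≤ q) (hq : q ≤ goodProb h i j) (left : ℕ) :
    ∀ (b next s : ℕ) (sum : ℝ) (x : Config n), s < M →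
    scanProb ψ i j h M r (fun o => o = none) left ⟨b, next, s, sum⟩ x ≤
      2 ^ (M - s) * (1 - q / 2) ^ (left - ((next + r - 1 - b) + (M - s - 1) * (r - 1))) := by
  have hq1 : q ≤ 1 := hq.trans (goodProb_le_one h i j)
  have y0 : 0 ≤ 1 - q / 2 := by linarith
  have y1 : 1 - q / 2 ≤ 1 := by linarith
  -- The exponent counts the remaining blocks minus those that waiting can consume: the rest of the
  -- current waiting period, and `r - 1` blocks after each stopping time except the last one needed.
  -- Every missing stopping time carries a weight `2`, so an active block shrinks the expected bound
  -- by `(1 - p) + p / 2 ≤ 1 - q / 2`, where `p = goodProb h i j`.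
  induction left with
  | zero =>
    intro b next s sum x hs
    rw [Nat.zero_sub, pow_zero, mul_one]
    exact (scanProb_le_one ..).trans (one_le_pow₀ one_le_two)
  | succ left ih =>
    intro b next s sum x hs
    by_cases hleft : left + 1 ≤ (next + r - 1 - b) + (M - s - 1) * (r - 1)
    · rw [Nat.sub_eq_zero_of_le hleft, pow_zero, mul_one]
      exact (scanProb_le_one ..).trans (one_le_pow₀ one_le_two)
    push Not at hleft
    by_cases hb : next + r ≤ b + 1
    · rw [scanProb_active ψ i j M r _ hh left b next s sum hs hb]
      have e0 : next + r - 1 - b = 0 := by omega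
      rw [e0, zero_add] at hleft ⊢
      set W := (M - s - 1) * (r - 1) with hW
      set P := 2 ^ (M - s - 1) * (1 - q / 2) ^ (left - W) with hP
      have hP0 : 0 ≤ P := by positivity
      have e1 : (2 : ℝ) ^ (M - s) = 2 * 2 ^ (M - s - 1) := by
        rw [← pow_succ']
        congr 1
        omega
      have hsucc : ∀ (z : ℝ) (y : Config n), scanProb ψ i j h M r (fun o => o = none) left
          ⟨b + 1, b + 1, s + 1, z⟩ y ≤ P := by
        intro z y
        by_cases hs1 : s + 1 < M
        · refine (ih (b + 1) (b + 1) (s + 1) z y hs1).trans (le_of_eq ?_)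
          rw [hP, show M - (s + 1) = M - s - 1 by omega]
          congr 3
          rw [hW, show M - s - 1 = (M - s - 1 - 1) + 1 by omega, Nat.add_sub_cancel, Nat.succ_mul]
          omega
        · rw [scanProb_of_le ψ i j h M r _ (σ := ⟨b + 1, b + 1, s + 1, z⟩) (by simp; omega)]
          rw [bool_of_false (by simp)]
          exact hP0
      have hstay : ∀ y : Config n, scanProb ψ i j h M r (fun o => o = none) left
          ⟨b + 1, next, s, sum⟩ y ≤ 2 * P := by
        intro y
        refine (ih (b + 1) next s sum y hs).trans (le_of_eq ?_)
        rw [show next + r - 1 - (b + 1) = 0 by omega, zero_add, hP, e1]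
        ring
      calc _ ≤ avg3 ψ h x (fun o₁ o₂ o₃ => 2 * P + (-P) * bool (Good i j o₁ o₂ o₃) +
            0 * (bool (Good i j o₁ o₂ o₃) * stat i o₁ o₃)) := by
            refine avg3_mono ψ h x (fun _ _ _ => abs_active_le ..)
              (fun _ _ _ => abs_linear_le i j _ _ _ _ _ _) fun o₁ o₂ o₃ => ?_
            by_cases hg : Good i j o₁ o₂ o₃
            · rw [bool_of_true hg, bool_of_false (not_not.2 hg)]
              linarith [hsucc (sum + stat i o₁ o₃) o₃.1]
            · rw [bool_of_false hg, bool_of_true hg]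
              linarith [hstay o₃.1]
        _ = P * (2 - goodProb h i j) := by
            rw [avg3_linear ψ i j hh]
            ring
        _ ≤ P * (2 - q) := mul_le_mul_of_nonneg_left (by linarith) hP0
        _ = _ := by
            rw [e1, hP, show left + 1 - W = (left - W) + 1 by omega, pow_succ]
            ring
    · push Not at hb
      rw [scanProb_wait ψ i j M r _ hh left b next s sum hs hb]
      rw [← avg3_const ψ h x (2 ^ (M - s) * (1 - q / 2) ^ _)]
      refine avg3_mono ψ h x (fun _ _ _ => abs_scanProb_le ..) (fun _ _ _ => le_rfl)
        fun o₁ o₂ o₃ => (ih (b + 1) next s sum o₃.1 hs).trans (le_of_eq ?_)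
      congr 2
      omega

end Failure

lemma exp_le_quadratic {y : ℝ} (hy : |y| ≤ 1) : Real.exp y ≤ 1 + y + y ^ 2 := by
  have := Real.abs_exp_sub_one_sub_id_le hy
  linarith [(abs_le.1 this).2]

/-! ### Exponential moments for non-adjacent pairs -/

section FalsePositive

variable (ψ : Hamiltonian n) {h : ℝ} (i j : Fin n) (M r : ℕ)

/-- The probability that the sum of the statistics is large although its expectation is small. -/
lemma scanProb_upper_le (hh : 0 ≤ h) {θ ε κ : ℝ} (hθ : 0 ≤ θ) (hθ' : 2 * θ ≤ 1) (hε : 0 ≤ ε)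
    (hstat : ∀ x, avg3 ψ h x (fun o₁ o₂ o₃ => bool (Good i j o₁ o₂ o₃) * stat i o₁ o₃) ≤
      goodProb h i j * ε) (left : ℕ) :
    ∀ (b next s : ℕ) (sum : ℝ) (x : Config n), s ≤ M →
    scanProb ψ i j h M r (fun o => ∃ z, o = some z ∧ κ ≤ z) left ⟨b, next, s, sum⟩ x ≤
      Real.exp (θ * (sum - κ)) * Real.exp (θ * ε + 4 * θ ^ 2) ^ (M - s) := by
  -- By `e^y ≤ 1 + y + y²` for `|y| ≤ 1` and `|Z| ≤ 2`, the number `g` dominates the mean of `e^{θ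
  -- Z}` given a good block. Other blocks leave the bound unchanged, so only one factor per stopping
  -- time appears, however long the scan is.
  set g := Real.exp (θ * ε + 4 * θ ^ 2) with hg
  have hg1 : 1 ≤ g := Real.one_le_exp (by positivity)
  have hfin : ∀ (left b next s : ℕ) (sum : ℝ) (x : Config n), M ≤ s →
      scanProb ψ i j h M r (fun o => ∃ z, o = some z ∧ κ ≤ z) left ⟨b, next, s, sum⟩ x ≤
      Real.exp (θ * (sum - κ)) := by
    intro left b next s sum x hs
    rw [scanProb_of_le ψ i j h M r _ (σ := ⟨b, next, s, sum⟩) hs]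
    by_cases hz : κ ≤ sum
    · exact (bool_le_one _).trans (Real.one_le_exp (mul_nonneg hθ (by linarith)))
    · rw [bool_of_false (by simpa using hz)]
      positivity
  induction left with
  | zero =>
    intro b next s sum x hs
    rcases hs.lt_or_eq with hs | hs
    · rw [scanProb_zero, bool_of_false (by simp [hs.not_ge])]
      positivity
    · rw [hs, Nat.sub_self, pow_zero, mul_one]
      exact hfin _ _ _ _ _ _ le_rfl
  | succ left ih =>
    intro b next s sum x hs
    rcases hs.lt_or_eq with hs | hs
    swap
    · rw [hs, Nat.sub_self, pow_zero, mul_one]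
      exact hfin _ _ _ _ _ _ le_rfl
    set K := Real.exp (θ * (sum - κ)) with hK
    have hK0 : 0 < K := Real.exp_pos _
    by_cases hb : next + r ≤ b + 1
    · rw [scanProb_active ψ i j M r _ hh left b next s sum hs hb]
      set P := g ^ (M - s - 1) with hP
      have hP0 : 0 < P := by positivity
      have e1 : g ^ (M - s) = P * g := by
        rw [hP, ← pow_succ]
        congr 1
        omega
      calc _ ≤ avg3 ψ h x (fun o₁ o₂ o₃ => K * P * g +
            (K * P * (1 + 4 * θ ^ 2 - g)) * bool (Good i j o₁ o₂ o₃) +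
            (K * P * θ) * (bool (Good i j o₁ o₂ o₃) * stat i o₁ o₃)) := by
            refine avg3_mono ψ h x (fun _ _ _ => abs_active_le ..)
              (fun _ _ _ => abs_linear_le i j _ _ _ _ _ _) fun o₁ o₂ o₃ => ?_
            by_cases hgd : Good i j o₁ o₂ o₃
            · rw [bool_of_true hgd, bool_of_false (not_not.2 hgd)]
              have h1 := ih (b + 1) (b + 1) (s + 1) (sum + stat i o₁ o₃) o₃.1 hs
              have h2 := abs_stat_le i o₁ o₃
              have h3 : Real.exp (θ * stat i o₁ o₃) ≤ 1 + θ * stat i o₁ o₃ + 4 * θ ^ 2 := by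
                have h4 : (θ * stat i o₁ o₃) ^ 2 ≤ 4 * θ ^ 2 := by
                  have := pow_le_pow_left₀ (abs_nonneg _) h2 2
                  rw [sq_abs] at this
                  rw [mul_pow]
                  linarith [mul_le_mul_of_nonneg_left this (sq_nonneg θ)]
                have := exp_le_quadratic (y := θ * stat i o₁ o₃) (by
                  rw [abs_mul, abs_of_nonneg hθ]
                  linarith [mul_le_mul_of_nonneg_left h2 hθ])
                linarith
              rw [show θ * (sum + stat i o₁ o₃ - κ) = θ * (sum - κ) + θ * stat i o₁ o₃ by ring,
                Real.exp_add, ← hK, show M - (s + 1) = M - s - 1 by omega, ← hP] at h1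
              have h5 := mul_le_mul_of_nonneg_left h3 (mul_pos hK0 hP0).le
              rw [mul_right_comm] at h1
              linarith
            · rw [bool_of_false hgd, bool_of_true hgd]
              have h1 := ih (b + 1) next s sum o₃.1 hs.le
              rw [e1] at h1
              linarith
        _ = K * P * (g + (1 + 4 * θ ^ 2 - g) * goodProb h i j + θ * avg3 ψ h x fun o₁ o₂ o₃ =>
              bool (Good i j o₁ o₂ o₃) * stat i o₁ o₃) := by
            rw [avg3_linear ψ i j hh]
            ring
        _ ≤ K * P * g := by
            refine mul_le_mul_of_nonneg_left ?_ (mul_pos hK0 hP0).le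
            have h1 := mul_le_mul_of_nonneg_left (hstat x) hθ
            have h2 : θ * ε + 4 * θ ^ 2 + 1 ≤ g := Real.add_one_le_exp _
            nlinarith [goodProb_nonneg h i j]
        _ = _ := by rw [e1, mul_assoc]
    · push Not at hb
      rw [scanProb_wait ψ i j M r _ hh left b next s sum hs hb]
      rw [← avg3_const ψ h x (K * g ^ (M - s))]
      exact avg3_mono ψ h x (fun _ _ _ => abs_scanProb_le ..) (fun _ _ _ => le_rfl)
        fun o₁ o₂ o₃ => ih (b + 1) next s sum o₃.1 hs.le

end FalsePositive

/-! ## Potentials for the burn-in -/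

/-- The growth that a potential is guaranteed to have in one time step. -/
def relax (β : ℝ) (Ψ : ℕ → Config n → ℝ) (l : ℕ) (x : Config n) : ℝ :=
  (1 - β) * Ψ l x + β * Ψ (l + 1) x

/-- Nonnegative functions that grow at least as described by `relax` in one step of the dynamics,
whatever the update counts of `i` and `j` are. -/
structure Admissible (ψ : Hamiltonian n) (h : ℝ) (i j : Fin n) (β : ℝ)
    (Ψ : ℕ → Config n → ℝ) : Prop where
  nonneg : ∀ l x, 0 ≤ Ψ l x
  step : ∀ (G : Set (ℕ × ℕ)) l x, patProb h i j G * relax β Ψ l x ≤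
    avg ψ h x fun o => bool (Pattern i j G (traceSites o)) * Ψ l o.1

lemma exists_abs_le (f : Config n → ℝ) : ∃ C, ∀ x, |f x| ≤ C :=
  ⟨∑ x, |f x|, fun x => Finset.single_le_sum (f := fun x => |f x|) (fun _ _ => abs_nonneg _)
    (Finset.mem_univ x)⟩

lemma abs_bool_mul_le (P : Prop) {a C : ℝ} (h : |a| ≤ C) : |bool P * a| ≤ C := by
  rw [abs_mul]
  exact (mul_le_of_le_one_left (abs_nonneg _) (abs_bool_le P)).trans h

namespace Admissible

variable {ψ : Hamiltonian n} {h : ℝ} {i j : Fin n} {β : ℝ} {Ψ Φ : ℕ → Config n → ℝ}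

lemma zero : Admissible ψ h i j β fun _ _ => 0 where
  nonneg _ _ := le_rfl
  step G l x := by simp [GlauberMRF.relax, avg]

lemma avg_combine (x : Config n) (P : List (Fin n) → Prop) (a b : ℝ) (f g : Config n → ℝ) :
    avg ψ h x (fun o => bool (P (traceSites o)) * (a * f o.1 + b * g o.1)) =
      a * avg ψ h x (fun o => bool (P (traceSites o)) * f o.1) +
        b * avg ψ h x (fun o => bool (P (traceSites o)) * g o.1) := by
  obtain ⟨C, hC⟩ := exists_abs_le fun x => a * f x
  obtain ⟨D, hD⟩ := exists_abs_le fun x => b * g x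
  rw [← avg_const_mul, ← avg_const_mul, ← avg_add ψ h x (C := C) (C' := D)]
  · congr 1
    funext o
    ring
  · intro o
    rw [mul_left_comm]
    exact abs_bool_mul_le _ (hC _)
  · intro o
    rw [mul_left_comm]
    exact abs_bool_mul_le _ (hD _)

lemma combine (hΨ : Admissible ψ h i j β Ψ) (hΦ : Admissible ψ h i j β Φ) {a b : ℝ} (ha : 0 ≤ a)
    (hb : 0 ≤ b) : Admissible ψ h i j β fun l x => a * Ψ l x + b * Φ l x where
  nonneg l x := add_nonneg (mul_nonneg ha (hΨ.nonneg l x)) (mul_nonneg hb (hΦ.nonneg l x))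
  step G l x := by
    rw [avg_combine]
    have h1 := mul_le_mul_of_nonneg_left (hΨ.step G l x) ha
    have h2 := mul_le_mul_of_nonneg_left (hΦ.step G l x) hb
    have e : GlauberMRF.relax β (fun l x => a * Ψ l x + b * Φ l x) l x =
        a * GlauberMRF.relax β Ψ l x + b * GlauberMRF.relax β Φ l x := by
      simp only [GlauberMRF.relax]
      ring
    rw [e]
    linarith

/-- `relax` mixes neighbouring levels with constant nonnegative weights and hence commutes with
averaging over the dynamics. This permits iterating the one-step guarantee. -/
lemma relax (hΨ : Admissible ψ h i j β Ψ) (h0 : 0 ≤ β) (h1 : β ≤ 1) :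
    Admissible ψ h i j β (GlauberMRF.relax β Ψ) where
  nonneg l x := add_nonneg (mul_nonneg (by linarith) (hΨ.nonneg _ _))
    (mul_nonneg h0 (hΨ.nonneg _ _))
  step G l x := by
    simp only [GlauberMRF.relax, avg_combine]
    have e1 := mul_le_mul_of_nonneg_left (hΨ.step G l x) (by linarith : 0 ≤ 1 - β)
    have e2 := mul_le_mul_of_nonneg_left (hΨ.step G (l + 1) x) h0
    simp only [GlauberMRF.relax] at e1 e2
    linarith

/-- Three steps of the dynamics. -/
lemma step_three (hΨ : Admissible ψ h i j β Ψ) (h0 : 0 ≤ β) (h1 : β ≤ 1) (G₁ G₂ G₃ : Set (ℕ × ℕ))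
    (l : ℕ) (x : Config n) :
    patProb h i j G₁ * patProb h i j G₂ * patProb h i j G₃ *
        GlauberMRF.relax β (GlauberMRF.relax β (GlauberMRF.relax β Ψ)) l x ≤
      avg3 ψ h x fun o₁ o₂ o₃ => bool (Pattern i j G₁ (traceSites o₁)) *
        bool (Pattern i j G₂ (traceSites o₂)) * bool (Pattern i j G₃ (traceSites o₃)) *
          Ψ l o₃.1 := by
  have hΨ1 := hΨ.relax h0 h1
  have hΨ2 := hΨ1.relax h0 h1
  obtain ⟨C, hC⟩ := exists_abs_le (Ψ l)
  obtain ⟨C1, hC1⟩ := exists_abs_le fun x => patProb h i j G₃ * GlauberMRF.relax β Ψ l x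
  obtain ⟨C2, hC2⟩ := exists_abs_le fun x => patProb h i j G₃ *
    (patProb h i j G₂ * GlauberMRF.relax β (GlauberMRF.relax β Ψ) l x)
  have s3 := mul_le_mul_of_nonneg_left (hΨ2.step G₁ l x)
    (mul_nonneg (patProb_nonneg h i j G₃) (patProb_nonneg h i j G₂))
  rw [← avg_const_mul] at s3
  simp only [avg3, mul_assoc]
  refine le_trans (le_of_eq_of_le (by ring) s3) ?_
  refine avg_mono ψ h x (C := C2) (C' := C) (fun o => ?_) (fun o => abs_avg_le ψ h _ fun _ =>
    abs_avg_le ψ h _ fun _ => abs_bool_mul_le _ (abs_bool_mul_le _ (abs_bool_mul_le _ (hC _))))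
    fun o₁ => ?_
  · rw [show ∀ a b c d : ℝ, a * b * (c * d) = c * (a * (b * d)) from fun a b c d => by ring]
    exact abs_bool_mul_le _ (hC2 _)
  simp only [avg_const_mul]
  rw [show ∀ a b c d : ℝ, a * b * (c * d) = c * (a * (b * d)) from fun a b c d => by ring]
  refine mul_le_mul_of_nonneg_left ?_ (bool_nonneg _)
  have s2 := mul_le_mul_of_nonneg_left (hΨ1.step G₂ l o₁.1) (patProb_nonneg h i j G₃)
  rw [← avg_const_mul] at s2
  refine s2.trans (avg_mono ψ h _ (C := C1) (C' := C) (fun o => ?_) (fun o =>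
    abs_bool_mul_le _ (abs_avg_le ψ h _ fun _ => abs_bool_mul_le _ (hC _))) fun o₂ => ?_)
  · rw [mul_left_comm]
    exact abs_bool_mul_le _ (hC1 _)
  rw [mul_left_comm]
  exact mul_le_mul_of_nonneg_left (hΨ.step G₃ l o₂.1) (bool_nonneg _)

lemma step_univ (hΨ : Admissible ψ h i j β Ψ) (h0 : 0 ≤ β) (h1 : β ≤ 1) (l : ℕ) (x : Config n) :
    GlauberMRF.relax β (GlauberMRF.relax β (GlauberMRF.relax β Ψ)) l x ≤
      avg3 ψ h x fun _ _ o₃ => Ψ l o₃.1 := by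
  have := hΨ.step_three h0 h1 Set.univ Set.univ Set.univ l x
  simpa [patProb_univ, Pattern, bool] using this

/-- Three steps of the dynamics, when the statistic of the block is not defined. -/
lemma step_not_good (hΨ : Admissible ψ h i j β Ψ) (h0 : 0 ≤ β) (h1 : β ≤ 1) (l : ℕ)
    (x : Config n) :
    (1 - goodProb h i j) *
        GlauberMRF.relax β (GlauberMRF.relax β (GlauberMRF.relax β Ψ)) l x ≤
      avg3 ψ h x fun o₁ o₂ o₃ => bool (¬ Good i j o₁ o₂ o₃) * Ψ l o₃.1 := by
  obtain ⟨C, hC⟩ := exists_abs_le (Ψ l)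
  -- The complement of `Good` is split according to the first third whose pattern fails; the thirds
  -- after it are unrestricted.
  have s1 := hΨ.step_three h0 h1 outerPatᶜ Set.univ Set.univ l x
  have s2 := hΨ.step_three h0 h1 outerPat middlePatᶜ Set.univ l x
  have s3 := hΨ.step_three h0 h1 outerPat middlePat outerPatᶜ l x
  have hb : ∀ (P Q R : Prop) (y : Config n), |bool P * bool Q * bool R * Ψ l y| ≤ C :=
    fun P Q R y => by
      rw [mul_assoc, mul_assoc]
      exact abs_bool_mul_le _ (abs_bool_mul_le _ (abs_bool_mul_le _ (hC _)))
  have e : ∀ o₁ o₂ o₃ : Config n × List (Fin n × ℤˣ),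
      bool (¬ Good i j o₁ o₂ o₃) * Ψ l o₃.1 =
      (bool (Pattern i j outerPatᶜ (traceSites o₁)) *
        bool (Pattern i j Set.univ (traceSites o₂)) * bool (Pattern i j Set.univ (traceSites o₃)) *
          Ψ l o₃.1 + bool (Pattern i j outerPat (traceSites o₁)) *
        bool (Pattern i j middlePatᶜ (traceSites o₂)) *
          bool (Pattern i j Set.univ (traceSites o₃)) * Ψ l o₃.1) +
        bool (Pattern i j outerPat (traceSites o₁)) *
        bool (Pattern i j middlePat (traceSites o₂)) *
          bool (Pattern i j outerPatᶜ (traceSites o₃)) * Ψ l o₃.1 := by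
    intro o₁ o₂ o₃
    have hc : ∀ (G : Set (ℕ × ℕ)) (l : List (Fin n)),
        bool (Pattern i j Gᶜ l) = 1 - bool (Pattern i j G l) := fun G l => bool_not _
    have hu : ∀ l : List (Fin n), bool (Pattern i j Set.univ l) = 1 := fun l =>
      bool_of_true (Set.mem_univ _)
    rw [bool_not, bool_good_eq, hc, hc, hc, hu, hu]
    ring
  simp only [e]
  rw [avg3_add ψ h x (fun _ _ _ => (abs_add_le _ _).trans (add_le_add (hb _ _ _ _) (hb _ _ _ _)))
    (fun _ _ _ => hb _ _ _ _), avg3_add ψ h x (fun _ _ _ => hb _ _ _ _) (fun _ _ _ => hb _ _ _ _)]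
  refine le_trans (le_of_eq ?_) (add_le_add (add_le_add s1 s2) s3)
  rw [patProb_compl, patProb_compl, patProb_univ, goodProb]
  ring

end Admissible

/-- The guaranteed size of a potential. -/
def Above (c : ℝ) (m : ℕ) (y : ℝ) (Ψ : ℕ → Config n → ℝ) : Prop :=
  ∀ l x, c * (1 - ((m - l : ℕ) : ℝ) * y) ≤ Ψ l x

/-- For `l < m` the deficit `m - l` turns into `(m - l) - β`, which is at most `(1 - η) (m - l)`
because `(m - l) η ≤ m η ≤ β`. From level `m` on there is no deficit and the guarantee `c` persists.
-/
lemma Above.relax {c : ℝ} (hc : 0 ≤ c) {m : ℕ} {y β η : ℝ} (hy : 0 ≤ y)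
    (hβ0 : 0 ≤ β) (hβ1 : β ≤ 1) (hβ : m * η ≤ β) {Ψ : ℕ → Config n → ℝ} (hΨ : Above c m y Ψ) :
    Above c m ((1 - η) * y) (relax β Ψ) := by
  intro l x
  have h1 := hΨ l x
  have h2 := hΨ (l + 1) x
  unfold GlauberMRF.relax
  by_cases hl : l < m
  · have e : ((m - l : ℕ) : ℝ) = ((m - (l + 1) : ℕ) : ℝ) + 1 := by
      rw [show m - l = m - (l + 1) + 1 by omega]
      push_cast
      ring
    have h3 : ((m - l : ℕ) : ℝ) * η ≤ β := by
      rcases le_or_gt 0 η with hη | hη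
      · refine le_trans (mul_le_mul_of_nonneg_right ?_ hη) hβ
        exact_mod_cast Nat.sub_le m l
      · exact (mul_nonpos_of_nonneg_of_nonpos (Nat.cast_nonneg _) hη.le).trans hβ0
    have h4 : c * (1 - ((m - l : ℕ) : ℝ) * ((1 - η) * y)) ≤
        (1 - β) * (c * (1 - ((m - l : ℕ) : ℝ) * y)) +
          β * (c * (1 - ((m - (l + 1) : ℕ) : ℝ) * y)) := by
      have h5 := mul_le_mul_of_nonneg_right h3 (mul_nonneg hc hy)
      have e' : ((m - (l + 1) : ℕ) : ℝ) = ((m - l : ℕ) : ℝ) - 1 := by linarith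
      rw [e']
      linarith
    have h6 := mul_le_mul_of_nonneg_left h1 (by linarith : 0 ≤ 1 - β)
    have h7 := mul_le_mul_of_nonneg_left h2 hβ0
    linarith
  · rw [show m - l = 0 by omega] at h1 ⊢
    rw [show m - (l + 1) = 0 by omega] at h2
    simp only [Nat.cast_zero, zero_mul, sub_zero, mul_one] at h1 h2 ⊢
    have h6 := mul_le_mul_of_nonneg_left h1 (by linarith : 0 ≤ 1 - β)
    have h7 := mul_le_mul_of_nonneg_left h2 hβ0
    linarith

/-! ### Exponential moments for adjacent pairs -/

section FalseNegative

variable (ψ : Hamiltonian n) {h : ℝ} (i j : Fin n) (M r : ℕ)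

/-- The value function of the scan, when small sums are bad. -/
lemma exists_potential (hh : 0 ≤ h) {θ ε κ β A B c γ : ℝ} {m : ℕ} {g : ℕ → Config n → ℝ}
    (hθ : 0 ≤ θ) (hθ' : 2 * θ ≤ 1) (hβ0 : 0 ≤ β) (hβ1 : β ≤ 1)
    (hβ : m * (1 - Real.exp (-h)) ≤ β) (hA : A = 1 + 2 * ε * θ + 4 * θ ^ 2)
    (hB : 0 ≤ B) (hc : 0 ≤ c) (hγ : 0 ≤ γ)
    (hcontr : A - θ * B * (c * (1 - m * (Real.exp (-h) ^ 3) ^ (r - 1))) ≤ γ)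
    (hg : Admissible ψ h i j β g) (hgc : Above c m 1 g)
    (hstat : ∀ x, goodProb h i j * (B * g 0 x - 2 * ε) ≤
      avg3 ψ h x fun o₁ o₂ o₃ => bool (Good i j o₁ o₂ o₃) * stat i o₁ o₃) (left : ℕ) :
    ∀ (b next s : ℕ) (sum : ℝ), s < M → ∃ (R : ℝ) (Ψ : ℕ → Config n → ℝ), 0 ≤ R ∧ R ≤ 1 ∧
      Admissible ψ h i j β Ψ ∧ Above (R * c) m ((Real.exp (-h) ^ 3) ^ (next + r - 1 - b)) Ψ ∧
      ∀ x, scanProb ψ i j h M r (fun o => ∃ z, o = some z ∧ z < κ) left ⟨b, next, s, sum⟩ x ≤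
        Real.exp (θ * (κ - sum)) * γ ^ (M - s - 1) * (A * R - θ * B * Ψ 0 x) := by
  set ρ := Real.exp (-h) with hρ
  have hρ0 : 0 < ρ := Real.exp_pos _
  have hfin : ∀ (left b next s : ℕ) (sum : ℝ) (x : Config n), M ≤ s →
      scanProb ψ i j h M r (fun o => ∃ z, o = some z ∧ z < κ) left ⟨b, next, s, sum⟩ x ≤
      Real.exp (θ * (κ - sum)) := by
    intro left b next s sum x hs
    rw [scanProb_of_le ψ i j h M r _ (σ := ⟨b, next, s, sum⟩) hs]
    by_cases hz : sum < κ
    · exact (bool_le_one _).trans (Real.one_le_exp (mul_nonneg hθ (by linarith)))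
    · rw [bool_of_false (by simpa using hz)]
      positivity
  have hrelax : ∀ {R : ℝ} {Ψ : ℕ → Config n → ℝ} {y : ℝ}, 0 ≤ R → 0 ≤ y → Above (R * c) m y Ψ →
      Above (R * c) m (ρ ^ 3 * y) (relax β (relax β (relax β Ψ))) := by
    intro R Ψ y hR hy hΨ
    have hβ' : m * (1 - ρ) ≤ β := hβ
    have hRc := mul_nonneg hR hc
    have h1 := ((hΨ.relax hRc hy hβ0 hβ1 hβ').relax hRc (by
      have : (1 - (1 - ρ)) = ρ := by ring
      rw [this]
      positivity) hβ0 hβ1 hβ').relax hRc (by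
      have : (1 - (1 - ρ)) = ρ := by ring
      rw [this]
      positivity) hβ0 hβ1 hβ'
    convert h1 using 1
    ring
  -- The invariant: `R` is the probability of a further stopping time in the remaining blocks, and
  -- `Ψ 0 x` bounds from below the mean, on that event, of `g 0` at the start of its block. The
  -- factor `A * R - θ * B * Ψ 0 x` accounts for the next stopping time, and each later one
  -- contributes a factor `γ`.
  induction left with
  | zero =>
    intro b next s sum hs
    refine ⟨0, fun _ _ => 0, le_rfl, zero_le_one, Admissible.zero, fun l x => by simp, fun x => ?_⟩
    rw [scanProb_zero, bool_of_false (by simp [hs.not_ge])]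
    simp
  | succ left ih =>
    intro b next s sum hs
    obtain ⟨R, Ψ, hR0, hR1, hΨ, habove, hbd⟩ := ih (b + 1) next s sum hs
    set K := Real.exp (θ * (κ - sum)) with hK
    set P := γ ^ (M - s - 1) with hP
    have hKP : 0 ≤ K * P := by positivity
    have hθB : 0 ≤ θ * B := mul_nonneg hθ hB
    obtain ⟨D, hD⟩ := exists_abs_le (Ψ 0)
    by_cases hb : next + r ≤ b + 1
    · set p := goodProb h i j with hp
      have hp0 : 0 ≤ p := goodProb_nonneg h i j
      have hp1 : p ≤ 1 := goodProb_le_one h i j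
      have e0 : next + r - 1 - b = 0 := by omega
      have e0' : next + r - 1 - (b + 1) = 0 := by omega
      rw [e0'] at habove
      rw [e0]
      have hnn := ((hΨ.relax hβ0 hβ1).relax hβ0 hβ1).relax hβ0 hβ1
      -- With probability `p` the present block provides the stopping time, and `g` is evaluated at
      -- its start; otherwise the earlier potential is carried through three thirds under the
      -- conditioning that the block is not good.
      refine ⟨p + (1 - p) * R, fun l x => p * g l x + (1 - p) * relax β (relax β (relax β Ψ)) l x,
        by nlinarith, by nlinarith, hg.combine hnn hp0 (by linarith), fun l x => ?_, fun x => ?_⟩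
      · have h2 := hrelax hR0 (by positivity) habove l x
        have h1 := hgc l x
        rw [pow_zero, mul_one] at h2 ⊢
        -- The exponent of the decay is `0` here, so below level `m` the required lower bound is
        -- nonpositive and only the levels from `m` on carry information.
        by_cases hl : l < m
        · have hle : (1 : ℝ) ≤ ((m - l : ℕ) : ℝ) := by exact_mod_cast (by omega : 1 ≤ m - l)
          have h3 : (p + (1 - p) * R) * c * (1 - ((m - l : ℕ) : ℝ)) ≤ 0 :=
            mul_nonpos_of_nonneg_of_nonpos (mul_nonneg (by nlinarith) hc) (by linarith)
          exact h3.trans (add_nonneg (mul_nonneg hp0 (hg.nonneg _ _))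
            (mul_nonneg (by linarith) (hnn.nonneg _ _)))
        · rw [show m - l = 0 by omega] at h1 h2 ⊢
          simp only [Nat.cast_zero, zero_mul, sub_zero, mul_one] at h1 h2 ⊢
          have h6 := mul_le_mul_of_nonneg_left h2 (by linarith : 0 ≤ 1 - p)
          have h7 := mul_le_mul_of_nonneg_left h1 hp0
          linarith
      · rw [scanProb_active ψ i j M r _ hh left b next s sum hs hb]
        have hsucc : ∀ (z : ℝ) (y : Config n), scanProb ψ i j h M r
            (fun o => ∃ z, o = some z ∧ z < κ) left ⟨b + 1, b + 1, s + 1, sum + z⟩ y ≤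
            K * P * Real.exp (-θ * z) := by
          intro z y
          have eK : Real.exp (θ * (κ - (sum + z))) = K * Real.exp (-θ * z) := by
            rw [hK, ← Real.exp_add]
            congr 1
            ring
          by_cases hs1 : s + 1 < M
          · obtain ⟨R', Ψ', hR0', hR1', hΨ', habove', hbd'⟩ :=
              ih (b + 1) (b + 1) (s + 1) (sum + z) hs1
            refine (hbd' y).trans ?_
            have h1 := habove' 0 y
            rw [show b + 1 + r - 1 - (b + 1) = r - 1 by omega, Nat.sub_zero] at h1
            -- After a stopping time in block `b`, the `r - 1` blocks following it are skipped;
            -- `hcontr` is the resulting burn-in bound, and the last block of the window is used for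
            -- the statistic.
            have h2 : A * R' - θ * B * Ψ' 0 y ≤ γ := by
              have h3 := mul_le_mul_of_nonneg_left h1 hθB
              have h4 := mul_le_mul_of_nonneg_left hcontr hR0'
              have h5 := mul_le_of_le_one_left hγ hR1'
              linarith
            rw [eK, show M - (s + 1) - 1 = M - s - 1 - 1 by omega]
            calc _ ≤ K * Real.exp (-θ * z) * γ ^ (M - s - 1 - 1) * γ :=
                  mul_le_mul_of_nonneg_left h2 (by positivity)
              _ = K * γ ^ (M - s - 1 - 1 + 1) * Real.exp (-θ * z) := by
                  rw [pow_succ]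
                  ring
              _ = _ := by rw [hP, show M - s - 1 - 1 + 1 = M - s - 1 by omega]
          · refine (hfin _ _ _ _ _ _ (by omega)).trans (le_of_eq ?_)
            rw [eK, hP, show M - s - 1 = 0 by omega, pow_zero]
            ring
        have hbdF : ∀ o₁ o₂ o₃ : Config n × List (Fin n × ℤˣ),
            |K * P * θ * B * (bool (¬ Good i j o₁ o₂ o₃) * Ψ 0 o₃.1)| ≤ |K * P * θ * B| * D :=
          fun o₁ o₂ o₃ => by
            rw [abs_mul]
            exact mul_le_mul_of_nonneg_left (abs_bool_mul_le _ (hD _)) (abs_nonneg _)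
        calc _ ≤ avg3 ψ h x (fun o₁ o₂ o₃ => (K * P * (A * R) +
              (K * P * (1 + 4 * θ ^ 2 - A * R)) * bool (Good i j o₁ o₂ o₃) +
              (-(K * P * θ)) * (bool (Good i j o₁ o₂ o₃) * stat i o₁ o₃)) +
              -1 * (K * P * θ * B * (bool (¬ Good i j o₁ o₂ o₃) * Ψ 0 o₃.1))) := by
              refine avg3_mono ψ h x (fun _ _ _ => abs_active_le ..)
                (fun a b c => (abs_add_le _ _).trans (add_le_add (abs_linear_le i j _ _ _ _ _ _) (by
                  rw [neg_one_mul, abs_neg]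
                  exact hbdF a b c))) fun o₁ o₂ o₃ => ?_
              by_cases hgd : Good i j o₁ o₂ o₃
              · rw [bool_of_true hgd, bool_of_false (not_not.2 hgd)]
                have h1 := hsucc (stat i o₁ o₃) o₃.1
                have h2 := abs_stat_le i o₁ o₃
                have h3 : Real.exp (-θ * stat i o₁ o₃) ≤ 1 + -θ * stat i o₁ o₃ + 4 * θ ^ 2 := by
                  have h4 : (-θ * stat i o₁ o₃) ^ 2 ≤ 4 * θ ^ 2 := by
                    have := pow_le_pow_left₀ (abs_nonneg _) h2 2
                    rw [sq_abs] at this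
                    rw [mul_pow, neg_sq]
                    linarith [mul_le_mul_of_nonneg_left this (sq_nonneg θ)]
                  have := exp_le_quadratic (y := -θ * stat i o₁ o₃) (by
                    rw [abs_mul, abs_neg, abs_of_nonneg hθ]
                    linarith [mul_le_mul_of_nonneg_left h2 hθ])
                  linarith
                have h5 := mul_le_mul_of_nonneg_left h3 hKP
                linarith
              · rw [bool_of_false hgd, bool_of_true hgd]
                have h1 := hbd o₃.1
                linarith
          _ = K * P * (A * R + (1 + 4 * θ ^ 2 - A * R) * p - θ * avg3 ψ h x (fun o₁ o₂ o₃ =>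
                bool (Good i j o₁ o₂ o₃) * stat i o₁ o₃) - θ * B * avg3 ψ h x (fun o₁ o₂ o₃ =>
                bool (¬ Good i j o₁ o₂ o₃) * Ψ 0 o₃.1)) := by
              rw [avg3_add ψ h x (fun _ _ _ => abs_linear_le i j _ _ _ _ _ _) (fun a b c => by
                rw [neg_one_mul, abs_neg]
                exact hbdF a b c), avg3_linear ψ i j hh, avg3_const_mul, avg3_const_mul]
              ring
          _ ≤ _ := by
              refine mul_le_mul_of_nonneg_left ?_ hKP
              have h1 := mul_le_mul_of_nonneg_left (hstat x) hθ
              have h2 := mul_le_mul_of_nonneg_left (hΨ.step_not_good hβ0 hβ1 0 x) hθB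
              rw [← hp] at h2
              dsimp only
              have h3 : A * p = (1 + 2 * ε * θ + 4 * θ ^ 2) * p := by rw [hA]
              linarith
    · push Not at hb
      refine ⟨R, relax β (relax β (relax β Ψ)), hR0, hR1,
        ((hΨ.relax hβ0 hβ1).relax hβ0 hβ1).relax hβ0 hβ1, ?_, fun x => ?_⟩
      · have := hrelax hR0 (by positivity) habove
        rwa [← pow_succ', show next + r - 1 - (b + 1) + 1 = next + r - 1 - b by omega] at this
      · rw [scanProb_wait ψ i j M r _ hh left b next s sum hs hb]
        have hbdF : ∀ y : Config n, |-(K * P * (θ * B)) * Ψ 0 y| ≤ |-(K * P * (θ * B))| * D :=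
          fun y => by
            rw [abs_mul]
            exact mul_le_mul_of_nonneg_left (hD _) (abs_nonneg _)
        calc _ ≤ avg3 ψ h x (fun _ _ o₃ => K * P * (A * R) + -(K * P * (θ * B)) * Ψ 0 o₃.1) :=
              avg3_mono ψ h x (fun _ _ _ => abs_scanProb_le ..) (fun _ _ o₃ =>
                (abs_add_le _ _).trans (add_le_add le_rfl (hbdF o₃.1))) fun o₁ o₂ o₃ => by
                  have := hbd o₃.1
                  linarith
          _ = K * P * (A * R - θ * B * avg3 ψ h x (fun _ _ o₃ => Ψ 0 o₃.1)) := by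
              rw [avg3_add ψ h x (fun _ _ _ => le_rfl) (fun _ _ o₃ => hbdF o₃.1), avg3_const,
                avg3_const_mul]
              ring
          _ ≤ _ := by
              refine mul_le_mul_of_nonneg_left ?_ hKP
              have := mul_le_mul_of_nonneg_left (hΨ.step_univ hβ0 hβ1 0 x) hθB
              linarith

/-- The probability that the sum of the statistics is small. -/
lemma scanProb_lower_le (hh : 0 ≤ h) {θ ε κ β A B c γ : ℝ} {m : ℕ} {g : ℕ → Config n → ℝ}
    (hθ : 0 ≤ θ) (hθ' : 2 * θ ≤ 1) (hβ0 : 0 ≤ β) (hβ1 : β ≤ 1)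
    (hβ : m * (1 - Real.exp (-h)) ≤ β) (hA : A = 1 + 2 * ε * θ + 4 * θ ^ 2)
    (hB : 0 ≤ B) (hc : 0 ≤ c) (hγ : 0 ≤ γ)
    (hcontr : A - θ * B * (c * (1 - m * (Real.exp (-h) ^ 3) ^ (r - 1))) ≤ γ)
    (hg : Admissible ψ h i j β g) (hgc : Above c m 1 g)
    (hstat : ∀ x, goodProb h i j * (B * g 0 x - 2 * ε) ≤
      avg3 ψ h x fun o₁ o₂ o₃ => bool (Good i j o₁ o₂ o₃) * stat i o₁ o₃) (left : ℕ) (hM : 0 < M)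
    (x : Config n) :
    scanProb ψ i j h M r (fun o => ∃ z, o = some z ∧ z < κ) left ⟨0, r, 0, 0⟩ x ≤
      Real.exp (θ * κ) * γ ^ M := by
  obtain ⟨R, Ψ, hR0, hR1, -, habove, hbd⟩ := exists_potential ψ i j M r hh (κ := κ) hθ hθ' hβ0 hβ1
    hβ hA hB hc hγ hcontr hg hgc hstat left 0 r 0 0 hM
  refine (hbd x).trans ?_
  have h1 := habove 0 x
  rw [Nat.sub_zero, Nat.sub_zero] at h1
  have hρ : Real.exp (-h) ^ 3 ≤ 1 := pow_le_one₀ (Real.exp_pos _).le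
    (Real.exp_le_one_iff.2 (by linarith))
  have h2 : (Real.exp (-h) ^ 3) ^ (r + r - 1) ≤ (Real.exp (-h) ^ 3) ^ (r - 1) :=
    pow_le_pow_of_le_one (by positivity) hρ (by omega)
  have h3 : R * c * (1 - m * (Real.exp (-h) ^ 3) ^ (r - 1)) ≤ Ψ 0 x := by
    refine le_trans (mul_le_mul_of_nonneg_left ?_ (mul_nonneg hR0 hc)) h1
    have := mul_le_mul_of_nonneg_left h2 (Nat.cast_nonneg m : (0 : ℝ) ≤ m)
    linarith
  have h4 : A * R - θ * B * Ψ 0 x ≤ γ := by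
    have h5 := mul_le_mul_of_nonneg_left h3 (mul_nonneg hθ hB)
    have h6 := mul_le_mul_of_nonneg_left hcontr hR0
    have h7 := mul_le_of_le_one_left hγ hR1
    linarith
  rw [sub_zero, Nat.sub_zero]
  calc _ ≤ Real.exp (θ * κ) * γ ^ (M - 1) * γ := mul_le_mul_of_nonneg_left h4 (by positivity)
    _ = Real.exp (θ * κ) * γ ^ (M - 1 + 1) := by rw [pow_succ]; ring
    _ = _ := by rw [Nat.sub_add_cancel hM]

end FalseNegative

/-! ## The burn-in for a maximal monomial -/

lemma Hamiltonian.derivs_append (f : Hamiltonian n) (l l' : List (Fin n)) :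
    f.derivs (l ++ l') = (f.derivs l).derivs l' := List.foldl_append ..

section Monomial

variable {ψ : Hamiltonian n} {K : Finset (Fin n)} {i j : Fin n}

/-- Derivatives along the variables of a monomial that contains `i` and `j`, starting with these. -/
def burnDeriv (ψ : Hamiltonian n) (K : Finset (Fin n)) (i j : Fin n) (l : ℕ) : Hamiltonian n :=
  ψ.derivs ([i, j] ++ (((K.erase i).erase j).toList.take l))

lemma burnDeriv_zero : burnDeriv ψ K i j 0 = (ψ.deriv i).deriv j := rfl

lemma supp_burnDeriv (l : ℕ) : (burnDeriv ψ K i j l).supp ⊆ (ψ.deriv i).supp.erase j := by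
  rw [burnDeriv, Hamiltonian.derivs_append]
  exact (Hamiltonian.supp_derivs _ _).trans (Hamiltonian.supp_deriv j (ψ.deriv i))

lemma not_mem_supp_deriv (i : Fin n) : i ∉ (ψ.deriv i).supp := fun hi =>
  Finset.notMem_erase i _ (Hamiltonian.supp_deriv i ψ hi)

lemma burnDeriv_succ {l : ℕ} (hl : l < ((K.erase i).erase j).card) :
    ∃ a, burnDeriv ψ K i j (l + 1) = (burnDeriv ψ K i j l).deriv a := by
  have hl' : l < ((K.erase i).erase j).toList.length := by rwa [Finset.length_toList]
  refine ⟨((K.erase i).erase j).toList[l], ?_⟩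
  rw [burnDeriv, burnDeriv, List.take_succ_eq_append_getElem hl', ← List.append_assoc,
    Hamiltonian.derivs_append]
  rfl

lemma burnDeriv_of_le {l : ℕ} (hl : ((K.erase i).erase j).card ≤ l) :
    burnDeriv ψ K i j l = burnDeriv ψ K i j ((K.erase i).erase j).card := by
  rw [burnDeriv, burnDeriv, List.take_of_length_le (by rwa [Finset.length_toList]),
    List.take_of_length_le (by rw [Finset.length_toList])]

lemma burnDeriv_card_apply (hij : i ≠ j) (hi : i ∈ K) (hj : j ∈ K) (S : Finset (Fin n)) :
    burnDeriv ψ K i j ((K.erase i).erase j).card S = if Disjoint S K then ψ (S ∪ K) else 0 := by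
  have e : ([i, j] ++ ((K.erase i).erase j).toList).toFinset = K := by
    ext a
    simp only [List.mem_toFinset, List.mem_append, List.mem_cons, List.not_mem_nil, or_false,
      Finset.mem_toList, Finset.mem_erase]
    constructor
    · rintro ((rfl | rfl) | h)
      exacts [hi, hj, h.2.2]
    · intro ha
      tauto
  rw [burnDeriv, List.take_of_length_le (by rw [Finset.length_toList]),
    Hamiltonian.derivs_apply _ _ _ S, e]
  simp [hij, Finset.nodup_toList]

/-- Differentiating along all of `K` keeps only the coefficients of supersets of `K`, and maximality
removes all of these except `ψ K`. -/
lemma burnDeriv_card (hK : ψ.IsMaximalMonomial K) (hij : i ≠ j) (hi : i ∈ K) (hj : j ∈ K) :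
    (burnDeriv ψ K i j ((K.erase i).erase j).card).supp = ∅ ∧
      ∀ x, (burnDeriv ψ K i j ((K.erase i).erase j).card).eval x = ψ K := by
  have h0 : ∀ S, S ≠ ∅ → burnDeriv ψ K i j ((K.erase i).erase j).card S = 0 := by
    intro S hS
    rw [burnDeriv_card_apply hij hi hj]
    split_ifs with hd
    · refine hK.2 _ (Finset.ssubset_iff_subset_ne.2 ⟨Finset.subset_union_right, fun e => hS ?_⟩)
      have h1 : S ⊆ K := by
        rw [e]
        exact Finset.subset_union_left
      exact Finset.disjoint_self_iff_empty _ |>.1 (hd.mono_right h1)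
    · rfl
  constructor
  · refine Finset.eq_empty_of_forall_notMem fun a ha => ?_
    obtain ⟨S, hS, haS⟩ := Hamiltonian.mem_supp.1 ha
    exact hS (h0 S (Finset.ne_empty_of_mem haS))
  · intro x
    rw [Hamiltonian.eval_of_supp_empty _ h0, burnDeriv_card_apply hij hi hj]
    simp

/-- Bounds the number of levels by `d`, because the other variables of the monomial all occur in
`∂_i ψ`. This gives the condition `m η ≤ β` of `Above.relax` with `β = d η`. -/
lemma card_erase_le_supp (hK : ψ K ≠ 0) (hi : i ∈ K) :
    ((K.erase i).erase j).card ≤ (ψ.deriv i).supp.card := by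
  refine Finset.card_le_card ((Finset.erase_subset _ _).trans fun a ha => ?_)
  refine Hamiltonian.mem_supp.2 ⟨K.erase i, ?_, ha⟩
  simpa [Hamiltonian.deriv, Finset.insert_erase hi] using hK

/-- The potential for the burn-in. -/
def burnPot (ψ : Hamiltonian n) (K : Finset (Fin n)) (i j : Fin n) (γ : ℝ) (l : ℕ)
    (x : Config n) : ℝ :=
  γ ^ min l ((K.erase i).erase j).card * (burnDeriv ψ K i j l).eval x ^ 2

lemma burnPot_zero (γ : ℝ) (x : Config n) :
    burnPot ψ K i j γ 0 x = ((ψ.deriv i).deriv j).eval x ^ 2 := by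
  simp [burnPot, burnDeriv_zero]

/-- Below the last level the right side is nonpositive; on it the derivative is the constant `ψ K`.
-/
lemma above_burnPot {γ α : ℝ} (hγ : 0 ≤ γ) (hK : ψ.IsMaximalMonomial K) (hij : i ≠ j) (hi : i ∈ K)
    (hj : j ∈ K) (hα : 0 ≤ α) (hαK : α ≤ |ψ K|) :
    Above (γ ^ ((K.erase i).erase j).card * α ^ 2) ((K.erase i).erase j).card 1
      (burnPot ψ K i j γ) := by
  intro l x
  rw [mul_one]
  rcases lt_or_ge l ((K.erase i).erase j).card with hl | hl
  · have h1 : (1 : ℝ) ≤ ((((K.erase i).erase j).card - l : ℕ) : ℝ) := by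
      exact_mod_cast (by omega : 1 ≤ ((K.erase i).erase j).card - l)
    exact (mul_nonpos_of_nonneg_of_nonpos (by positivity) (by linarith)).trans
      (mul_nonneg (by positivity) (by positivity))
  · rw [burnPot, min_eq_right hl, burnDeriv_of_le hl, (burnDeriv_card hK hij hi hj).2,
      Nat.sub_eq_zero_of_le hl, Nat.cast_zero, sub_zero, mul_one, ← sq_abs (ψ K)]
    gcongr

/-- The weights are balanced against `burnIn_step`: with `η = 1 - ρ` and `μ = e^{-2λ} / 2 = d γ`,
level `l + 1` needs the coefficient `d η γ = η μ`, while the step provides `2 η ρ^d μ`, and `ρ^d ≥ 1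
/ 2`. -/
lemma admissible_burnPot {h lam : ℝ} {d : ℕ} (hh : 0 ≤ h) (hd1 : 1 ≤ d)
    (hlam : ∀ i : Fin n, ∑ S, |ψ.deriv i S| ≤ lam) (hd : (ψ.deriv i).supp.card ≤ d)
    (hρ : 1 / 2 ≤ Real.exp (-h) ^ d) (hK : ψ.IsMaximalMonomial K) (hij : i ≠ j) (hi : i ∈ K)
    (hj : j ∈ K) :
    Admissible ψ h i j (d * (1 - Real.exp (-h)))
      (burnPot ψ K i j (Real.exp (-2 * lam) / (2 * d))) where
  nonneg l x := mul_nonneg (by positivity) (sq_nonneg _)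
  step G l x := by
    set γ := Real.exp (-2 * lam) / (2 * d) with hγ
    have hγ0 : 0 < γ := by positivity
    have hη : 0 ≤ 1 - Real.exp (-h) := by
      have := Real.exp_le_one_iff.2 (by linarith : -h ≤ 0)
      linarith
    have hm := fun a (x : Config n) => half_exp_le_upProb hlam a x
    have hm0 : 0 ≤ Real.exp (-2 * lam) / 2 := by positivity
    have hp := patProb_nonneg h i j G
    have hsi : i ∉ (burnDeriv ψ K i j l).supp := fun hmem =>
      not_mem_supp_deriv i (Finset.mem_of_mem_erase (supp_burnDeriv l hmem))
    have hsj : j ∉ (burnDeriv ψ K i j l).supp := fun hmem =>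
      Finset.notMem_erase j _ (supp_burnDeriv l hmem)
    have e : (avg ψ h x fun o => bool (Pattern i j G (traceSites o)) *
        burnPot ψ K i j γ l o.1) = γ ^ min l ((K.erase i).erase j).card * avg ψ h x fun o =>
          bool (Pattern i j G (traceSites o)) * (burnDeriv ψ K i j l).eval o.1 ^ 2 := by
      rw [← avg_const_mul]
      congr 1
      funext o
      rw [burnPot]
      ring
    rw [e]
    rcases lt_or_ge l ((K.erase i).erase j).card with hl | hl
    · obtain ⟨a, ha⟩ := burnDeriv_succ (ψ := ψ) hl
      have h1 := burnIn_step ψ (a := a) (d := d) hh hm0 hm (burnDeriv ψ K i j l) hsi hsj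
        ((Finset.card_le_card ((supp_burnDeriv l).trans (Finset.erase_subset _ _))).trans hd) G x
      refine le_trans ?_ (mul_le_mul_of_nonneg_left h1 (by positivity))
      rw [relax, burnPot, burnPot, min_eq_left hl.le, min_eq_left (by omega : l + 1 ≤ _), ha,
        mul_left_comm (γ ^ l)]
      refine mul_le_mul_of_nonneg_left ?_ hp
      set F := ((burnDeriv ψ K i j l).deriv a).eval x ^ 2
      have hF : 0 ≤ F := sq_nonneg _
      have hdγ : d * γ = Real.exp (-2 * lam) / 2 := by
        rw [hγ]
        field_simp
      have h2 : d * (1 - Real.exp (-h)) * (γ ^ (l + 1) * F) ≤ γ ^ l *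
          ((1 - Real.exp (-h)) * Real.exp (-h) ^ d * (2 * (Real.exp (-2 * lam) / 2)) * F) := by
        calc _ = γ ^ l * (((1 - Real.exp (-h)) * (1 / 2) * (2 * (d * γ))) * F) := by
              rw [pow_succ]
              ring
          _ ≤ _ := by
              rw [hdγ]
              gcongr
      linarith
    · have hc := burnDeriv_card hK hij hi hj
      -- On the last level the polynomial is constant, so the step is used with support bound `0`,
      -- where nothing is lost; the choice of `a` is immaterial.
      have h1 := burnIn_step ψ (a := i) (d := 0) hh hm0 hm (burnDeriv ψ K i j l) hsi hsj
        (by rw [burnDeriv_of_le hl, hc.1, Finset.card_empty]) G x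
      refine le_trans ?_ (mul_le_mul_of_nonneg_left h1 (by positivity))
      rw [relax, burnPot, burnPot, min_eq_right hl, min_eq_right (by omega : _ ≤ l + 1),
        burnDeriv_of_le (by omega : _ ≤ l + 1), ← burnDeriv_of_le hl,
        mul_left_comm _ (patProb h i j G)]
      refine mul_le_mul_of_nonneg_left ?_ hp
      set F := (burnDeriv ψ K i j l).eval x ^ 2
      have h3 : 0 ≤ γ ^ ((K.erase i).erase j).card * ((1 - Real.exp (-h)) * Real.exp (-h) ^ 0 *
          (2 * (Real.exp (-2 * lam) / 2)) * ((burnDeriv ψ K i j l).deriv i).eval x ^ 2) := by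
        positivity
      push_cast
      linarith

end Monomial

/-! ## The probability of a good block -/

lemma patProb_prod {h : ℝ} {i j : Fin n} (hij : i ≠ j) (A B : Set ℕ) :
    patProb h i j {q | q.1 ∈ A ∧ q.2 ∈ B} =
      (clockLaw n).real {w | level h (siteClock i w) ∈ A} *
        (clockLaw n).real {w | level h (siteClock j w) ∈ B} := by
  -- The joint slot is filled with `i` twice, and `j` is treated as a separate site.
  have := clockLaw_level_inter h (i := i) (j := i) {q | q.1 ∈ A} {j} (by simpa using hij)
    (by simpa using hij) fun _ => B
  simpa [patProb] using this

lemma mul_exp_neg_le (y : ℝ) : y * Real.exp (-y) ≤ 1 - Real.exp (-y) := by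
  have h1 := Real.add_one_le_exp y
  have h2 : Real.exp y * Real.exp (-y) = 1 := by rw [← Real.exp_add]; simp
  nlinarith [Real.exp_pos (-y)]

/-- Everything follows from `y e^{-y} ≤ 1 - e^{-y}`. Each outer third contributes `(h / 2)² e^{-h}`
for two updates of `i` and `e^{-h}` for the silence of `j`; the middle third contributes `h e^{-h}`
and `e^{-h}`. -/
lemma le_goodProb {h : ℝ} (hh : 0 ≤ h) {i j : Fin n} (hij : i ≠ j) :
    h ^ 5 / 16 * Real.exp (-(6 * h)) ≤ goodProb h i j := by
  have hO : (h / 2) ^ 2 * Real.exp (-(2 * h)) ≤ patProb h i j outerPat := by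
    have e : outerPat = {q : ℕ × ℕ | q.1 ∈ ({2} : Set ℕ) ∧ q.2 ∈ ({0} : Set ℕ)} := by
      ext ⟨a, b⟩
      simp [outerPat]
    rw [e, patProb_prod hij]
    simp only [Set.mem_singleton_iff]
    rw [clockLaw_level_eq_zero hh]
    have h1 := clockLaw_level_two hh i
    have h2 := pow_le_pow_left₀ (mul_nonneg (by linarith) (Real.exp_pos _).le)
      (mul_exp_neg_le (h / 2)) 2
    calc _ = (h / 2 * Real.exp (-(h / 2))) ^ 2 * Real.exp (-h) := by
          rw [mul_pow, ← Real.exp_nat_mul, mul_assoc, ← Real.exp_add]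
          push_cast
          ring_nf
      _ ≤ _ := mul_le_mul_of_nonneg_right (h2.trans h1) (Real.exp_pos _).le
  have hM : h * Real.exp (-(2 * h)) ≤ patProb h i j middlePat := by
    have e : middlePat = {q : ℕ × ℕ | q.1 ∈ ({0} : Set ℕ) ∧ q.2 ∈ {b : ℕ | b ≠ 0}} := by
      ext ⟨a, b⟩
      simp [middlePat]
    rw [e, patProb_prod hij]
    simp only [Set.mem_singleton_iff, Set.mem_ofPred_eq]
    rw [clockLaw_level_eq_zero hh, clockLaw_level_ne_zero hh]
    calc _ = Real.exp (-h) * (h * Real.exp (-h)) := by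
          rw [show -(2 * h) = -h + -h by ring, Real.exp_add]
          ring
      _ ≤ _ := mul_le_mul_of_nonneg_left (mul_exp_neg_le h) (Real.exp_pos _).le
  have h0 : 0 ≤ (h / 2) ^ 2 * Real.exp (-(2 * h)) := by positivity
  have h1 : 0 ≤ h * Real.exp (-(2 * h)) := by positivity
  calc _ = (h / 2) ^ 2 * Real.exp (-(2 * h)) * (h * Real.exp (-(2 * h))) *
        ((h / 2) ^ 2 * Real.exp (-(2 * h))) := by
        rw [show -(6 * h) = -(2 * h) + -(2 * h) + -(2 * h) by ring, Real.exp_add, Real.exp_add]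
        ring
    _ ≤ _ := mul_le_mul (mul_le_mul hO hM h1 (patProb_nonneg _ _ _ _)) hO h0
        (mul_nonneg (patProb_nonneg _ _ _ _) (patProb_nonneg _ _ _ _))

/-! ## The parameters of the algorithm -/

section Params

variable {k d : ℕ} {α lam : ℝ} (hd : 1 ≤ d) (hα : 0 < α) (hαl : α ≤ lam)

lemma qBurn_pos (hd : 1 ≤ d) (k : ℕ) (lam : ℝ) : 0 < qBurn k d lam := by
  have : (0 : ℝ) < d := by exact_mod_cast hd
  unfold qBurn
  positivity

include hd hα hαl

lemma burn_base_le : Real.exp (-2 * lam) / (2 * d) ≤ 1 / 2 := by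
  have h1 : (1 : ℝ) ≤ d := by exact_mod_cast hd
  have h2 : Real.exp (-2 * lam) ≤ 1 := Real.exp_le_one_iff.2 (by linarith)
  rw [div_le_div_iff₀ (by linarith) two_pos]
  linarith

lemma qBurn_le : qBurn k d lam ≤ 1 / 2 * (1 / 2) ^ (k - 2) := by
  have h0 : 0 ≤ Real.exp (-2 * lam) / (2 * d) := by positivity
  unfold qBurn
  have := pow_le_pow_left₀ h0 (burn_base_le hd hα hαl) (k - 2)
  linarith

omit hα hαl in
lemma mul_blockLength :
    d * blockLength k d α lam = α ^ 2 * qBurn k d lam * Real.exp (-6 * lam) / 64 := by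
  have h1 : (d : ℝ) ≠ 0 := by exact_mod_cast (by omega : d ≠ 0)
  unfold blockLength
  field_simp

omit hα hαl in
-- In the unit `ε = d L`, which bounds the probability of a disturbance by other neighbours, the
-- threshold is `5 ε`: it lies between the mean bound `ε` for non-adjacent pairs and about `30 ε`
-- for adjacent ones.
lemma threshold_eq : threshold k d α lam = 5 * (d * blockLength k d α lam) := by
  rw [mul_blockLength hd, threshold]
  ring

omit hαl in
lemma blockLength_pos : 0 < blockLength k d α lam := by
  have := qBurn_pos hd k lam
  have h1 : (0 : ℝ) < d := by exact_mod_cast hd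
  unfold blockLength
  positivity

omit hd in
-- Here `α ≤ lam` enters, through `α ≤ lam ≤ e^{3 lam}`. It makes `ε` at most `1 / 128`.
lemma sq_mul_exp_le : α ^ 2 * Real.exp (-6 * lam) ≤ 1 := by
  have h1 : α * Real.exp (-3 * lam) ≤ 1 := by
    have h2 := Real.add_one_le_exp (3 * lam)
    have h3 : Real.exp (3 * lam) * Real.exp (-3 * lam) = 1 := by rw [← Real.exp_add]; simp
    nlinarith [Real.exp_pos (-3 * lam)]
  have h2 : Real.exp (-6 * lam) = Real.exp (-3 * lam) ^ 2 := by
    rw [← Real.exp_nat_mul]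
    push_cast
    ring_nf
  rw [h2, ← mul_pow]
  exact pow_le_one₀ (by positivity) h1

lemma mul_blockLength_le : d * blockLength k d α lam ≤ qBurn k d lam / 64 := by
  rw [mul_blockLength hd]
  nlinarith [sq_mul_exp_le hα hαl, qBurn_pos hd k lam]

lemma eps_le : d * blockLength k d α lam ≤ 1 / 128 := by
  have h1 := mul_blockLength_le hd hα hαl (k := k)
  have h2 := qBurn_le hd hα hαl (k := k)
  have h3 : ((1 : ℝ) / 2) ^ (k - 2) ≤ 1 := pow_le_one₀ (by norm_num) (by norm_num)
  linarith

omit hαl in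
lemma blockLength_le : blockLength k d α lam ≤ d * blockLength k d α lam := by
  have h1 : (1 : ℝ) ≤ d := by exact_mod_cast hd
  exact le_mul_of_one_le_left (blockLength_pos hd hα).le h1

omit hαl in
lemma log_le_mul_windowBlocks :
    Real.log (2 * max 1 (2 * ((k : ℝ) - 2))) ≤
      blockLength k d α lam * windowBlocks k d α lam := by
  have h1 := Nat.le_ceil (Real.log (2 * max 1 (2 * ((k : ℝ) - 2))) / blockLength k d α lam)
  rw [div_le_iff₀ (blockLength_pos hd hα)] at h1
  exact h1.trans (mul_comm _ _).le

omit hαl in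
lemma one_le_windowBlocks : 1 ≤ windowBlocks k d α lam := by
  refine Nat.one_le_iff_ne_zero.2 (Nat.ceil_pos.2 (div_pos (Real.log_pos ?_)
    (blockLength_pos hd hα))).ne'
  have : (1 : ℝ) ≤ max 1 (2 * ((k : ℝ) - 2)) := le_max_left _ _
  linarith

lemma windowBlocks_le : windowBlocks k d α lam ≤ 1 + 1 / blockLength k d α lam ^ 2 := by
  set L := blockLength k d α lam with hL
  have hL0 : 0 < L := blockLength_pos hd hα
  have hm : (1 : ℝ) ≤ max 1 (2 * ((k : ℝ) - 2)) := le_max_left _ _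
  have h1 : max 1 (2 * ((k : ℝ) - 2)) ≤ 2 * 2 ^ (k - 2) := by
    refine max_le ?_ ?_
    · have : (1 : ℝ) ≤ 2 ^ (k - 2) := one_le_pow₀ one_le_two
      linarith
    · have h2 : (k : ℝ) - 2 ≤ ((k - 2 : ℕ) : ℝ) := by
        rw [sub_le_iff_le_add]
        exact_mod_cast (by omega : k ≤ k - 2 + 2)
      have h3 : ((k - 2 : ℕ) : ℝ) ≤ 2 ^ (k - 2) := by exact_mod_cast (k - 2).lt_two_pow_self.le
      linarith
  have h2 : Real.log (2 * max 1 (2 * ((k : ℝ) - 2))) ≤ 1 / L := by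
    refine (Real.log_le_self (by linarith)).trans ?_
    rw [le_div_iff₀ hL0]
    have h3 : L ≤ 1 / 2 * (1 / 2) ^ (k - 2) / 64 :=
      (blockLength_le hd hα).trans ((mul_blockLength_le hd hα hαl).trans
        (by linarith [qBurn_le hd hα hαl (k := k)]))
    have h4 : ((1 : ℝ) / 2) ^ (k - 2) * 2 ^ (k - 2) = 1 := by
      rw [← mul_pow]
      norm_num
    calc _ ≤ 2 * (2 * 2 ^ (k - 2)) * (1 / 2 * (1 / 2) ^ (k - 2) / 64) := by gcongr
      _ = ((1 : ℝ) / 2) ^ (k - 2) * 2 ^ (k - 2) / 32 := by ring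
      _ ≤ 1 := by rw [h4]; norm_num
  have h3 := (Nat.ceil_lt_add_one (a := Real.log (2 * max 1 (2 * ((k : ℝ) - 2))) / L)
    (div_nonneg (Real.log_nonneg (by linarith)) hL0.le)).le
  calc _ ≤ Real.log (2 * max 1 (2 * ((k : ℝ) - 2))) / L + 1 := h3
    _ ≤ 1 / L / L + 1 := by gcongr
    _ = _ := by field_simp; ring

omit hαl in
lemma qGood_pos : 0 < qGood k d α lam := by
  have := blockLength_pos hd hα (k := k) (lam := lam)
  unfold qGood
  positivity

/-- The window has at most `1 + L⁻²` blocks, whereas a good block has probability bound of order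
`L⁵`. So the extra initial window in `scanProb_fail_le` is negligible. -/
lemma qGood_mul_le : qGood k d α lam * (windowBlocks k d α lam + 1) ≤ 1 := by
  set L := blockLength k d α lam with hL
  have hL0 : 0 < L := blockLength_pos hd hα
  have hL1 : L ≤ 1 := by
    linarith [eps_le hd hα hαl (k := k), blockLength_le hd hα (k := k) (lam := lam)]
  have h1 := windowBlocks_le hd hα hαl (k := k)
  rw [← hL] at h1
  have h2 : qGood k d α lam = L ^ 5 / 6 ^ 5 := rfl
  have h3 : L ^ 5 / 6 ^ 5 * (1 / L ^ 2) = L ^ 3 / 6 ^ 5 := by field_simp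
  have h4 : L ^ 5 ≤ 1 := pow_le_one₀ hL0.le hL1
  have h5 : L ^ 3 ≤ 1 := pow_le_one₀ hL0.le hL1
  rw [h2]
  calc _ ≤ L ^ 5 / 6 ^ 5 * (1 + 1 / L ^ 2 + 1) := by gcongr
    _ = 2 * L ^ 5 / 6 ^ 5 + L ^ 5 / 6 ^ 5 * (1 / L ^ 2) := by ring
    _ ≤ 1 := by
      rw [h3]
      linarith

lemma exp_neg_blockLength_ge : 1 / 2 ≤ Real.exp (-(2 * blockLength k d α lam)) := by
  have h1 := Real.add_one_le_exp (-(2 * blockLength k d α lam))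
  linarith [eps_le hd hα hαl (k := k), blockLength_le hd hα (k := k) (lam := lam)]

lemma qGood_le_goodProb {i j : Fin n} (hij : i ≠ j) :
    qGood k d α lam ≤ goodProb (blockLength k d α lam / 3) i j := by
  have hL0 : 0 < blockLength k d α lam := blockLength_pos hd hα
  refine le_trans ?_ (le_goodProb (by positivity) hij)
  have h1 := exp_neg_blockLength_ge hd hα hαl (k := k)
  rw [show 6 * (blockLength k d α lam / 3) = 2 * blockLength k d α lam by ring, qGood]
  calc _ = (blockLength k d α lam / 3) ^ 5 / 16 * (1 / 2) := by ring
    _ ≤ _ := by gcongr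

omit hd hα hαl in
lemma exp_pow_eps : (Real.exp (-(blockLength k d α lam / 3)) ^ d) ^ 3 =
    Real.exp (-(d * blockLength k d α lam)) := by
  rw [← Real.exp_nat_mul, ← Real.exp_nat_mul]
  congr 1
  push_cast
  ring

lemma half_le_exp_pow : 1 / 2 ≤ Real.exp (-(blockLength k d α lam / 3)) ^ d := by
  rw [← Real.exp_nat_mul]
  refine le_trans ?_ (Real.add_one_le_exp _)
  have := eps_le hd hα hαl (k := k)
  linarith

/-- The effect of the waiting time. -/
lemma wait_le {m : ℕ} (hm : m ≤ k - 2) :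
    m * (Real.exp (-(blockLength k d α lam / 3)) ^ 3) ^ (windowBlocks k d α lam - 1) ≤ 1 / 2 := by
  set L := blockLength k d α lam with hL
  rcases Nat.eq_zero_or_pos m with rfl | hm0
  · norm_num
  have hk : 3 ≤ k := by omega
  have hmax : max 1 (2 * ((k : ℝ) - 2)) = 2 * ((k : ℝ) - 2) := by
    refine max_eq_right ?_
    have : (3 : ℝ) ≤ k := by exact_mod_cast hk
    linarith
  have hk' : (3 : ℝ) ≤ k := by exact_mod_cast hk
  have hmk : (m : ℝ) ≤ k - 2 := by
    have : ((m + 2 : ℕ) : ℝ) ≤ k := by exact_mod_cast (by omega : m + 2 ≤ k)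
    push_cast at this
    linarith
  have h1 := log_le_mul_windowBlocks hd hα (k := k) (lam := lam)
  rw [hmax, ← hL] at h1
  -- Having `r - 1` blocks of burn-in instead of `r` costs the factor `e^L ≤ 2`. The argument `4 (k
  -- - 2)` of the logarithm in `r` covers it and still leaves `1 / 2`.
  have e : (Real.exp (-(L / 3)) ^ 3) ^ (windowBlocks k d α lam - 1) =
      Real.exp L * Real.exp (-(L * windowBlocks k d α lam)) := by
    rw [← Real.exp_nat_mul, ← Real.exp_nat_mul, ← Real.exp_add,
      Nat.cast_sub (one_le_windowBlocks hd hα)]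
    congr 1
    push_cast
    ring
  have h2 : Real.exp (-(L * windowBlocks k d α lam)) ≤ (2 * (2 * ((k : ℝ) - 2)))⁻¹ := by
    rw [← Real.exp_log (by linarith : (0 : ℝ) < 2 * (2 * ((k : ℝ) - 2))), ← Real.exp_neg]
    exact Real.exp_le_exp.2 (by linarith)
  have h3 : Real.exp L ≤ 2 := by
    have h4 := exp_neg_blockLength_ge hd hα hαl (k := k)
    have h5 : Real.exp L * Real.exp (-L) = 1 := by rw [← Real.exp_add]; simp
    have h6 : Real.exp (-(2 * L)) ≤ Real.exp (-L) :=
      Real.exp_le_exp.2 (by linarith [blockLength_pos hd hα (k := k) (lam := lam)])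
    have h7 := Real.exp_pos L
    nlinarith
  rw [e]
  calc _ ≤ ((k : ℝ) - 2) * (2 * (2 * (2 * ((k : ℝ) - 2)))⁻¹) := by gcongr; linarith
    _ = 1 / 2 := by
      have : (k : ℝ) - 2 ≠ 0 := by linarith
      field_simp

end Params

/-! ### Error probabilities of one pair with the chosen parameters -/

section Stops

variable {k d : ℕ} {α lam δ : ℝ} (hd : 1 ≤ d) (hα : 0 < α) (hαl : α ≤ lam) (hn : 2 ≤ n)
  (hδ : 0 < δ) (hδ1 : δ ≤ 1)

include hn hδ hδ1 in
lemma two_le_log : 2 ≤ Real.log (2 * (n : ℝ) ^ 2 / δ) := by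
  have h1 : (8 : ℝ) ≤ 2 * (n : ℝ) ^ 2 / δ := by
    rw [le_div_iff₀ hδ]
    have : (2 : ℝ) ≤ n := by exact_mod_cast hn
    nlinarith
  rw [Real.le_log_iff_exp_le (by linarith)]
  have h2 := Real.exp_one_lt_d9
  have h3 : Real.exp 2 = Real.exp 1 * Real.exp 1 := by rw [← Real.exp_add]; norm_num
  nlinarith [Real.exp_pos 1]

include hd hα in
-- With `κ = 5 ε` the number `2000 / κ²` becomes `80 / ε²`.
lemma le_numStops_mul : 80 * Real.log (2 * (n : ℝ) ^ 2 / δ) ≤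
    numStops n k d α lam δ * (d * blockLength k d α lam) ^ 2 := by
  have h1 := Nat.le_ceil (2000 * Real.log (2 * (n : ℝ) ^ 2 / δ) / threshold k d α lam ^ 2)
  have h2 : 0 < d * blockLength k d α lam :=
    lt_of_lt_of_le (blockLength_pos hd hα) (blockLength_le hd hα)
  rw [threshold_eq hd, div_le_iff₀ (by positivity)] at h1
  have h3 : (numStops n k d α lam δ : ℝ) = (⌈2000 * Real.log (2 * (n : ℝ) ^ 2 / δ) /
    (5 * (d * blockLength k d α lam)) ^ 2⌉₊ : ℝ) := by rw [numStops, threshold_eq hd]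
  rw [← h3] at h1
  linarith

include hd hα hαl in
lemma le_numStops : 80 * Real.log (2 * (n : ℝ) ^ 2 / δ) ≤ numStops n k d α lam δ := by
  have h1 := le_numStops_mul (n := n) (δ := δ) hd hα (k := k) (lam := lam)
  have h2 := eps_le hd hα hαl (k := k)
  have h3 : 0 < d * blockLength k d α lam :=
    lt_of_lt_of_le (blockLength_pos hd hα) (blockLength_le hd hα)
  refine h1.trans (mul_le_of_le_one_right (Nat.cast_nonneg _) ?_)
  exact pow_le_one₀ h3.le (by linarith)

include hd hα hαl hn hδ hδ1 in
lemma numStops_pos : 0 < numStops n k d α lam δ := by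
  have h1 := le_numStops (n := n) (δ := δ) (k := k) hd hα hαl
  have h2 := two_le_log hn hδ hδ1
  have h3 : (0 : ℝ) < numStops n k d α lam δ := by linarith
  exact_mod_cast h3

variable {ψ : Hamiltonian n} (hψ : IsMRF k d α lam ψ) {i j : Fin n} (hij : i ≠ j)

include hd hα hαl hn hδ hδ1 hij in
/-- It is unlikely that there are not enough stopping times. -/
lemma scanProb_fail_le (x : Config n) :
    scanProb ψ i j (blockLength k d α lam / 3) (numStops n k d α lam δ) (windowBlocks k d α lam)
      (fun o => o = none) (params n k d α lam δ).blocks ⟨0, windowBlocks k d α lam, 0, 0⟩ x ≤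
      Real.exp (-(2 * Real.log (2 * (n : ℝ) ^ 2 / δ))) := by
  have hL0 : 0 < blockLength k d α lam := blockLength_pos hd hα
  have hq0 := qGood_pos hd hα (k := k) (lam := lam)
  have hM0 := numStops_pos (k := k) hd hα hαl hn hδ hδ1
  have hr0 := one_le_windowBlocks hd hα (k := k) (lam := lam)
  have hM1 := le_numStops (n := n) (δ := δ) (k := k) hd hα hαl
  have hlog := two_le_log hn hδ hδ1
  have hqr := qGood_mul_le hd hα hαl (k := k)
  have hq := qGood_le_goodProb hd hα hαl (k := k) hij
  have hq1 : qGood k d α lam ≤ 1 := hq.trans (goodProb_le_one _ _ _)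
  refine (scanProb_none_le ψ i j _ _ (by positivity) hq0.le hq _ _ _ _ _ _ hM0).trans ?_
  have hB : (numStops n k d α lam δ : ℝ) * windowBlocks k d α lam +
      2 * numStops n k d α lam δ / qGood k d α lam - 1 ≤ (params n k d α lam δ).blocks := by
    have h1 := (Nat.lt_floor_add_one (horizon n k d α lam δ / blockLength k d α lam)).le
    rw [show horizon n k d α lam δ / blockLength k d α lam =
      (numStops n k d α lam δ : ℝ) * windowBlocks k d α lam +
      2 * numStops n k d α lam δ / qGood k d α lam by
        rw [horizon]
        field_simp] at h1
    have h2 : ((params n k d α lam δ).blocks : ℝ) = (⌊(numStops n k d α lam δ : ℝ) *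
        windowBlocks k d α lam + 2 * numStops n k d α lam δ / qGood k d α lam⌋₊ : ℝ) := by
      rw [params, horizon]
      field_simp
    linarith
  generalize (params n k d α lam δ).blocks = B at *
  generalize numStops n k d α lam δ = M at *
  generalize windowBlocks k d α lam = r at *
  generalize qGood k d α lam = q at *
  set W := (r + r - 1 - 0) + (M - 0 - 1) * (r - 1) with hW
  -- Waiting consumes `2 r - 1` blocks initially and `r - 1` blocks before each of the other `M - 1`
  -- stopping times.
  have hWr : (W : ℝ) = M * r - M + r := by
    obtain ⟨M, rfl⟩ : ∃ M', M = M' + 1 := ⟨M - 1, by omega⟩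
    obtain ⟨r, rfl⟩ : ∃ r', r = r' + 1 := ⟨r - 1, by omega⟩
    rw [hW, show r + 1 + (r + 1) - 1 - 0 = 2 * r + 1 by omega]
    simp only [Nat.sub_zero, Nat.add_sub_cancel]
    push_cast
    ring
  have hsub : (B : ℝ) - W ≤ ((B - W : ℕ) : ℝ) := by
    rw [sub_le_iff_le_add]
    exact_mod_cast (by omega : B ≤ B - W + W)
  have h1 : (1 - q / 2) ^ (B - W) ≤ Real.exp (-((M : ℝ) - 1)) := by
    calc _ ≤ Real.exp (-(q / 2)) ^ (B - W) := by
          refine pow_le_pow_left₀ (by linarith) ?_ _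
          linarith [Real.add_one_le_exp (-(q / 2))]
      _ = Real.exp (-(q / 2 * ((B - W : ℕ) : ℝ))) := by
          rw [← Real.exp_nat_mul]
          ring_nf
      _ ≤ _ := by
          refine Real.exp_le_exp.2 (neg_le_neg ?_)
          have h2 : q / 2 * (2 * M / q) = M := by field_simp
          have h3 : q / 2 * ((2 * M / q) + (M - r - 1)) ≤ q / 2 * ((B - W : ℕ) : ℝ) :=
            mul_le_mul_of_nonneg_left (by linarith) (by linarith)
          have h4 : 0 ≤ q * (M : ℝ) := by positivity
          linarith
  have h2 : (2 : ℝ) ^ (M - 0) = Real.exp (M * Real.log 2) := by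
    rw [Nat.sub_zero, Real.exp_nat_mul, Real.exp_log two_pos]
  rw [h2]
  calc _ ≤ Real.exp (M * Real.log 2) * Real.exp (-((M : ℝ) - 1)) :=
        mul_le_mul_of_nonneg_left h1 (Real.exp_pos _).le
    _ = Real.exp (M * Real.log 2 + -((M : ℝ) - 1)) := (Real.exp_add _ _).symm
    _ ≤ _ := by
        -- Since `log 2 < 0.7`, a fixed fraction of `M` remains in the exponent, and `M` is at least
        -- `80` times the logarithm.
        refine Real.exp_le_exp.2 ?_
        have h3 := Real.log_two_lt_d9
        nlinarith

include hd hα hψ in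
lemma le_avg3_stat_params (i j : Fin n) (x : Config n) :
    goodProb (blockLength k d α lam / 3) i j *
      ((1 - d * blockLength k d α lam) * (Real.exp (-6 * lam) / 2) *
        ((ψ.deriv i).deriv j).eval x ^ 2 - 2 * (d * blockLength k d α lam)) ≤
      avg3 ψ (blockLength k d α lam / 3) x
        fun o₁ o₂ o₃ => bool (Good i j o₁ o₂ o₃) * stat i o₁ o₃ := by
  refine le_avg3_stat i j (div_nonneg (blockLength_pos hd hα).le (by norm_num)) (hψ.junta i) ?_
    hψ.width_le x
  rw [exp_pow_eps]
  linarith [Real.add_one_le_exp (-(d * blockLength k d α lam))]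

include hd hα hαl hn hδ hδ1 hψ in
/-- It is unlikely that non-adjacent sites are declared adjacent. -/
lemma scanProb_upper_le_exp (hadj : ¬ (dependencyGraph ψ).Adj i j) (left : ℕ) (x : Config n) :
    scanProb ψ i j (blockLength k d α lam / 3) (numStops n k d α lam δ) (windowBlocks k d α lam)
      (fun o => ∃ z, o = some z ∧ threshold k d α lam * numStops n k d α lam δ ≤ z)
      left ⟨0, windowBlocks k d α lam, 0, 0⟩ x ≤
      Real.exp (-(2 * Real.log (2 * (n : ℝ) ^ 2 / δ))) := by
  set ε := d * blockLength k d α lam with hε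
  have hL0 : 0 < blockLength k d α lam := blockLength_pos hd hα
  have hε0 : 0 < ε := lt_of_lt_of_le hL0 (blockLength_le hd hα)
  have hε1 := eps_le hd hα hαl (k := k)
  have hM := le_numStops_mul (n := n) (δ := δ) hd hα (k := k) (lam := lam)
  rw [← hε] at hM hε1
  have hlog := two_le_log hn hδ hδ1
  -- The choice `θ = ε / 2` makes the total exponent `M (θ ε + 4 θ² - 5 θ ε) = -M ε²`.
  have key := scanProb_upper_le ψ i j (numStops n k d α lam δ) (windowBlocks k d α lam)
    (h := blockLength k d α lam / 3) (θ := ε / 2) (ε := ε)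
    (κ := threshold k d α lam * numStops n k d α lam δ) (by positivity) (by positivity)
    (by linarith) hε0.le (fun x => avg3_stat_le_of_not_adj i j (by positivity) (hψ.junta i) (by
      rw [exp_pow_eps]
      linarith [Real.add_one_le_exp (-(d * blockLength k d α lam))]) hadj x) left 0
    (windowBlocks k d α lam) 0 0 x (Nat.zero_le _)
  refine key.trans ?_
  rw [← Real.exp_nat_mul, ← Real.exp_add, threshold_eq hd, ← hε, Nat.sub_zero]
  refine Real.exp_le_exp.2 ?_
  nlinarith

include hd hα hαl hn hδ hδ1 hψ in
/-- It is unlikely that adjacent sites are declared non-adjacent. -/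
lemma scanProb_lower_le_exp (hadj : (dependencyGraph ψ).Adj i j) (left : ℕ) (x : Config n) :
    scanProb ψ i j (blockLength k d α lam / 3) (numStops n k d α lam δ) (windowBlocks k d α lam)
      (fun o => ∃ z, o = some z ∧ z < threshold k d α lam * numStops n k d α lam δ)
      left ⟨0, windowBlocks k d α lam, 0, 0⟩ x ≤
      Real.exp (-(2 * Real.log (2 * (n : ℝ) ^ 2 / δ))) := by
  obtain ⟨K, hK, hi, hj, hαK⟩ := hψ.edge_coeff i j hadj
  have hij : i ≠ j := hadj.ne
  set ε := d * blockLength k d α lam with hε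
  have hL0 : 0 < blockLength k d α lam := blockLength_pos hd hα
  have hε0 : 0 < ε := lt_of_lt_of_le hL0 (blockLength_le hd hα)
  have hε1 := eps_le hd hα hαl (k := k)
  have hM := le_numStops_mul (n := n) (δ := δ) hd hα (k := k) (lam := lam)
  rw [← hε] at hM hε1
  have hlog := two_le_log hn hδ hδ1
  have hh : 0 ≤ blockLength k d α lam / 3 := by positivity
  set m := ((K.erase i).erase j).card with hm
  have hmd : m ≤ d := (card_erase_le_supp hK.1 hi).trans (hψ.junta i)
  have hmk : m ≤ k - 2 := by
    have h1 := hψ.degree_le K hK.1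
    rw [hm, Finset.card_erase_of_mem (Finset.mem_erase.2 ⟨hij.symm, hj⟩),
      Finset.card_erase_of_mem hi]
    omega
  set γ := Real.exp (-2 * lam) / (2 * d) with hγ
  have hd0 : (0 : ℝ) < d := by exact_mod_cast hd
  have hγ0 : 0 < γ := by positivity
  set ρ := Real.exp (-(blockLength k d α lam / 3)) with hρ
  have hρ1 : ρ ≤ 1 := Real.exp_le_one_iff.2 (by linarith)
  have hβ1 : d * (1 - ρ) ≤ 1 := by
    have := Real.add_one_le_exp (-(blockLength k d α lam / 3))
    nlinarith
  have hwait := wait_le hd hα hαl hmk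
  -- Half of `γ^m α²` survives by `wait_le`, and `m ≤ k - 2` makes this at least `α² q`.
  have hq : α ^ 2 * qBurn k d lam ≤ γ ^ m * α ^ 2 *
      (1 - m * (ρ ^ 3) ^ (windowBlocks k d α lam - 1)) := by
    have h1 : γ ^ (k - 2) ≤ γ ^ m := pow_le_pow_of_le_one hγ0.le
      ((burn_base_le hd hα hαl).trans (by norm_num)) hmk
    have h2 : qBurn k d lam ≤ 1 / 2 * γ ^ m := mul_le_mul_of_nonneg_left h1 (by norm_num)
    calc _ ≤ α ^ 2 * (1 / 2 * γ ^ m) := mul_le_mul_of_nonneg_left h2 (sq_nonneg α)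
      _ = γ ^ m * α ^ 2 * (1 / 2) := by ring
      _ ≤ _ := mul_le_mul_of_nonneg_left (by linarith) (by positivity)
  have hεq : Real.exp (-6 * lam) * (α ^ 2 * qBurn k d lam) = 64 * ε := by
    rw [hε, mul_blockLength hd]
    ring
  -- With `θ = ε` one has `A = 1 + 6 ε²`, and the burn-in term is at least `32 ε² (1 - ε)`. As `ε ≤
  -- 1 / 128`, each stopping time gives a factor at most `1 - 25 ε² ≤ e^{-25 ε²}`, which beats the
  -- weight `e^{5 ε²}` coming from the threshold.
  have key := scanProb_lower_le ψ i j (numStops n k d α lam δ) (windowBlocks k d α lam)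
    (h := blockLength k d α lam / 3) (θ := ε) (ε := ε) (β := d * (1 - ρ)) (m := m)
    (A := 1 + 2 * ε * ε + 4 * ε ^ 2) (B := (1 - ε) * (Real.exp (-6 * lam) / 2))
    (c := γ ^ m * α ^ 2) (γ := Real.exp (-(25 * ε ^ 2))) (g := burnPot ψ K i j γ)
    (κ := threshold k d α lam * numStops n k d α lam δ) hh hε0.le
    (by linarith) (mul_nonneg hd0.le (by linarith)) hβ1
    (mul_le_mul_of_nonneg_right (by exact_mod_cast hmd) (by linarith)) rfl
    (mul_nonneg (by linarith) (by positivity)) (by positivity) (Real.exp_pos _).le (by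
      have h1 := mul_le_mul_of_nonneg_left hq
        (mul_nonneg hε0.le (mul_nonneg (by linarith : 0 ≤ 1 - ε)
          (by positivity : 0 ≤ Real.exp (-6 * lam) / 2)))
      have h2 : ε * ((1 - ε) * (Real.exp (-6 * lam) / 2)) * (α ^ 2 * qBurn k d lam) =
          32 * ε ^ 2 * (1 - ε) := by
        calc _ = ε * (1 - ε) / 2 * (Real.exp (-6 * lam) * (α ^ 2 * qBurn k d lam)) := by ring
          _ = _ := by rw [hεq]; ring
      have h3 := Real.add_one_le_exp (-(25 * ε ^ 2))
      rw [h2] at h1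
      have h4 : ε ^ 3 ≤ ε ^ 2 / 128 := by nlinarith [sq_nonneg ε]
      nlinarith)
    (admissible_burnPot hh hd hψ.width_le (hψ.junta i) (half_le_exp_pow hd hα hαl) hK hij hi hj)
    (above_burnPot hγ0.le hK hij hi hj hα.le hαK) (fun x => by
      rw [burnPot_zero]
      exact le_avg3_stat_params hd hα hψ i j x) left
    (numStops_pos hd hα hαl hn hδ hδ1) x
  refine key.trans ?_
  rw [← Real.exp_nat_mul, ← Real.exp_add, threshold_eq hd, ← hε]
  refine Real.exp_le_exp.2 ?_
  nlinarith

end Stops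

/-! ## The result of the algorithm -/

lemma pair_sublist_or {V : Type*} {l : List V} {a b : V} (ha : a ∈ l) (hb : b ∈ l) (hab : a ≠ b) :
    [a, b].Sublist l ∨ [b, a].Sublist l := by
  induction l with
  | nil => simp at ha
  | cons c l ih =>
    rcases List.mem_cons.1 ha with rfl | ha'
    · have hb' : b ∈ l := (List.mem_cons.1 hb).resolve_left hab.symm
      exact Or.inl ((List.singleton_sublist.2 hb').cons_cons _)
    · rcases List.mem_cons.1 hb with rfl | hb'
      · exact Or.inr ((List.singleton_sublist.2 ha').cons_cons _)
      · exact (ih ha' hb').imp (fun h => h.cons _) fun h => h.cons _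

section Run

variable (k d : ℕ) (α lam δ : ℝ) (ψ : Hamiltonian n)

/-- The result of the scan for the pair `i, j` leads to a failure or to a wrong decision. -/
def Wrong (i j : Fin n) (o : Option ℝ) : Prop :=
  o = none ∨
    (¬ (dependencyGraph ψ).Adj i j ∧
      ∃ z, o = some z ∧ threshold k d α lam * numStops n k d α lam δ ≤ z) ∨
    ((dependencyGraph ψ).Adj i j ∧
      ∃ z, o = some z ∧ z < threshold k d α lam * numStops n k d α lam δ)

/-- The result of the scan for the pair `i, j`. -/
def pairScan (i j : Fin n) (x : Config n) (ω : Drive n) : Option ℝ :=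
  noiseScan ψ i j (blockLength k d α lam / 3) (numStops n k d α lam δ) (windowBlocks k d α lam)
    (params n k d α lam δ).blocks ⟨0, windowBlocks k d α lam, 0, 0⟩ x ω

variable {k d α lam δ ψ}

section
variable (hd : 1 ≤ d) (hα : 0 < α) (hαl : α ≤ lam) (hn : 2 ≤ n) (hδ : 0 < δ) (hδ1 : δ ≤ 1)
include hd hα

lemma measurableSet_wrong (i j : Fin n) (x : Config n) :
    MeasurableSet {ω | Wrong k d α lam δ ψ i j (pairScan k d α lam δ ψ i j x ω)} :=
  measurableSet_noiseScan ψ i j _ _ _ (div_nonneg (blockLength_pos hd hα).le (by norm_num)) _ _ _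

include hαl hn hδ hδ1 in
lemma real_wrong_le (hψ : IsMRF k d α lam ψ) {i j : Fin n} (hij : i ≠ j) (x : Config n) :
    (driveLaw n).real {ω | Wrong k d α lam δ ψ i j (pairScan k d α lam δ ψ i j x ω)} ≤
      2 * Real.exp (-(2 * Real.log (2 * (n : ℝ) ^ 2 / δ))) := by
  have h1 := scanProb_fail_le (ψ := ψ) (k := k) hd hα hαl hn hδ hδ1 hij x
  rw [two_mul]
  by_cases hadj : (dependencyGraph ψ).Adj i j
  · have h2 := scanProb_lower_le_exp hd hα hαl hn hδ hδ1 hψ hadj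
      (params n k d α lam δ).blocks x
    refine le_trans ?_ (add_le_add h1 h2)
    refine le_trans (measureReal_mono ?_) (measureReal_union_le _ _)
    intro ω hω
    rcases hω with h | h | h
    · exact Or.inl h
    · exact absurd hadj h.1
    · exact Or.inr h.2
  · have h2 := scanProb_upper_le_exp hd hα hαl hn hδ hδ1 hψ hadj
      (params n k d α lam δ).blocks x
    refine le_trans ?_ (add_le_add h1 h2)
    refine le_trans (measureReal_mono ?_) (measureReal_union_le _ _)
    intro ω hω
    rcases hω with h | h | h
    · exact Or.inl h
    · exact Or.inr h.2
    · exact absurd h.1 hadj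

lemma blocks_mul_le (n : ℕ) (δ : ℝ) :
    (params n k d α lam δ).blocks * (params n k d α lam δ).L ≤ horizon n k d α lam δ := by
  have hL0 : 0 < blockLength k d α lam := blockLength_pos hd hα
  have hq0 := qGood_pos hd hα (k := k) (lam := lam)
  have h0 : 0 ≤ horizon n k d α lam δ := by
    unfold horizon
    positivity
  have h1 := Nat.floor_le (div_nonneg h0 hL0.le)
  rwa [le_div_iff₀ hL0] at h1

include hαl hn hδ hδ1 in
open Classical in
lemma Regular.testPair_siteRecord {x : Config n} {ω : Drive n} (hω : Regular ω.1) {i j : Fin n}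
    (hw : ¬ Wrong k d α lam δ ψ i j (pairScan k d α lam δ ψ i j x ω)) :
    (testPair (params n k d α lam δ) (siteRecord ψ (x, ω) (horizon n k d α lam δ) i)
      (siteRecord ψ (x, ω) (horizon n k d α lam δ) j)).val =
      some (decide ((dependencyGraph ψ).Adj i j)) := by
  have hL0 : 0 < blockLength k d α lam := blockLength_pos hd hα
  have hM : (0 : ℝ) < numStops n k d α lam δ := by
    exact_mod_cast numStops_pos hd hα hαl hn hδ hδ1
  have h1 := Regular.scan_val ψ i j (params n k d α lam δ) (h := blockLength k d α lam / 3)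
    (by positivity) (by simp only [params]; ring) (params n k d α lam δ).blocks
    ⟨0, windowBlocks k d α lam, 0, 0⟩ x ω (horizon n k d α lam δ) hω (blocks_mul_le hd hα n δ)
  have e : ∀ i : Fin n, recordFrom ψ (((0 : ℕ) : ℝ) * (params n k d α lam δ).L)
      (horizon n k d α lam δ) x ω i = siteRecord ψ (x, ω) (horizon n k d α lam δ) i := by
    intro i
    simp [recordFrom]
  simp only [e] at h1
  have h2 : (testPair (params n k d α lam δ) (siteRecord ψ (x, ω) (horizon n k d α lam δ) i)
      (siteRecord ψ (x, ω) (horizon n k d α lam δ) j)).val =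
      (pairScan k d α lam δ ψ i j x ω).map fun z =>
        decide (threshold k d α lam ≤ z / numStops n k d α lam δ) := by
    rw [testPair_val]
    exact congrArg _ h1
  rw [h2]
  simp only [Wrong, not_or, not_and, not_exists] at hw
  cases hs : pairScan k d α lam δ ψ i j x ω with
  | none => exact absurd hs hw.1
  | some z =>
    simp only [Option.map_some, Option.some.injEq, decide_eq_decide]
    rw [le_div_iff₀ hM]
    constructor
    · intro hz
      by_contra hadj
      exact hw.2.1 hadj z hs hz
    · intro hadj
      exact not_lt.1 (hw.2.2 hadj z hs)

include hαl hn hδ hδ1 in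
lemma Regular.run_val {x : Config n} {ω : Drive n} (hω : Regular ω.1)
    (hw : ∀ i j, i ≠ j → ¬ Wrong k d α lam δ ψ i j (pairScan k d α lam δ ψ i j x ω))
    (S : Finset (Fin n)) :
    ∃ E, (run k d α lam δ ψ S (x, ω)).val = some E ∧ edgeGraph E = inducedGraph ψ S := by
  classical
  obtain ⟨E, hE, hmem⟩ := testAll_val (params n k d α lam δ)
    (fun a b : S => decide ((dependencyGraph ψ).Adj a b))
    (observation ψ S (horizon n k d α lam δ) (x, ω)) [] (by
      rw [observation, List.pairwise_map]
      refine (Finset.sort_nodup (Finset.univ : Finset S) (· ≤ ·)).imp fun {a b} hab => ?_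
      exact hω.testPair_siteRecord hd hα hαl hn hδ hδ1
        (hw a b fun h => hab (Subtype.ext h)))
  refine ⟨E, hE, ?_⟩
  have e : (observation ψ S (horizon n k d α lam δ) (x, ω)).map Prod.fst =
      (Finset.univ : Finset S).sort (· ≤ ·) := by
    rw [observation, List.map_map]
    exact List.map_id _
  ext a b
  rw [edgeGraph, SimpleGraph.fromRel_adj, hmem, hmem, e]
  simp only [List.not_mem_nil, false_or, decide_eq_true_eq, inducedGraph, SimpleGraph.comap_adj]
  constructor
  · rintro ⟨-, h | h⟩
    · exact h.1
    · exact h.1.symm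
  · intro h
    have hab : a ≠ b := fun e => h.ne (congrArg _ e)
    refine ⟨hab, ?_⟩
    rcases pair_sublist_or (l := (Finset.univ : Finset S).sort (· ≤ ·)) (a := a) (b := b) (by simp)
      (by simp) hab with h' | h'
    · exact Or.inl ⟨h, h'⟩
    · exact Or.inr ⟨h.symm, h'⟩

end

/-! ## The running time -/

lemma Regular.length_siteRecord_le {x : Config n} {ω : Drive n} (hω : Regular ω.1) {T : ℝ}
    {i : Fin n} {N : ℕ} (hN : T < arr ω.1 (i, N)) : (siteRecord ψ (x, ω) T i).length ≤ N := by
  rw [siteRecord, List.length_map, List.length_range, numUpdates]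
  have : {m : ℕ | updateTime (x, ω) (i, m) ≤ T} ⊆ (Finset.range N : Set ℕ) := by
    intro m hm
    rw [Finset.coe_range, Set.mem_Iio]
    by_contra hle
    have h1 : arr ω.1 (i, m) ≤ T := hm
    rcases (not_lt.1 hle).eq_or_lt with rfl | hlt
    · linarith
    · linarith [hω.mono i hlt]
  refine (Set.ncard_le_ncard this (Finset.finite_toSet _)).trans ?_
  rw [Set.ncard_coe_finset, Finset.card_range]

lemma Regular.run_cost_le {x : Config n} {ω : Drive n} (hω : Regular ω.1) {N : ℕ}
    (hN : ∀ i, horizon n k d α lam δ < arr ω.1 (i, N)) (S : Finset (Fin n)) :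
    (run k d α lam δ ψ S (x, ω)).cost ≤ 102 + k +
      n * (n * (74 * (params n k d α lam δ).blocks + 59 + 8 * N) + 6) := by
  have hlen : (observation ψ S (horizon n k d α lam δ) (x, ω)).length ≤ n := by
    simp only [observation, List.length_map, Finset.length_sort]
    simpa using S.card_le_univ
  have h1 := testAll_cost (params n k d α lam δ) (74 * (params n k d α lam δ).blocks + 54 + 8 * N) n
    (observation ψ S (horizon n k d α lam δ) (x, ω)) [] hlen (by
      intro q hq q' hq'
      obtain ⟨a, -, rfl⟩ := List.mem_map.1 hq
      obtain ⟨b, -, rfl⟩ := List.mem_map.1 hq'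
      refine (testPair_cost _ _ _).trans ?_
      have h2 := hω.length_siteRecord_le (ψ := ψ) (x := x) (hN a)
      have h3 := hω.length_siteRecord_le (ψ := ψ) (x := x) (hN b)
      dsimp only
      omega)
  have h2 := Nat.mul_le_mul_right (n * (74 * (params n k d α lam δ).blocks + 54 + 8 * N + 5) + 6)
    hlen
  have h3 : (run k d α lam δ ψ S (x, ω)).cost = (100 + k) + (testAll (params n k d α lam δ)
    (observation ψ S (horizon n k d α lam δ) (x, ω)) []).cost := rfl
  rw [h3]
  have e : 74 * (params n k d α lam δ).blocks + 54 + 8 * N + 5 =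
    74 * (params n k d α lam δ).blocks + 59 + 8 * N := by ring
  rw [e] at h1 h2
  omega

end Run

/-! ## Learning the graph from the dynamics -/

section Constants

variable {k d : ℕ} {α lam δ : ℝ} (hd : 1 ≤ d) (hα : 0 < α) (hαl : α ≤ lam) (hn : 2 ≤ n)
  (hδ : 0 < δ) (hδ1 : δ ≤ 1)

include hn hδ hδ1

lemma one_le_two_mul_log : 1 ≤ 2 * Real.log (n / δ) := by
  have h1 : Real.log 2 ≤ Real.log (n / δ) := by
    refine Real.log_le_log two_pos ?_
    rw [le_div_iff₀ hδ]
    have : (2 : ℝ) ≤ n := by exact_mod_cast hn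
    linarith
  linarith [Real.log_two_gt_d9]

lemma log_two_sq_le : Real.log (2 * (n : ℝ) ^ 2 / δ) ≤ 3 * Real.log (n / δ) := by
  have hn' : (2 : ℝ) ≤ n := by exact_mod_cast hn
  rw [← Nat.cast_ofNat (n := 3), ← Real.log_pow]
  refine Real.log_le_log (by positivity) ?_
  rw [div_pow, div_le_div_iff₀ hδ (by positivity)]
  have h1 : δ ^ 3 ≤ δ := pow_le_of_le_one hδ.le hδ1 (by norm_num)
  calc 2 * (n : ℝ) ^ 2 * δ ^ 3 ≤ n * (n : ℝ) ^ 2 * δ := by gcongr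
    _ = _ := by ring

lemma log_two_mul_le : Real.log (2 * (n : ℝ) / δ) ≤ 2 * Real.log (n / δ) := by
  have hn' : (2 : ℝ) ≤ n := by exact_mod_cast hn
  rw [← Nat.cast_ofNat (n := 2), ← Real.log_pow]
  refine Real.log_le_log (by positivity) ?_
  rw [div_pow, div_le_div_iff₀ hδ (by positivity)]
  have h1 : δ ^ 2 ≤ δ := pow_le_of_le_one hδ.le hδ1 (by norm_num)
  calc ((2 : ℕ) : ℝ) * (n : ℝ) * δ ^ 2 ≤ n * (n : ℝ) * δ := by
        push_cast
        gcongr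
    _ = _ := by ring

end Constants

/-- The constant in the bound for the length of the trajectory. -/
def timeConst (k d : ℕ) (α lam : ℝ) : ℝ :=
  blockLength k d α lam * (windowBlocks k d α lam + 2 / qGood k d α lam) *
    (6000 / threshold k d α lam ^ 2 + 2)

/-- The constant in the main theorem. -/
def mainConst (k d : ℕ) (α lam : ℝ) : ℝ :=
  timeConst k d α lam * (17 + 74 / blockLength k d α lam) + 2 * k + 1000

section Main

variable {k d : ℕ} {α lam δ : ℝ} (hd : 1 ≤ d) (hα : 0 < α) (hαl : α ≤ lam) (hn : 2 ≤ n)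
  (hδ : 0 < δ) (hδ1 : δ ≤ 1)

include hd hα

lemma timeConst_nonneg : 0 ≤ timeConst k d α lam := by
  have h1 := blockLength_pos hd hα (k := k) (lam := lam)
  have h2 := qGood_pos hd hα (k := k) (lam := lam)
  unfold timeConst
  positivity

lemma mainConst_pos : 0 < mainConst k d α lam := by
  have h1 := blockLength_pos hd hα (k := k) (lam := lam)
  have h2 := timeConst_nonneg hd hα (k := k) (lam := lam)
  unfold mainConst
  positivity

include hn hδ hδ1

lemma horizon_le : horizon n k d α lam δ ≤ timeConst k d α lam * Real.log (n / δ) := by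
  have h1 := blockLength_pos hd hα (k := k) (lam := lam)
  have h2 := qGood_pos hd hα (k := k) (lam := lam)
  have h3 := one_le_two_mul_log hn hδ hδ1
  have h4 := log_two_sq_le hn hδ hδ1
  have h5 := two_le_log hn hδ hδ1
  -- `6000 = 3 · 2000` comes from `log (2 n² / δ) ≤ 3 log (n / δ)`, and the `2` from rounding up, as
  -- `1 ≤ 2 log (n / δ)`.
  have h6 : (numStops n k d α lam δ : ℝ) ≤
      (6000 / threshold k d α lam ^ 2 + 2) * Real.log (n / δ) := by
    refine (Nat.ceil_lt_add_one (by positivity)).le.trans ?_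
    calc _ ≤ 2000 * (3 * Real.log (n / δ)) / threshold k d α lam ^ 2 + 2 * Real.log (n / δ) := by
          gcongr
      _ = _ := by ring
  calc _ = blockLength k d α lam * (windowBlocks k d α lam + 2 / qGood k d α lam) *
        numStops n k d α lam δ := by rw [horizon]; ring
    _ ≤ blockLength k d α lam * (windowBlocks k d α lam + 2 / qGood k d α lam) *
        ((6000 / threshold k d α lam ^ 2 + 2) * Real.log (n / δ)) := by gcongr
    _ = _ := by rw [timeConst]; ring

lemma horizon_le_main : horizon n k d α lam δ ≤ mainConst k d α lam * Real.log (n / δ) := by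
  have h1 := blockLength_pos hd hα (k := k) (lam := lam)
  have h2 := timeConst_nonneg hd hα (k := k) (lam := lam)
  have h3 := one_le_two_mul_log hn hδ hδ1
  refine (horizon_le hd hα hn hδ hδ1).trans (mul_le_mul_of_nonneg_right ?_ (by linarith))
  rw [mainConst]
  have h4 : 0 ≤ timeConst k d α lam * (16 + 74 / blockLength k d α lam) := by positivity
  have h5 : (0 : ℝ) ≤ k := Nat.cast_nonneg k
  linarith

omit hn hδ hδ1 in
lemma horizon_nonneg (n : ℕ) (δ : ℝ) : 0 ≤ horizon n k d α lam δ := by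
  have h1 := blockLength_pos hd hα (k := k) (lam := lam)
  have h2 := qGood_pos hd hα (k := k) (lam := lam)
  unfold horizon
  positivity

omit hd hα hn hδ hδ1 in
/-- A bound for the number of updates of a site that holds with high probability. -/
def maxUpdates (n k d : ℕ) (α lam δ : ℝ) : ℕ :=
  ⌈2 * (horizon n k d α lam δ + Real.log (2 * n / δ))⌉₊

lemma maxUpdates_le : (maxUpdates n k d α lam δ : ℝ) ≤
    (2 * timeConst k d α lam + 6) * Real.log (n / δ) := by
  have h1 := horizon_le hd hα hn hδ hδ1 (k := k) (lam := lam)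
  have h2 := log_two_mul_le hn hδ hδ1
  have h3 := one_le_two_mul_log hn hδ hδ1
  have hn' : (2 : ℝ) ≤ n := by exact_mod_cast hn
  have h4 : 0 ≤ Real.log (2 * n / δ) := Real.log_nonneg (by
    rw [le_div_iff₀ hδ]
    linarith)
  have h5 := horizon_nonneg hd hα n δ (k := k) (lam := lam)
  have := (Nat.ceil_lt_add_one (a := 2 * (horizon n k d α lam δ + Real.log (2 * n / δ)))
    (by positivity)).le
  have h6 : (maxUpdates n k d α lam δ : ℝ) ≤
    2 * (horizon n k d α lam δ + Real.log (2 * n / δ)) + 1 := this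
  linarith

/-- In the Chernoff bound `e^T 2^{-(N + 1)}` the number `N` is at least `2 (T + log (2 n / δ))`;
because `log 2 > 1 / 2`, the power `2^{-N}` absorbs `e^T` and leaves `δ / (2 n)`. -/
lemma real_arr_le (i : Fin n) :
    (clockLaw n).real {w | arr w (i, maxUpdates n k d α lam δ) ≤ horizon n k d α lam δ} ≤
      δ / (2 * n) / 2 := by
  have hn' : (2 : ℝ) ≤ n := by exact_mod_cast hn
  refine (clockLaw_arr_le i _ _).trans ?_
  have h1 := Nat.le_ceil (2 * (horizon n k d α lam δ + Real.log (2 * n / δ)))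
  rw [← maxUpdates] at h1
  have h5 := horizon_nonneg hd hα n δ (k := k) (lam := lam)
  have h4 : 0 ≤ Real.log (2 * n / δ) := Real.log_nonneg (by
    rw [le_div_iff₀ hδ]
    linarith)
  have h2 : ((1 : ℝ) / 2) ^ maxUpdates n k d α lam δ ≤
      Real.exp (-(horizon n k d α lam δ + Real.log (2 * n / δ))) := by
    have e : ((1 : ℝ) / 2) = Real.exp (-Real.log 2) := by
      rw [Real.exp_neg, Real.exp_log two_pos, one_div]
    rw [e, ← Real.exp_nat_mul]
    refine Real.exp_le_exp.2 ?_
    have h3 := Real.log_two_gt_d9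
    nlinarith
  rw [pow_succ]
  calc _ ≤ Real.exp (horizon n k d α lam δ) *
        (Real.exp (-(horizon n k d α lam δ + Real.log (2 * n / δ))) * (1 / 2)) := by gcongr
    _ = Real.exp (-Real.log (2 * n / δ)) * (1 / 2) := by
        rw [← mul_assoc, ← Real.exp_add]
        ring_nf
    _ = _ := by
        rw [Real.exp_neg, Real.exp_log (by positivity), inv_div]
        ring

lemma cost_const_le : ((102 + k + n * (n * (74 * (params n k d α lam δ).blocks + 59 +
      8 * maxUpdates n k d α lam δ) + 6) : ℕ) : ℝ) ≤
    mainConst k d α lam * (n : ℝ) ^ 2 * Real.log (n / δ) := by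
  have hn' : (2 : ℝ) ≤ n := by exact_mod_cast hn
  have hL0 := blockLength_pos hd hα (k := k) (lam := lam)
  have h1 := maxUpdates_le hd hα hn hδ hδ1 (k := k) (lam := lam)
  have h2 := horizon_le hd hα hn hδ hδ1 (k := k) (lam := lam)
  have h3 := one_le_two_mul_log hn hδ hδ1
  have hC := timeConst_nonneg hd hα (k := k) (lam := lam)
  have hB : ((params n k d α lam δ).blocks : ℝ) ≤
      timeConst k d α lam / blockLength k d α lam * Real.log (n / δ) := by
    rw [div_mul_eq_mul_div, le_div_iff₀ hL0]
    exact (blocks_mul_le hd hα n δ).trans h2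
  set ℓ := Real.log (n / δ)
  set B := ((params n k d α lam δ).blocks : ℝ)
  set N := (maxUpdates n k d α lam δ : ℝ)
  have hk : (0 : ℝ) ≤ k := Nat.cast_nonneg k
  have hn2 : (n : ℝ) ≤ n ^ 2 := by nlinarith
  have hn1 : (1 : ℝ) ≤ n ^ 2 := by nlinarith
  push_cast
  calc (102 : ℝ) + k + n * (n * (74 * B + 59 + 8 * N) + 6)
      = (102 + k) * 1 + n ^ 2 * (74 * B + 59 + 8 * N) + 6 * n := by ring
    _ ≤ (102 + k) * n ^ 2 + n ^ 2 * (74 * B + 59 + 8 * N) + 6 * n ^ 2 := by gcongr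
    _ = n ^ 2 * (74 * B + 8 * N + (167 + k) * 1) := by ring
    _ ≤ n ^ 2 * (74 * (timeConst k d α lam / blockLength k d α lam * ℓ) +
        8 * ((2 * timeConst k d α lam + 6) * ℓ) + (167 + k) * (2 * ℓ)) := by gcongr
    _ = n ^ 2 * ((timeConst k d α lam * (16 + 74 / blockLength k d α lam) + 2 * k + 382) * ℓ) := by
        ring
    _ ≤ n ^ 2 * (mainConst k d α lam * ℓ) := by
        refine mul_le_mul_of_nonneg_left (mul_le_mul_of_nonneg_right ?_ (by linarith))
          (by positivity)
        rw [mainConst]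
        linarith
    _ = _ := by ring

omit hd hα in
-- This is `2 a² ≤ a` for `a = δ / (2 n²) ≤ 1 / 2`, the error allotted to one ordered pair.
lemma exp_neg_two_log_le : 2 * Real.exp (-(2 * Real.log (2 * (n : ℝ) ^ 2 / δ))) ≤
    δ / (2 * n ^ 2) := by
  have hn' : (2 : ℝ) ≤ n := by exact_mod_cast hn
  have h0 : 0 < δ / (2 * (n : ℝ) ^ 2) := by positivity
  have e : Real.exp (-Real.log (2 * (n : ℝ) ^ 2 / δ)) = δ / (2 * n ^ 2) := by
    rw [Real.exp_neg, Real.exp_log (by positivity), inv_div]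
  have h1 : δ / (2 * (n : ℝ) ^ 2) ≤ 1 / 2 := by
    rw [div_le_div_iff₀ (by positivity) two_pos]
    nlinarith
  rw [show -(2 * Real.log (2 * (n : ℝ) ^ 2 / δ)) = -Real.log (2 * (n : ℝ) ^ 2 / δ) +
    -Real.log (2 * (n : ℝ) ^ 2 / δ) by ring, Real.exp_add, e]
  nlinarith

/-- The driving noise for which some pair is treated wrongly or some site is updated too often. -/
def badSet (k d : ℕ) (α lam δ : ℝ) (ψ : Hamiltonian n) (x : Config n) : Set (Drive n) :=
  (⋃ p : Fin n × Fin n, {ω | p.1 ≠ p.2 ∧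
      Wrong k d α lam δ ψ p.1 p.2 (pairScan k d α lam δ ψ p.1 p.2 x ω)}) ∪
    ⋃ i : Fin n, {ω | arr ω.1 (i, maxUpdates n k d α lam δ) ≤ horizon n k d α lam δ}

omit hn hδ hδ1 in
lemma measurableSet_badSet (ψ : Hamiltonian n) (x : Config n) :
    MeasurableSet (badSet k d α lam δ ψ x) := by
  refine (MeasurableSet.iUnion fun p => ?_).union (MeasurableSet.iUnion fun i => ?_)
  · exact (MeasurableSet.const (p.1 ≠ p.2)).inter (measurableSet_wrong hd hα p.1 p.2 x)
  · exact measurableSet_le ((measurable_arr _).comp measurable_fst) measurable_const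

include hαl in
lemma real_badSet_le {ψ : Hamiltonian n} (hψ : IsMRF k d α lam ψ) (x : Config n) :
    (driveLaw n).real (badSet k d α lam δ ψ x) ≤ δ := by
  have hn' : (2 : ℝ) ≤ n := by exact_mod_cast hn
  -- The wrong decisions receive `δ / 2` in total, the long records `δ / 4`.
  refine (measureReal_union_le _ _).trans ?_
  have h1 : (driveLaw n).real (⋃ p : Fin n × Fin n, {ω | p.1 ≠ p.2 ∧
      Wrong k d α lam δ ψ p.1 p.2 (pairScan k d α lam δ ψ p.1 p.2 x ω)}) ≤ δ / 2 := by
    refine (measureReal_iUnion_fintype_le _).trans ?_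
    calc _ ≤ ∑ _p : Fin n × Fin n, δ / (2 * (n : ℝ) ^ 2) := by
          refine Finset.sum_le_sum fun p _ => ?_
          by_cases hp : p.1 = p.2
          · rw [show {ω : Drive n | p.1 ≠ p.2 ∧ Wrong k d α lam δ ψ p.1 p.2
                (pairScan k d α lam δ ψ p.1 p.2 x ω)} = ∅ by
              ext ω
              simp [hp], measureReal_empty]
            positivity
          · refine le_trans (measureReal_mono fun ω hω => ?_)
              ((real_wrong_le hd hα hαl hn hδ hδ1 hψ hp x).trans (exp_neg_two_log_le hn hδ hδ1))
            exact hω.2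
      _ = δ / 2 := by
          rw [Finset.sum_const, Finset.card_univ, Fintype.card_prod, Fintype.card_fin,
            nsmul_eq_mul]
          push_cast
          field_simp
  have h2 : (driveLaw n).real (⋃ i : Fin n,
      {ω | arr ω.1 (i, maxUpdates n k d α lam δ) ≤ horizon n k d α lam δ}) ≤ δ / 4 := by
    refine (measureReal_iUnion_fintype_le _).trans ?_
    calc _ ≤ ∑ _i : Fin n, δ / (2 * n) / 2 := by
          refine Finset.sum_le_sum fun i _ => ?_
          have hm : MeasurableSet {w : Clocks n |
              arr w (i, maxUpdates n k d α lam δ) ≤ horizon n k d α lam δ} :=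
            measurableSet_le (measurable_arr _) measurable_const
          have e := (measurePreserving_fst (μ := clockLaw n) (ν := markLaw n)).measureReal_preimage
            hm.nullMeasurableSet
          exact le_of_eq_of_le e (real_arr_le hd hα hn hδ hδ1 i)
      _ = δ / 4 := by
          rw [Finset.sum_const, Finset.card_univ, Fintype.card_fin, nsmul_eq_mul]
          field_simp
          norm_num
  linarith

include hαl in
-- The bad set is small for every fixed initial configuration, hence by Fubini under every initial
-- law. Measurability of the success event is avoided: it contains the complement of the measurable
-- bad set, up to the null set of irregular clocks.
theorem learning_from_dynamics {ψ : Hamiltonian n} (hψ : IsMRF k d α lam ψ) (S : Finset (Fin n))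
    (ν : Measure (Config n)) [IsProbabilityMeasure ν] :
    1 - δ ≤ (noiseLaw ν).real
      {ω | (∃ E, (run k d α lam δ ψ S ω).val = some E ∧ edgeGraph E = inducedGraph ψ S) ∧
        ((run k d α lam δ ψ S ω).cost : ℝ) ≤
          mainConst k d α lam * (n : ℝ) ^ 2 * Real.log (n / δ)} := by
  set A := {ω : Noise n | (∃ E, (run k d α lam δ ψ S ω).val = some E ∧
    edgeGraph E = inducedGraph ψ S) ∧ ((run k d α lam δ ψ S ω).cost : ℝ) ≤
      mainConst k d α lam * (n : ℝ) ^ 2 * Real.log (n / δ)} with hA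
  have hlaw : noiseLaw ν = ν.prod (driveLaw n) := rfl
  rw [hlaw]
  set B : Set (Config n × Drive n) := {p | p.2 ∈ badSet k d α lam δ ψ p.1} with hB
  have hBm : MeasurableSet B := by
    have : B = ⋃ x, {x} ×ˢ badSet k d α lam δ ψ x := by
      ext p
      simp [hB]
    rw [this]
    exact MeasurableSet.iUnion fun x =>
      (MeasurableSet.of_discrete).prod (measurableSet_badSet hd hα ψ x)
  have hBle : (ν.prod (driveLaw n)).real B ≤ δ := by
    rw [measureReal_def, Measure.prod_apply hBm]
    refine ENNReal.toReal_le_of_le_ofReal hδ.le ?_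
    calc _ ≤ ∫⁻ _x, ENNReal.ofReal δ ∂ν := by
          refine lintegral_mono fun x => ?_
          have := real_badSet_le hd hα hαl hn hδ hδ1 hψ x
          rw [measureReal_def] at this
          exact (ENNReal.le_ofReal_iff_toReal_le (measure_ne_top _ _) hδ.le).2 this
      _ = _ := by simp
  have hsub : (Bᶜ : Set (Config n × Drive n)) ≤ᵐ[ν.prod (driveLaw n)] A := by
    have hreg : ∀ᵐ p ∂ν.prod (driveLaw n), Regular p.2.1 :=
      Measure.quasiMeasurePreserving_snd.ae ae_regular_drive
    filter_upwards [hreg] with p hp hpB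
    have hnb : p.2 ∉ badSet k d α lam δ ψ p.1 := hpB
    simp only [badSet, Set.mem_union, Set.mem_iUnion, not_or, not_exists] at hnb
    refine ⟨?_, ?_⟩
    · exact hp.run_val (x := p.1) hd hα hαl hn hδ hδ1 (fun i j hij hw => hnb.1 (i, j) ⟨hij, hw⟩) S
    · refine le_trans ?_ (cost_const_le hd hα hn hδ hδ1)
      have := hp.run_cost_le (ψ := ψ) (x := p.1) (k := k) (d := d) (α := α) (lam := lam) (δ := δ)
        (N := maxUpdates n k d α lam δ) (fun i => not_le.1 fun h => hnb.2 i h) S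
      exact_mod_cast this
  calc 1 - δ ≤ 1 - (ν.prod (driveLaw n)).real B := by linarith
    _ = (ν.prod (driveLaw n)).real Bᶜ := (probReal_compl_eq_one_sub hBm).symm
    _ ≤ _ := ENNReal.toReal_mono (measure_ne_top _ _) (measure_mono_ae hsub)

end Main

/-! ## Independent samples -/

lemma parity_eval (n : ℕ) (x : Config n) : (parity n).eval x = ∏ i, ((x i : ℤ) : ℝ) := by
  rw [Hamiltonian.eval, Finset.sum_eq_single Finset.univ]
  · simp [parity]
  · intro S _ hS
    simp [parity, hS]
  · simp

lemma constOne_eval (n : ℕ) (x : Config n) : (constOne n).eval x = 1 := by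
  rw [Hamiltonian.eval, Finset.sum_eq_single ∅]
  · simp [constOne]
  · intro S _ hS
    simp [constOne, hS]
  · simp

/-- The configuration that is `y` on the sites other than `v` and `s` at `v`. -/
def extend (v : Fin n) (y : others v → ℤˣ) (s : ℤˣ) : Config n :=
  fun a => if h : a ∈ others v then y ⟨a, h⟩ else s

lemma extend_self (v : Fin n) (y : others v → ℤˣ) (s : ℤˣ) : extend v y s v = s := by
  simp [extend, others]

lemma extend_coe (v : Fin n) (y : others v → ℤˣ) (s : ℤˣ) (a : others v) :
    extend v y s a = y a := by
  simp [extend]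

lemma eq_extend {v : Fin n} {y : others v → ℤˣ} {x : Config n} (h : y = fun i : others v => x i) :
    x = extend v y (x v) := by
  subst h
  funext a
  by_cases ha : a = v
  · rw [ha, extend_self]
  · rw [extend, dif_pos (show a ∈ others v from Finset.mem_erase.2 ⟨ha, Finset.mem_univ a⟩)]

lemma marginal_apply (ψ : Hamiltonian n) (v : Fin n) (y : others v → ℤˣ) :
    marginal ψ (others v) y = mrf ψ (extend v y 1) + mrf ψ (extend v y (-1)) := by
  classical
  rw [marginal, PMF.map_apply, tsum_fintype]
  refine Eq.trans (b := ∑ x with y = fun i : others v => x i, mrf ψ x)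
    (by rw [Finset.sum_filter]; congr!) ?_
  have hne : extend v y 1 ≠ extend v y (-1) := fun h => by
    have := congrFun h v
    rw [extend_self, extend_self] at this
    exact absurd this (by decide)
  rw [← Finset.sum_pair hne]
  congr 1
  ext x
  simp only [Finset.mem_filter, Finset.mem_univ, true_and, Finset.mem_insert, Finset.mem_singleton]
  constructor
  · intro h
    have h1 := eq_extend h
    rcases Int.units_eq_one_or (x v) with h2 | h2
    · rw [h2] at h1
      exact Or.inl h1
    · rw [h2] at h1
      exact Or.inr h1
  · rintro (rfl | rfl) <;> exact funext fun a => (extend_coe v y _ a).symm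

lemma eq_uniformOfFintype {β : Type*} [Fintype β] [Nonempty β] (p : PMF β) (c : ENNReal)
    (h : ∀ b, p b = c) : p = PMF.uniformOfFintype β := by
  ext b
  rw [h, PMF.uniformOfFintype_apply]
  have h1 := p.tsum_coe
  simp only [h, tsum_fintype, Finset.sum_const, Finset.card_univ, nsmul_eq_mul] at h1
  rw [mul_comm] at h1
  exact ENNReal.eq_inv_of_mul_eq_one_left h1

/-- Flipping `x_v` flips the parity, so every observed configuration gets the two weights `e` and
`e^{-1}`, in one order or the other. -/
lemma marginal_parity (v : Fin n) :
    marginal (parity n) (others v) = PMF.uniformOfFintype (others v → ℤˣ) := by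
  refine eq_uniformOfFintype _ ((ENNReal.ofReal (Real.exp 1) + ENNReal.ofReal (Real.exp (-1))) *
    (∑' x : Config n, ENNReal.ofReal (Real.exp ((parity n).eval x)))⁻¹) fun y => ?_
  rw [marginal_apply, mrf, PMF.normalize_apply, PMF.normalize_apply, ← add_mul]
  congr 1
  have e : ∀ s, (parity n).eval (extend v y s) =
      ((s : ℤ) : ℝ) * ∏ a ∈ Finset.univ.erase v, ((extend v y 1 a : ℤ) : ℝ) := by
    intro s
    rw [parity_eval, ← Finset.mul_prod_erase _ _ (Finset.mem_univ v), extend_self]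
    congr 1
    refine Finset.prod_congr rfl fun a ha => ?_
    rw [extend_coe v y s ⟨a, ha⟩, extend_coe v y 1 ⟨a, ha⟩]
  have h1 : ∀ F : Finset (Fin n), ∏ a ∈ F, ((extend v y 1 a : ℤ) : ℝ) = 1 ∨
      ∏ a ∈ F, ((extend v y 1 a : ℤ) : ℝ) = -1 := by
    intro F
    have : ∏ a ∈ F, ((extend v y 1 a : ℤ) : ℝ) = (((∏ a ∈ F, extend v y 1 a : ℤˣ) : ℤ) : ℝ) := by
      push_cast
      rfl
    rw [this]
    rcases Int.units_eq_one_or (∏ a ∈ F, extend v y 1 a) with h | h <;> simp [h]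
  rw [e 1, e (-1)]
  rcases h1 (Finset.univ.erase v) with h | h
  · rw [h]
    norm_num
  · rw [h, add_comm]
    norm_num

lemma marginal_constOne (v : Fin n) :
    marginal (constOne n) (others v) = PMF.uniformOfFintype (others v → ℤˣ) := by
  refine eq_uniformOfFintype _ ((ENNReal.ofReal (Real.exp 1) + ENNReal.ofReal (Real.exp 1)) *
    (∑' x : Config n, ENNReal.ofReal (Real.exp ((constOne n).eval x)))⁻¹) fun y => ?_
  rw [marginal_apply, mrf, PMF.normalize_apply, PMF.normalize_apply, ← add_mul, constOne_eval,
    constOne_eval]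

lemma deriv_parity (i : Fin n) (S : Finset (Fin n)) :
    (parity n).deriv i S = if S = Finset.univ.erase i then 1 else 0 := by
  unfold Hamiltonian.deriv parity
  by_cases hi : i ∈ S
  · rw [if_pos hi, if_neg]
    rintro rfl
    simp at hi
  · rw [if_neg hi]
    refine if_congr ⟨fun h => ?_, fun h => ?_⟩ rfl rfl
    · rw [← h, Finset.erase_insert hi]
    · rw [h, Finset.insert_erase (Finset.mem_univ i)]

lemma deriv_constOne (i : Fin n) (S : Finset (Fin n)) : (constOne n).deriv i S = 0 := by
  simp [Hamiltonian.deriv, constOne]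

lemma adj_parity {i j : Fin n} (hij : i ≠ j) : (dependencyGraph (parity n)).Adj i j :=
  Hamiltonian.mem_supp.2 ⟨Finset.univ.erase i, by rw [deriv_parity, if_pos rfl]; norm_num,
    Finset.mem_erase.2 ⟨hij.symm, Finset.mem_univ j⟩⟩

lemma not_adj_constOne (i j : Fin n) : ¬ (dependencyGraph (constOne n)).Adj i j := fun h => by
  obtain ⟨S, hS, -⟩ := Hamiltonian.mem_supp.1 h
  exact hS (deriv_constOne i S)

lemma isMRF_parity (n : ℕ) : IsMRF n (n - 1) 1 1 (parity n) where
  degree_le S _ := by simpa using S.card_le_univ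
  junta i := by
    refine (Finset.card_le_card ((Hamiltonian.supp_deriv i _).trans
      (Finset.erase_subset_erase i (Finset.subset_univ _)))).trans ?_
    simp
  edge_coeff i j _ := ⟨Finset.univ, ⟨by simp [parity], fun T hT =>
    absurd (Finset.subset_univ T) hT.2⟩, Finset.mem_univ i, Finset.mem_univ j, by simp [parity]⟩
  width_le i := by
    rw [Finset.sum_eq_single (Finset.univ.erase i)]
    · simp [deriv_parity]
    · intro S _ hS
      simp [deriv_parity, hS]
    · simp

lemma isMRF_constOne (n : ℕ) : IsMRF n (n - 1) 1 1 (constOne n) where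
  degree_le S hS := by
    have : S = ∅ := by
      by_contra h
      exact hS (if_neg h)
    simp [this]
  junta i := by
    have : ((constOne n).deriv i).supp = ∅ := Finset.eq_empty_of_forall_notMem fun j hj =>
      not_adj_constOne i j hj
    simp [this]
  edge_coeff i j h := absurd h (not_adj_constOne i j)
  width_le i := by simp [deriv_constOne]

lemma inducedGraph_ne (hn : 3 ≤ n) (v : Fin n) :
    inducedGraph (parity n) (others v) ≠ inducedGraph (constOne n) (others v) := by
  intro h
  have hcard : 1 < (others v).card := by
    rw [others, Finset.card_erase_of_mem (Finset.mem_univ v), Finset.card_univ, Fintype.card_fin]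
    omega
  obtain ⟨a, ha, b, hb, hab⟩ := Finset.one_lt_card.1 hcard
  have h1 : (inducedGraph (parity n) (others v)).Adj ⟨a, ha⟩ ⟨b, hb⟩ := adj_parity hab
  rw [h] at h1
  exact not_adj_constOne a b h1

/-- The samples have the same law under both models, and for each sample the two distinct target
graphs share the total mass of the single distribution `A x`. -/
lemma iidSuccess_add_le (hn : 3 ≤ n) (v : Fin n) (m : ℕ)
    (A : (Fin m → others v → ℤˣ) → PMF (SimpleGraph (others v))) :
    iidSuccess (parity n) (others v) m A + iidSuccess (constOne n) (others v) m A ≤ 1 := by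
  classical
  rw [iidSuccess, iidSuccess, marginal_parity, marginal_constOne, ← Finset.sum_add_distrib]
  calc _ ≤ ∑ x : Fin m → others v → ℤˣ, ∏ t, PMF.uniformOfFintype (others v → ℤˣ) (x t) := by
        refine Finset.sum_le_sum fun x _ => ?_
        rw [← mul_add]
        refine mul_le_of_le_one_right' ?_
        rw [← Finset.sum_pair (inducedGraph_ne hn v)]
        exact (ENNReal.sum_le_tsum _).trans (A x).tsum_coe.le
    _ = 1 := by
        have h1 := Finset.prod_univ_sum (fun _ : Fin m => (Finset.univ : Finset (others v → ℤˣ)))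
          fun _ y => PMF.uniformOfFintype (others v → ℤˣ) y
        rw [Fintype.piFinset_univ] at h1
        rw [← h1]
        have h2 := (PMF.uniformOfFintype (others v → ℤˣ)).tsum_coe
        rw [tsum_fintype] at h2
        simp only [h2, Finset.prod_const_one]

end GlauberMRF

end

theorem mainTheorem4 :
    -- learning the induced dependency graph from the partially observed dynamics
    (∀ (k d : ℕ) (α lam : ℝ), 1 ≤ d → 0 < α → α ≤ lam →
      ∃ C : ℝ, 0 < C ∧ ∀ (n : ℕ) (δ : ℝ), 2 ≤ n → 0 < δ → δ ≤ 1 →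
        horizon n k d α lam δ ≤ C * Real.log (n / δ) ∧
        ∀ (ψ : Hamiltonian n), IsMRF k d α lam ψ → ∀ (S : Finset (Fin n))
          (ν : MeasureTheory.Measure (Config n)), MeasureTheory.IsProbabilityMeasure ν →
          1 - δ ≤ (noiseLaw ν).real
            {ω | (∃ E, (run k d α lam δ ψ S ω).val = some E ∧
                    edgeGraph E = inducedGraph ψ S) ∧
                  ((run k d α lam δ ψ S ω).cost : ℝ) ≤ C * (n : ℝ) ^ 2 * Real.log (n / δ)}) ∧
    -- with one unobserved site the observed marginals of two fields coincide
    (∀ (n : ℕ) (v : Fin n),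
      marginal (parity n) (others v) = PMF.uniformOfFintype (others v → ℤˣ) ∧
      marginal (constOne n) (others v) = PMF.uniformOfFintype (others v → ℤˣ)) ∧
    -- so the induced dependency graph cannot be learned from independent samples
    (∀ (n : ℕ) (v : Fin n), 3 ≤ n →
      IsMRF n (n - 1) 1 1 (parity n) ∧ IsMRF n (n - 1) 1 1 (constOne n) ∧
      inducedGraph (parity n) (others v) ≠ inducedGraph (constOne n) (others v) ∧
      ∀ (m : ℕ) (A : (Fin m → others v → ℤˣ) → PMF (SimpleGraph (others v))),
        iidSuccess (parity n) (others v) m A + iidSuccess (constOne n) (others v) m A ≤ 1) := by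
  refine ⟨fun k d α lam hd hα hαl => ⟨mainConst k d α lam, mainConst_pos hd hα,
    fun n δ hn hδ hδ1 => ⟨horizon_le_main hd hα hn hδ hδ1, fun ψ hψ S ν hν => ?_⟩⟩,
    fun n v => ⟨marginal_parity v, marginal_constOne v⟩, fun n v hn => ⟨isMRF_parity n,
      isMRF_constOne n, inducedGraph_ne hn v, iidSuccess_add_le hn v⟩⟩
  exact learning_from_dynamics hd hα hαl hn hδ hδ1 hψ S ν
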